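/- Let $\mathbf C$ be an infinitary pretopos, i.e. a Barr exact category with small coproducts which are disjoint and stable under pullback. Formulas about elements of objects of $\mathbf C$ are understood for generalized elements, and $\exists$ means existence after passing to a cover (an epimorphism onto the domain). Let $R$ be a (not necessarily unital) associative ring object in $\mathbf C$ which is \emph{weakly unital}: there is a subobject $\mathcal E \subseteq R$ such that - $\mathcal E$ is closed under multiplication and central in $R$; - for all $\varepsilon, \eta \in \mathcal E$ there are $\zeta, \varepsilon', \eta' \in \mathcal E$ with $\varepsilon = \varepsilon' \zeta$ and $\eta = \eta' \zeta$; - the multiplications $\mathcal E \times \mathcal E \to \mathcal E$ and $R \times \mathcal E \to R$ are epimorphisms; - if $m \in R$, $\varepsilon \in \mathcal E$ and $m \varepsilon = 0$, then there are $\varepsilon', \varepsilon'' \in \mathcal E$ with $\varepsilon = \varepsilon' \varepsilon''$ and $m \varepsilon' = 0$. Let $\mathrm{St}(\mathsf A_3, R)$ be the group object in $\mathbf C$ with generators $x_{ij}(p)$ for distinct $i, j \in \{1, 2, 3, 4\}$ and $p \in R$, and relations $$x_{ij}(p)\, x_{ij}(q) = x_{ij}(p + q),$$ $$[x_{ij}(p),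 x_{jk}(q)] = x_{ik}(p q) \quad (i \neq k),$$ $$[x_{ij}(p), x_{kl}(q)] = 1 \quad (j \neq k,\ i \neq l),$$ where $[a, b] = a b a^{-1} b^{-1}$. Let $$R_{2 \varepsilon} = R / \langle 2 p,\ p q - q p,\ (p^2 - p)(q^2 - q) \mid p, q \in R \rangle,$$ where $\langle \ldots \rangle$ denotes the generated two-sided ideal. Both objects exist, being given by their universal properties. Moreover, $\mathrm{St}(\mathsf A_3, R)$ has a universal central extension $\kappa \colon \widetilde{\mathrm{St}} \to \mathrm{St}(\mathsf A_3, R)$ (a central extension is an epimorphic homomorphism of group objects with central kernel). Its kernel is the Schur multiplier of $\mathrm{St}(\mathsf A_3, R)$. There is a pairing $$\langle -, = \rangle \colon \mathrm{St}(\mathsf A_3, R) \times \mathrm{St}(\mathsf A_3, R) \to \widetilde{\mathrm{St}}, \qquad \kappa(\langle a, b \rangle) = [a, b], \quad \langle \kappa(x), \kappa(y) \rangle = [x, y].$$ For every permutation $i j k l$ of $\{1, 2, 3, 4\}$ there is a unique homomorphism $c_{ij \mid kl} \colon R \to \widetilde{\mathrm{St}}$ from the additive group of $R$ such that $$\langle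 x_{ij}(p), x_{kl}(q) \rangle = c_{ij \mid kl}(p q)$$ for all $p, q \in R$. The homomorphisms $c_{ij \mid kl} = c$ do not depend on the permutation, $c$ factors through a homomorphism from the additive group of $R_{2 \varepsilon}$, and the Schur multiplier of $\mathrm{St}(\mathsf A_3, R)$ is the image of $c$. -/

import Mathlib

open CategoryTheory Limits MonoidalCategory CartesianMonoidalCategory
open scoped MonObj AddMonObj commutatorElement

universe w v u

/-- An infinitary pretopos: a Barr exact category (regular, and every internal equivalence
relation is a kernel pair) with small coproducts which are disjoint and stable under pullback.
Here "small" refers to the universe `w`. -/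
class InfinitaryPretopos (C : Type u) [Category.{v} C] : Prop extends Regular C where
  isKernelPair_of_equivalenceRelation :
    ∀ {R X : C} (p₁ p₂ : R ⟶ X), IsEquivalenceRelation p₁ p₂ →
      ∃ (Y : C) (f : X ⟶ Y), IsKernelPair f p₁ p₂
  hasCoproducts : HasCoproducts.{w} C
  disjoint : ∀ {I : Type w} (X : I → C), CoproductDisjoint X
  universal : ∀ {I : Type w} (X : I → C) (c : Cofan X), IsColimit c → IsUniversalColimit c

section RingObjects

variable {C : Type u} [Category.{v} C] [CartesianMonoidalCategory C] [BraidedCategory C]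

/-- A non-unital associative ring object: a commutative additive group object with an associative
biadditive multiplication (the axioms are stated for generalized elements). -/
class NonUnitalRingObj (R : C) extends AddGrpObj R, IsCommAddMonObj R where
  /-- the multiplication morphism -/
  rmul : R ⊗ R ⟶ R
  rmul_assoc : ∀ {T : C} (p q r : T ⟶ R),
    lift (lift p q ≫ rmul) r ≫ rmul = lift p (lift q r ≫ rmul) ≫ rmul
  rmul_add : ∀ {T : C} (p q r : T ⟶ R),
    lift p (q + r) ≫ rmul = lift p q ≫ rmul + lift p r ≫ rmul
  add_rmul : ∀ {T : C} (p q r : T ⟶ R),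
    lift (p + q) r ≫ rmul = lift p r ≫ rmul + lift q r ≫ rmul

/-- The generalized elements of a ring object form a non-unital ring. -/
instance NonUnitalRingObj.homRing (T R : C) [NonUnitalRingObj R] : NonUnitalRing (T ⟶ R) where
  __ := (Hom.addCommGroup : AddCommGroup (T ⟶ R))
  mul p q := lift p q ≫ NonUnitalRingObj.rmul
  left_distrib := NonUnitalRingObj.rmul_add
  right_distrib := NonUnitalRingObj.add_rmul
  mul_assoc := NonUnitalRingObj.rmul_assoc
  zero_mul p := by
    have h := NonUnitalRingObj.add_rmul (0 : T ⟶ R) 0 p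
    rw [add_zero] at h
    exact left_eq_add.mp h
  mul_zero p := by
    have h := NonUnitalRingObj.rmul_add p (0 : T ⟶ R) 0
    rw [add_zero] at h
    exact left_eq_add.mp h

/-- Homomorphisms of non-unital ring objects. -/
structure IsNonUnitalRingHom {R S : C} [NonUnitalRingObj R] [NonUnitalRingObj S]
    (f : R ⟶ S) : Prop where
  map_add : ∀ {T : C} (p q : T ⟶ R), (p + q) ≫ f = p ≫ f + q ≫ f
  map_mul : ∀ {T : C} (p q : T ⟶ R), (p * q) ≫ f = (p ≫ f) * (q ≫ f)

/-- `E` is a weak unit of the ring object `R`. Existential quantifiers of the internal language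
are interpreted as usual: existence after passing to a cover, i.e. an epimorphism `T' ⟶ T`. -/
structure IsWeakUnit (R : C) [NonUnitalRingObj R] (E : Subobject R) : Prop where
  /-- `E` is a multiplicative subsemigroup and its multiplication is an epimorphism -/
  mul_epi : ∃ m : (E : C) ⊗ (E : C) ⟶ (E : C),
    m ≫ E.arrow = (E.arrow ⊗ₘ E.arrow) ≫ NonUnitalRingObj.rmul ∧ Epi m
  /-- `E` is central -/
  central : ∀ {T : C} (ε p : T ⟶ R), E.Factors ε → ε * p = p * ε
  /-- any two elements of `E` have a common divisor in `E` -/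
  common_divisor : ∀ {T : C} (ε θ : T ⟶ R), E.Factors ε → E.Factors θ →
    ∃ (T' : C) (e : T' ⟶ T) (ξ ε' θ' : T' ⟶ R), Epi e ∧
      E.Factors ξ ∧ E.Factors ε' ∧ E.Factors θ' ∧ e ≫ ε = ε' * ξ ∧ e ≫ θ = θ' * ξ
  /-- the multiplication `R × E → R` is an epimorphism -/
  smul_epi : Epi ((R ◁ E.arrow) ≫ NonUnitalRingObj.rmul)
  /-- if `m ε = 0`, then locally `ε = ε' ε''` with `m ε' = 0` -/
  torsion : ∀ {T : C} (m ε : T ⟶ R), E.Factors ε → m * ε = 0 →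
    ∃ (T' : C) (e : T' ⟶ T) (ε' ε'' : T' ⟶ R), Epi e ∧
      E.Factors ε' ∧ E.Factors ε'' ∧ e ≫ ε = ε' * ε'' ∧ (e ≫ m) * ε' = 0

/-- A ring object is weakly unital if it has a weak unit. -/
def IsWeaklyUnital (R : C) [NonUnitalRingObj R] : Prop :=
  ∃ E : Subobject R, IsWeakUnit R E

/-- The morphism `f` kills `2 p`, `p q - q p` and `(p² - p) (q² - q)` for all `p`, `q` in `R`. -/
def KillsTwoEps {R S : C} [NonUnitalRingObj R] [NonUnitalRingObj S] (f : R ⟶ S) : Prop :=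
  ∀ {T : C} (p q : T ⟶ R), (p + p) ≫ f = 0 ∧ (p * q - q * p) ≫ f = 0 ∧
    ((p * p - p) * (q * q - q)) ≫ f = 0

/-- `π : R ⟶ Q` is the factor-ring `R_{2ε} = R / ⟨2 p, p q - q p, (p² - p) (q² - q)⟩`, i.e.
the universal ring homomorphism killing these elements. -/
structure IsTwoEpsQuotient {R Q : C} [NonUnitalRingObj R] [NonUnitalRingObj Q]
    (π : R ⟶ Q) : Prop where
  isHom : IsNonUnitalRingHom π
  kills : KillsTwoEps π
  universal : ∀ (S : C) [NonUnitalRingObj S] (f : R ⟶ S), IsNonUnitalRingHom f →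
    KillsTwoEps f → ∃! g : Q ⟶ S, IsNonUnitalRingHom g ∧ π ≫ g = f

/-- A homomorphism from the additive group of a ring object to a (multiplicative) group object. -/
def IsAddToMulHom {R G : C} [NonUnitalRingObj R] [GrpObj G] (c : R ⟶ G) : Prop :=
  ∀ {T : C} (p q : T ⟶ R), (p + q) ≫ c = (p ≫ c) * (q ≫ c)

/-- A family `x i j : R ⟶ G`, where `i ≠ j` are elements of `Fin n`, satisfying the Steinberg
relations of type `A_{n-1}`. -/
structure SteinbergRelations {n : ℕ} {R G : C} [NonUnitalRingObj R] [GrpObj G]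
    (x : ∀ i j : Fin n, i ≠ j → (R ⟶ G)) : Prop where
  map_add : ∀ (i j : Fin n) (hij : i ≠ j) {T : C} (p q : T ⟶ R),
    (p ≫ x i j hij) * (q ≫ x i j hij) = (p + q) ≫ x i j hij
  comm_mul : ∀ (i j k : Fin n) (hij : i ≠ j) (hjk : j ≠ k) (hik : i ≠ k) {T : C} (p q : T ⟶ R),
    ⁅p ≫ x i j hij, q ≫ x j k hjk⁆ = (p * q) ≫ x i k hik
  comm_one : ∀ (i j k l : Fin n) (hij : i ≠ j) (hkl : k ≠ l), j ≠ k → i ≠ l →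
    ∀ {T : C} (p q : T ⟶ R), ⁅p ≫ x i j hij, q ≫ x k l hkl⁆ = 1

/-- The group object `G` with the morphisms `x i j` is the Steinberg group `St(A_{n-1}, R)`: it is
given by the generators `x i j p` and the Steinberg relations. -/
structure IsSteinbergGroup {n : ℕ} {R G : C} [NonUnitalRingObj R] [GrpObj G]
    (x : ∀ i j : Fin n, i ≠ j → (R ⟶ G)) : Prop where
  relations : SteinbergRelations x
  universal : ∀ (H : C) [GrpObj H] (y : ∀ i j : Fin n, i ≠ j → (R ⟶ H)), SteinbergRelations y →
    ∃! f : G ⟶ H, IsMonHom f ∧ ∀ (i j : Fin n) (hij : i ≠ j), x i j hij ≫ f = y i j hij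

end RingObjects

section CentralExtensions

variable {C : Type u} [Category.{v} C] [CartesianMonoidalCategory C]

/-- A central extension: an epimorphic homomorphism with central kernel. -/
structure IsCentralExtension {H G : C} [GrpObj H] [GrpObj G] (f : H ⟶ G) : Prop where
  isHom : IsMonHom f
  epi : Epi f
  central : ∀ {T : C} (z h : T ⟶ H), z ≫ f = 1 → z * h = h * z

/-- A universal central extension. -/
structure IsUniversalCentralExtension {H G : C} [GrpObj H] [GrpObj G] (κ : H ⟶ G) : Prop where
  isCentralExtension : IsCentralExtension κ
  universal : ∀ (X : C) [GrpObj X] (d : X ⟶ G), IsCentralExtension d →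
    ∃! f : H ⟶ X, IsMonHom f ∧ f ≫ d = κ

/-- The kernel of `κ : H ⟶ G`. If `κ` is the universal central extension of `G`, this is the Schur
multiplier of `G`. -/
noncomputable def kernelOf [HasPullbacks C] {H G : C} [GrpObj H] [GrpObj G] (κ : H ⟶ G) :
    Subobject H :=
  (Subobject.pullback κ).obj (Subobject.mk η[G])

/-- `B` is the pairing `⟨-, =⟩ : G × G ⟶ H` associated with the central extension `κ : H ⟶ G`,
i.e. `κ ⟨a, b⟩ = [a, b]` and `⟨κ x, κ y⟩ = [x, y]`. -/
structure IsCommutatorPairing {H G : C} [GrpObj H] [GrpObj G] (κ : H ⟶ G)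
    (B : G ⊗ G ⟶ H) : Prop where
  comp : ∀ {T : C} (a b : T ⟶ G), lift a b ≫ B ≫ κ = ⁅a, b⁆
  lift_comp : ∀ {T : C} (x y : T ⟶ H), lift (x ≫ κ) (y ≫ κ) ≫ B = ⁅x, y⁆

end CentralExtensions

/-- `c : R ⟶ H` is the homomorphism `c_{ij|kl}`, i.e. `⟨x i j p, x k l q⟩ = c (p q)`. -/
structure IsRootPairing {C : Type u} [Category.{v} C] [CartesianMonoidalCategory C]
    [BraidedCategory C] {n : ℕ} {R G H : C} [NonUnitalRingObj R] [GrpObj G] [GrpObj H]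
    (x : ∀ i j : Fin n, i ≠ j → (R ⟶ G)) (B : G ⊗ G ⟶ H)
    (i j k l : Fin n) (hij : i ≠ j) (hkl : k ≠ l) (c : R ⟶ H) : Prop where
  isHom : IsAddToMulHom c
  pairing : ∀ {T : C} (p q : T ⟶ R),
    lift (p ≫ x i j hij) (q ≫ x k l hkl) ≫ B = (p * q) ≫ c

section Covers

variable {C : Type u} [Category.{v} C]

/-- A jointly extremal epimorphic family: it does not factor through a proper subobject. -/
def IsCover {A : Type*} {T : C} (X : A → C) (e : ∀ a, X a ⟶ T) : Prop :=
  ∀ ⦃S : C⦄ (m : S ⟶ T), Mono m → (∀ a, ∃ g, g ≫ m = e a) → IsIso m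

/-- The statement `P` holds locally on `T`, i.e. on the members of a small covering family. -/
def Locally (T : C) (P : ∀ ⦃T' : C⦄, (T' ⟶ T) → Prop) : Prop :=
  ∃ (A : Type w) (X : A → C) (e : ∀ a, X a ⟶ T), IsCover X e ∧ ∀ a, P (e a)

namespace Locally

lemma mono {T : C} {P Q : ∀ ⦃T' : C⦄, (T' ⟶ T) → Prop} (h : Locally.{w} T P)
    (hPQ : ∀ ⦃T' : C⦄ (e : T' ⟶ T), P e → Q e) : Locally.{w} T Q := by
  obtain ⟨A, X, e, hc, hP⟩ := h
  exact ⟨A, X, e, hc, fun a => hPQ _ (hP a)⟩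

lemma of_strongEpi {T T' : C} (e : T' ⟶ T) [StrongEpi e] {P : ∀ ⦃T' : C⦄, (T' ⟶ T) → Prop}
    (h : P e) : Locally.{w} T P :=
  ⟨PUnit, fun _ => T', fun _ => e, fun _ m _ hg => by
    obtain ⟨g, hg⟩ := hg ⟨⟩
    exact ExtremalEpi.isIso e g m hg, fun _ => h⟩

lemma of_id {T : C} {P : ∀ ⦃T' : C⦄, (T' ⟶ T) → Prop} (h : P (𝟙 T)) : Locally.{w} T P :=
  of_strongEpi (𝟙 T) h

lemma factors [HasPullbacks C] {T Z S : C} {f : T ⟶ Z} (m : S ⟶ Z) [Mono m]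
    (h : Locally.{w} T fun _ e => ∃ g, g ≫ m = e ≫ f) : ∃ g, g ≫ m = f := by
  obtain ⟨A, X, e, hc, hP⟩ := h
  have : IsIso (pullback.snd m f) := hc _ inferInstance fun a => by
    obtain ⟨g, hg⟩ := hP a
    exact ⟨pullback.lift g (e a) hg, pullback.lift_snd _ _ _⟩
  exact ⟨inv (pullback.snd m f) ≫ pullback.fst m f, by simp [pullback.condition]⟩

lemma eq [HasEqualizers C] {T Z : C} {f g : T ⟶ Z}
    (h : Locally.{w} T fun _ e => e ≫ f = e ≫ g) : f = g := by
  obtain ⟨A, X, e, hc, hP⟩ := h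
  have : IsIso (equalizer.ι f g) := hc _ inferInstance fun a => ⟨equalizer.lift (e a) (hP a), by simp⟩
  rw [← cancel_epi (equalizer.ι f g), equalizer.condition]

lemma trans [HasPullbacks C] {T : C} {P : ∀ ⦃T' : C⦄, (T' ⟶ T) → Prop}
    (h : Locally.{w} T fun T' e => Locally.{w} T' fun _ e' => P (e' ≫ e)) : Locally.{w} T P := by
  obtain ⟨A, X, e, hc, hP⟩ := h
  choose B Y e' hc' hP' using hP
  refine ⟨Σ a, B a, fun x => Y x.1 x.2, fun x => e' x.1 x.2 ≫ e x.1, ?_, fun x => hP' _ _⟩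
  intro S m _ hm
  refine hc m inferInstance fun a => ?_
  exact factors (f := e a) m ⟨B a, Y a, e' a, hc' a, fun b => hm ⟨a, b⟩⟩

lemma sigma_ι {A : Type w} [HasCoproducts.{w} C] (X : A → C) :
    IsCover X (Sigma.ι X) := by
  intro S m _ hm
  choose g hg using hm
  have : Sigma.desc g ≫ m = 𝟙 _ := by
    ext a
    simp [hg]
  have := IsSplitEpi.mk' ⟨_, this⟩
  exact isIso_of_mono_of_isSplitEpi m

end Locally

lemma IsCover.isRegularEpi_desc [Regular C] [HasCoproducts.{w} C] {A : Type w} {T : C}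
    {X : A → C} {e : ∀ a, X a ⟶ T} (h : IsCover X e) : IsRegularEpi (Sigma.desc e) := by
  have : ExtremalEpi (Sigma.desc e) := .mk_of_hasEqualizers _ fun Z p i hp _ =>
    h i inferInstance fun a => ⟨Sigma.ι X a ≫ p, by simp [hp]⟩
  infer_instance

attribute [instance] InfinitaryPretopos.hasCoproducts InfinitaryPretopos.disjoint

variable [InfinitaryPretopos.{w} C]

lemma IsCover.pullback {A : Type w} {T T' : C} {X : A → C} {e : ∀ a, X a ⟶ T}
    (h : IsCover X e) (f : T' ⟶ T) :
    IsCover (fun a => pullback f (e a)) (fun a => pullback.fst f (e a)) := by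
  have := h.isRegularEpi_desc
  intro S m _ hm
  choose g hg using hm
  have hu : IsUniversalColimit (Cofan.mk (∐ X) (Sigma.ι X)) :=
    InfinitaryPretopos.universal X _ (coproductIsCoproduct X)
  let d : Cofan (fun a => Limits.pullback f (e a)) :=
    Cofan.mk (Limits.pullback f (Sigma.desc e)) fun a =>
      pullback.lift (pullback.fst f (e a)) (pullback.snd f (e a) ≫ Sigma.ι X a)
        (by simp [pullback.condition])
  obtain ⟨hd⟩ := hu.nonempty_isColimit_of_isPullback_left e (Sigma.desc e) f
    (fun a => pullback.fst f (e a)) (fun a => pullback.snd f (e a))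
    (fun a => IsPullback.of_hasPullback f (e a))
    (IsPullback.of_hasPullback f (Sigma.desc e)) d (Iso.refl _)
    (fun a => by simp)
    (fun a => (congrArg _ (Category.id_comp _)).trans (pullback.lift_fst _ _ _))
    (fun a => (congrArg _ (Category.id_comp _)).trans (pullback.lift_snd _ _ _))
  refine ExtremalEpi.isIso (pullback.fst f (Sigma.desc e)) (Cofan.IsColimit.desc hd g) m ?_
  refine Cofan.IsColimit.hom_ext hd _ _ fun a => ?_
  rw [Cofan.IsColimit.fac_assoc, hg]
  exact (pullback.lift_fst _ _ _).symm

lemma Locally.pullback {T T' : C} {P : ∀ ⦃T' : C⦄, (T' ⟶ T) → Prop} (h : Locally.{w} T P)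
    (hP : ∀ ⦃T₁ T₂ : C⦄ (f : T₂ ⟶ T₁) (e : T₁ ⟶ T), P e → P (f ≫ e)) (f : T' ⟶ T) :
    Locally.{w} T' fun _ e => P (e ≫ f) := by
  obtain ⟨A, X, e, hc, h⟩ := h
  refine ⟨A, _, _, hc.pullback f, fun a => ?_⟩
  beta_reduce
  rw [pullback.condition]
  exact hP _ _ (h a)

/-- Two local statements which are stable under restriction hold simultaneously. -/
lemma Locally.and {T : C} {P Q : ∀ ⦃T' : C⦄, (T' ⟶ T) → Prop} (h : Locally.{w} T P)
    (h' : Locally.{w} T Q)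
    (hP : ∀ ⦃T₁ T₂ : C⦄ (f : T₂ ⟶ T₁) (e : T₁ ⟶ T), P e → P (f ≫ e))
    (hQ : ∀ ⦃T₁ T₂ : C⦄ (f : T₂ ⟶ T₁) (e : T₁ ⟶ T), Q e → Q (f ≫ e)) :
    Locally.{w} T fun _ e => P e ∧ Q e := by
  obtain ⟨A, X, e, hc, h⟩ := h
  exact trans ⟨A, X, e, hc, fun a => (h'.pullback hQ (e a)).mono fun _ e' hq => ⟨hP _ _ (h a), hq⟩⟩

lemma Locally.exists_sigma_ι {A : Type w} (X : A → C) {T : C} (f : T ⟶ ∐ X) :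
    Locally.{w} T fun T' e => ∃ (a : A) (x : T' ⟶ X a), x ≫ Sigma.ι X a = e ≫ f :=
  ⟨A, _, _, (Locally.sigma_ι X).pullback f, fun a => ⟨a, _, pullback.condition.symm⟩⟩

lemma locally_of_sigma_ι_eq {A : Type w} (X : A → C) {T : C} {a b : A} (x : T ⟶ X a) (y : T ⟶ X b)
    (h : x ≫ Sigma.ι X a = y ≫ Sigma.ι X b) :
    Locally.{w} T fun T' e => (⟨a, e ≫ x⟩ : Σ a, (T' ⟶ X a)) = ⟨b, e ≫ y⟩ := by
  by_cases hab : a = b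
  · subst hab
    rw [cancel_mono] at h
    exact .of_id (by rw [h])
  · have hi := IsInitial.ofCoproductDisjoint (X := X) hab
    refine ⟨PEmpty, PEmpty.elim, fun a => a.elim, ?_, fun a => a.elim⟩
    have hP : IsCover (T := Limits.pullback (Sigma.ι X a) (Sigma.ι X b)) (A := PEmpty.{w + 1})
        PEmpty.elim (fun a => a.elim) := by
      intro S m _ _
      have := IsSplitEpi.mk' (f := m) ⟨hi.to S, hi.hom_ext _ _⟩
      exact isIso_of_mono_of_isSplitEpi m
    intro S m hm _
    exact hP.pullback (pullback.lift x y h) m hm fun a => a.elim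

/-- Compatible local morphisms glue. -/
lemma exists_glue {V Z : C} (S : ∀ ⦃T : C⦄, (T ⟶ V) → (T ⟶ Z) → Prop)
    (nat : ∀ ⦃T T' : C⦄ (f : T' ⟶ T) (s : T ⟶ V) (z : T ⟶ Z), S s z → S (f ≫ s) (f ≫ z))
    (single : ∀ ⦃T : C⦄ (s : T ⟶ V) (z z' : T ⟶ Z), S s z → S s z' → z = z')
    (cov : Locally.{w} V fun _ e => ∃ z, S e z) :
    ∃ g : V ⟶ Z, ∀ ⦃T : C⦄ (s : T ⟶ V) (z : T ⟶ Z), S s z → s ≫ g = z := by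
  obtain ⟨A, X, e, hc, hz⟩ := cov
  choose z hz using hz
  have := hc.isRegularEpi_desc
  have hw : IsRegularEpi.left (Sigma.desc e) ≫ Sigma.desc z =
      IsRegularEpi.right (Sigma.desc e) ≫ Sigma.desc z := by
    apply Locally.eq.{w}
    refine ((Locally.exists_sigma_ι X (IsRegularEpi.left (Sigma.desc e))).and
      (Locally.exists_sigma_ι X (IsRegularEpi.right (Sigma.desc e))) ?_ ?_).mono ?_
    · rintro _ _ f e ⟨a, x, h⟩
      exact ⟨a, f ≫ x, by simp [h]⟩
    · rintro _ _ f e ⟨a, x, h⟩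
      exact ⟨a, f ≫ x, by simp [h]⟩
    · rintro T' e' ⟨⟨a, x, hx⟩, ⟨b, y, hy⟩⟩
      have h := IsRegularEpi.w (Sigma.desc e)
      replace h := congr(e' ≫ $h)
      rw [← reassoc_of% hx, ← reassoc_of% hy] at *
      simp only [Sigma.ι_desc] at *
      have h1 := nat x _ _ (hz a)
      rw [h] at h1
      exact single _ _ _ h1 (nat y _ _ (hz b))
  let g : V ⟶ Z := IsRegularEpi.desc (Sigma.desc e) (Sigma.desc z) hw
  have hg : ∀ a, e a ≫ g = z a := fun a => by
    rw [← Sigma.ι_desc e a, Category.assoc, IsRegularEpi.fac, Sigma.ι_desc]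
  refine ⟨g, fun T s t h => Locally.eq.{w} ⟨A, _, _, hc.pullback s, fun a => ?_⟩⟩
  beta_reduce
  rw [pullback.condition_assoc, hg]
  refine single _ _ _ ?_ (nat _ _ _ h)
  rw [pullback.condition]
  exact nat _ _ _ (hz a)

end Covers

section Quotients

universe t

variable {C : Type u} [Category.{v} C]

/-- The presheaf `D` is a small coproduct of representable presheaves. -/
def IsFamiliallyRepresentable (D : Cᵒᵖ ⥤ Type t) : Prop :=
  ∃ (A : Type w) (U : A → C) (s : ∀ a, D.obj (.op (U a))), ∀ ⦃T : C⦄ (x : D.obj (.op T)),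
    ∃! p : Σ a, (T ⟶ U a), D.map p.2.op (s p.1) = x

/-- The relation `ρ` on the presheaf `D` is stable under restriction and is the image of a small
coproduct of representable presheaves. -/
structure IsSmallRel (D : Cᵒᵖ ⥤ Type t)
    (ρ : ∀ ⦃T : C⦄, D.obj (.op T) → D.obj (.op T) → Prop) : Prop where
  res : ∀ ⦃T T' : C⦄ (f : T' ⟶ T) (x y : D.obj (.op T)), ρ x y → ρ (D.map f.op x) (D.map f.op y)
  small : ∃ (A : Type w) (V : A → C) (x y : ∀ a, D.obj (.op (V a))), (∀ a, ρ (x a) (y a)) ∧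
    ∀ ⦃T : C⦄ (p q : D.obj (.op T)), ρ p q →
      ∃ (a : A) (f : T ⟶ V a), D.map f.op (x a) = p ∧ D.map f.op (y a) = q

/-- The object `Q` is the quotient of the presheaf `D` by the relation `ρ` in the internal sense:
`π` is locally surjective and identifies exactly the elements which are locally related. -/
structure IsLocalQuotient (D : Cᵒᵖ ⥤ Type t)
    (ρ : ∀ ⦃T : C⦄, D.obj (.op T) → D.obj (.op T) → Prop) (Q : C)
    (π : ∀ ⦃T : C⦄, D.obj (.op T) → (T ⟶ Q)) : Prop where
  comp : ∀ ⦃T T' : C⦄ (f : T' ⟶ T) (x : D.obj (.op T)), f ≫ π x = π (D.map f.op x)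
  eq_iff : ∀ ⦃T : C⦄ (x y : D.obj (.op T)), π x = π y ↔
    Locally.{w} T fun _ e => ρ (D.map e.op x) (D.map e.op y)
  surj : ∀ ⦃T : C⦄ (q : T ⟶ Q), Locally.{w} T fun _ e => ∃ x, π x = e ≫ q

lemma IsLocalQuotient.sound {D : Cᵒᵖ ⥤ Type t}
    {ρ : ∀ ⦃T : C⦄, D.obj (.op T) → D.obj (.op T) → Prop} {Q : C}
    {π : ∀ ⦃T : C⦄, D.obj (.op T) → (T ⟶ Q)} (h : IsLocalQuotient.{w} D ρ Q π)
    (hres : ∀ ⦃T T' : C⦄ (f : T' ⟶ T) (x y : D.obj (.op T)), ρ x y →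
      ρ (D.map f.op x) (D.map f.op y))
    {T : C} {x y : D.obj (.op T)} (hxy : ρ x y) : π x = π y :=
  (h.eq_iff _ _).2 (.of_id (hres _ _ _ hxy))

lemma Locally.strongEpi_lift [Regular C] {T X Y : C} (p : X ⟶ Y) [StrongEpi p] (f : T ⟶ Y) :
    Locally.{w} T fun T' e => ∃ g : T' ⟶ X, g ≫ p = e ≫ f :=
  Locally.of_strongEpi (pullback.fst f p) ⟨_, pullback.condition.symm⟩

variable [InfinitaryPretopos.{w} C]

/-- A presheaf which is a small coproduct of representables is locally isomorphic to a
representable one. -/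
lemma IsFamiliallyRepresentable.exists_isLocalQuotient_eq {D : Cᵒᵖ ⥤ Type t}
    (hD : IsFamiliallyRepresentable.{w} D) :
    ∃ (U : C) (π : ∀ ⦃T : C⦄, D.obj (.op T) → (T ⟶ U)),
      IsLocalQuotient.{w} D (fun _ => Eq) U π := by
  obtain ⟨A, U, s, hs⟩ := hD
  choose p hp hp' using hs
  have hres : ∀ ⦃T T' : C⦄ (f : T' ⟶ T) (x : D.obj (.op T)),
      p (D.map f.op x) = ⟨(p x).1, f ≫ (p x).2⟩ := fun T T' f x =>
    (hp' (D.map f.op x) ⟨(p x).1, f ≫ (p x).2⟩ (by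
      simp only [op_comp, Functor.map_comp, ConcreteCategory.comp_apply]
      rw [hp])).symm
  refine ⟨∐ U, fun T x => (p x).2 ≫ Sigma.ι U (p x).1, ⟨fun T T' f x => ?_, fun T x y => ?_,
    fun T q => ?_⟩⟩
  · rw [hres, Category.assoc]
  · refine ⟨fun h => (locally_of_sigma_ι_eq U _ _ h).mono fun T' e h => ?_, fun h => Locally.eq <|
      h.mono fun T' e h => ?_⟩
    · rw [← hres e x, ← hres e y] at h
      rw [← hp (D.map e.op x), ← hp (D.map e.op y), h]
    · have h' := congr(p $h)
      rw [hres, hres] at h'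
      simp only [← Category.assoc]
      exact congr($(h').2 ≫ Sigma.ι U $(h').1)
  · refine (Locally.exists_sigma_ι U q).mono ?_
    rintro T' e ⟨a, x, hx⟩
    refine ⟨D.map x.op (s a), ?_⟩
    rw [← hx, ← hp' (D.map x.op (s a)) ⟨a, x⟩ rfl]

variable [CartesianMonoidalCategory C]

/-- Equivalence relations on `U` which are given locally by a small relation have a quotient. -/
lemma exists_kernel_eq_locally (U : C)
    (r : ∀ ⦃T : C⦄, (T ⟶ U) → (T ⟶ U) → Prop) (hr : ∀ ⦃T : C⦄, Equivalence (r (T := T)))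
    (res : ∀ ⦃T T' : C⦄ (f : T' ⟶ T) (x y : T ⟶ U), r x y → r (f ≫ x) (f ≫ y))
    {A : Type w} (V : A → C) (x y : ∀ a, V a ⟶ U) (hxy : ∀ a, r (x a) (y a))
    (small : ∀ ⦃T : C⦄ (p q : T ⟶ U), r p q →
      Locally.{w} T fun T' e => ∃ (a : A) (f : T' ⟶ V a), f ≫ x a = e ≫ p ∧ f ≫ y a = e ≫ q)
    (loc : ∀ ⦃T : C⦄ (p q : T ⟶ U),
      (Locally.{w} T fun _ e => r (e ≫ p) (e ≫ q)) → r p q) :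
    ∃ (Q : C) (π : U ⟶ Q), StrongEpi π ∧ ∀ ⦃T : C⦄ (p q : T ⟶ U), p ≫ π = q ≫ π ↔ r p q := by
  let F := Regular.strongEpiMonoFactorisation (Sigma.desc fun a => lift (x a) (y a))
  have hF : ∀ ⦃T : C⦄ (p q : T ⟶ U), r p q ↔ ∃ g : T ⟶ F.I, g ≫ F.m = lift p q := by
    refine fun T p q => ⟨fun h => Locally.factors F.m ((small p q h).mono ?_), ?_⟩
    · rintro T' e ⟨a, f, h₁, h₂⟩
      refine ⟨f ≫ Sigma.ι V a ≫ F.e, ?_⟩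
      simp [F, h₁, h₂]
    · rintro ⟨g, hg⟩
      refine loc p q (((Locally.strongEpi_lift F.e g).mono fun T' e h => ?_).trans)
      obtain ⟨s, hs⟩ := h
      refine (Locally.exists_sigma_ι V s).mono ?_
      rintro T'' e' ⟨a, f, hf⟩
      have h : f ≫ lift (x a) (y a) = (e' ≫ e) ≫ lift p q := by
        rw [← hg, Category.assoc, ← reassoc_of% hs, ← reassoc_of% hf]
        simp [F]
      simp only [comp_lift] at h
      have h₁ := congr($h ≫ fst _ _)
      have h₂ := congr($h ≫ snd _ _)
      simp only [lift_fst, lift_snd] at h₁ h₂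
      rw [← h₁, ← h₂]
      exact res _ _ _ (hxy a)
  have hm : ∀ ⦃T : C⦄ (g : T ⟶ F.I), r (g ≫ F.m ≫ fst _ _) (g ≫ F.m ≫ snd _ _) := fun T g =>
    (hF _ _).2 ⟨g, by ext <;> simp⟩
  obtain ⟨i, hi⟩ := (hF _ _).1 (hr.refl (𝟙 U))
  obtain ⟨s, hs⟩ := (hF _ _).1 (hr.symm (hm (𝟙 F.I)))
  obtain ⟨k, hk⟩ := (hF _ _).1 (hr.trans
    (hm (pullback.fst (F.m ≫ snd _ _) (F.m ≫ fst _ _)))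
    (by rw [pullback.condition]; exact hm _))
  have he : IsEquivalenceRelation (F.m ≫ fst _ _) (F.m ≫ snd _ _) := ⟨⟨{
    right_cancellation := fun Y f g h₁ h₂ => by
      rw [← cancel_mono F.m]
      ext
      · simpa using h₁
      · simpa using h₂
    r := i
    reflexivity₁ := by simp [reassoc_of% hi]
    reflexivity₂ := by simp [reassoc_of% hi]
    s := s
    symmetry₁ := by simp [reassoc_of% hs]
    symmetry₂ := by simp [reassoc_of% hs]
    c := _
    isLimit := pullbackIsPullback _ _
    t := k
    transitivity₁ := (Category.assoc _ _ _).symm.trans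
      ((congrArg (· ≫ fst _ _) hk).trans (lift_fst _ _))
    transitivity₂ := (Category.assoc _ _ _).symm.trans
      ((congrArg (· ≫ snd _ _) hk).trans (lift_snd _ _)) }⟩⟩
  obtain ⟨Y, f, hf⟩ :=
    InfinitaryPretopos.isKernelPair_of_equivalenceRelation.{w} _ _ he
  let G := Regular.strongEpiMonoFactorisation f
  refine ⟨G.I, G.e, inferInstance, fun T p q => ?_⟩
  rw [← cancel_mono G.m, Category.assoc, Category.assoc, G.fac, hF]
  refine ⟨fun h => ⟨hf.lift p q h, ?_⟩, ?_⟩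
  · ext
    · simp [IsKernelPair.lift_fst]
    · simp [IsKernelPair.lift_snd]
  · rintro ⟨g, hg⟩
    have h := congr(g ≫ $(hf.w))
    simpa [reassoc_of% hg] using h

theorem IsSmallRel.exists_isLocalQuotient {D : Cᵒᵖ ⥤ Type t}
    (hD : IsFamiliallyRepresentable.{w} D)
    {ρ : ∀ ⦃T : C⦄, D.obj (.op T) → D.obj (.op T) → Prop} (hρ : IsSmallRel.{w} D ρ)
    (he : ∀ ⦃T : C⦄, Equivalence (ρ (T := T))) :
    ∃ (Q : C) (π : ∀ ⦃T : C⦄, D.obj (.op T) → (T ⟶ Q)), IsLocalQuotient.{w} D ρ Q π := by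
  obtain ⟨U, p, hp⟩ := hD.exists_isLocalQuotient_eq
  obtain ⟨A, V, x, y, hxy, hsmall⟩ := hρ.small
  let r₀ : ∀ ⦃T T' : C⦄, (T' ⟶ T) → (T ⟶ U) → (T ⟶ U) → Prop := fun T T' e a b =>
    ∃ x y, ρ x y ∧ p x = e ≫ a ∧ p y = e ≫ b
  have hr₀ : ∀ ⦃T : C⦄ (a b : T ⟶ U) ⦃T₁ T₂ : C⦄ (f : T₂ ⟶ T₁) (e : T₁ ⟶ T),
      r₀ e a b → r₀ (f ≫ e) a b := by
    rintro T a b T₁ T₂ f e ⟨x, y, h, hx, hy⟩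
    exact ⟨_, _, hρ.res f _ _ h, by simp [← hp.comp, hx], by simp [← hp.comp, hy]⟩
  have hr : ∀ ⦃T : C⦄, Equivalence fun a b : T ⟶ U => Locally.{w} T fun _ e => r₀ e a b := by
    refine fun T => ⟨fun a => (hp.surj a).mono ?_, fun h => h.mono ?_, fun {a b c} h h' =>
      ((h.and h' (hr₀ _ _) (hr₀ _ _)).mono ?_).trans⟩
    · rintro T' e ⟨x, hx⟩
      exact ⟨x, x, he.refl x, hx, hx⟩
    · rintro T' e ⟨x, y, h, hx, hy⟩
      exact ⟨y, x, he.symm h, hy, hx⟩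
    · rintro T' e ⟨⟨x, y, h, hx, hy⟩, ⟨y', z, h', hy', hz⟩⟩
      have := hy.trans hy'.symm
      rw [hp.eq_iff] at this
      refine this.mono fun T'' e' h'' => ⟨_, D.map e'.op z, he.trans (hρ.res e' _ _ h) ?_, ?_, ?_⟩
      · rw [h'']
        exact hρ.res e' _ _ h'
      · simp [← hp.comp, hx]
      · simp [← hp.comp, hz]
  have hcomp : ∀ ⦃T T' T'' : C⦄ (f : T' ⟶ T) (e : T'' ⟶ T') (a b : T ⟶ U),
      r₀ e (f ≫ a) (f ≫ b) ↔ r₀ (e ≫ f) a b := fun T T' T'' f e a b => by simp [r₀]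
  obtain ⟨Q, q, hq, hqr⟩ := exists_kernel_eq_locally.{w} U
    (fun T a b => Locally.{w} T fun _ e => r₀ e a b) hr
    (fun T T' f a b h => (h.pullback (hr₀ _ _) f).mono fun T'' e => (hcomp f e a b).2)
    V (fun a => p (x a)) (fun a => p (y a))
    (fun a => .of_id ⟨_, _, hxy a, by simp, by simp⟩)
    (fun T a b h => h.mono fun T' e ⟨x', y', h, hx, hy⟩ => by
      obtain ⟨a, f, rfl, rfl⟩ := hsmall _ _ h
      exact ⟨a, f, by rw [← hx, hp.comp], by rw [← hy, hp.comp]⟩)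
    (fun T a b h => Locally.trans (h.mono fun T' e h => h.mono fun T'' e' => (hcomp e e' a b).1))
  refine ⟨Q, fun T x => p x ≫ q, ⟨fun T T' f x => by simp [← hp.comp], fun T x y => ?_,
    fun T a => ?_⟩⟩
  · rw [hqr]
    refine ⟨fun h => (h.mono ?_).trans, fun h => h.mono fun T' e h => ⟨_, _, h, ?_, ?_⟩⟩
    · rintro T' e ⟨x', y', h, hx, hy⟩
      rw [hp.comp, hp.eq_iff] at hx hy
      refine (hx.and hy ?_ ?_).mono ?_
      · intro T₁ T₂ f e h
        simp [h]
      · intro T₁ T₂ f e h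
        simp [h]
      · rintro T'' e' ⟨h₁, h₂⟩
        simp only [op_comp, Functor.map_comp, ConcreteCategory.comp_apply]
        rw [← h₁, ← h₂]
        exact hρ.res _ _ _ h
    · rw [hp.comp]
    · rw [hp.comp]
  · refine Locally.trans ((Locally.strongEpi_lift q a).mono ?_)
    rintro T' e ⟨g, hg⟩
    refine (hp.surj g).mono ?_
    rintro T'' e' ⟨x, hx⟩
    exact ⟨x, by simp [hx, hg]⟩

end Quotients

section Balanced

variable {C : Type u} [Category.{v} C]

/-- A morphism through which every element lifts locally is an epimorphism. -/
lemma epi_of_locally_lift [HasEqualizers C] {X Y : C} (p : X ⟶ Y)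
    (h : Locally.{w} Y fun T' e => ∃ g : T' ⟶ X, g ≫ p = e) : Epi p :=
  ⟨fun a b hab => Locally.eq <| h.mono fun T' e ⟨g, hg⟩ => by
    rw [← hg, Category.assoc, hab, Category.assoc]⟩

/-- The presheaf of elements of two copies of `B`. -/
def twoCopies (B : C) : Cᵒᵖ ⥤ Type v where
  obj T := ULift Bool × (T.unop ⟶ B)
  map f := ↾fun x => (x.1, f.unop ≫ x.2)

lemma isFamiliallyRepresentable_twoCopies (B : C) :
    IsFamiliallyRepresentable.{w} (twoCopies B) := by
  refine ⟨ULift Bool, fun _ => B, fun a => (⟨a.down⟩, 𝟙 B), fun T x =>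
    ⟨⟨⟨x.1.down⟩, x.2⟩, ?_, ?_⟩⟩
  · exact Prod.ext rfl (Category.comp_id _)
  · rintro ⟨a, y⟩ rfl
    exact Sigma.ext rfl (heq_of_eq (Category.comp_id y).symm)

/-- The element `b` of the copy of `B` with index `i`. -/
def twoCopies.mk {B T : C} (i : Bool) (b : T ⟶ B) : (twoCopies B).obj (.op T) := (⟨i⟩, b)

lemma twoCopies.map_mk {B T T' : C} (f : T' ⟶ T) (i : Bool) (b : T ⟶ B) :
    (twoCopies B).map f.op (mk i b) = mk i (f ≫ b) := rfl

/-- The relation glueing the two copies of `B` along a morphism `m`. -/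
def glueRel {A B : C} (m : A ⟶ B) ⦃T : C⦄ (x y : (twoCopies B).obj (.op T)) : Prop :=
  x.2 = y.2 ∧ (x.1 = y.1 ∨ ∃ a, a ≫ m = x.2)

lemma isSmallRel_glueRel {A B : C} (m : A ⟶ B) : IsSmallRel.{w} (twoCopies B) (glueRel m) := by
  refine ⟨?_, ?_⟩
  · rintro T T' f ⟨i, x⟩ ⟨j, y⟩ ⟨rfl : x = y, h⟩
    refine ⟨rfl, h.imp id ?_⟩
    rintro ⟨a, ha⟩
    exact ⟨f ≫ a, (Category.assoc _ _ _).trans (congrArg (f ≫ ·) ha)⟩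
  · refine ⟨ULift (Bool ⊕ Bool × Bool), fun a => a.down.elim (fun _ => B) (fun _ => A),
      fun ⟨a⟩ => match a with
        | .inl i => (⟨i⟩, 𝟙 B)
        | .inr i => (⟨i.1⟩, m),
      fun ⟨a⟩ => match a with
        | .inl i => (⟨i⟩, 𝟙 B)
        | .inr i => (⟨i.2⟩, m), ?_, ?_⟩
    · rintro ⟨i | i⟩
      · exact ⟨rfl, .inl rfl⟩
      · exact ⟨rfl, .inr ⟨𝟙 A, Category.id_comp m⟩⟩
    · rintro T ⟨⟨i⟩, x⟩ ⟨⟨j⟩, y⟩ ⟨rfl : x = y, (h : _ = _) | ⟨a, rfl : a ≫ m = x⟩⟩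
      · cases h
        exact ⟨⟨.inl i⟩, x, Prod.ext rfl (Category.comp_id _), Prod.ext rfl (Category.comp_id _)⟩
      · exact ⟨⟨.inr (i, j)⟩, a, rfl, rfl⟩

lemma equivalence_glueRel {A B : C} (m : A ⟶ B) ⦃T : C⦄ : Equivalence (glueRel m (T := T)) where
  refl _ := ⟨rfl, .inl rfl⟩
  symm h := ⟨h.1.symm, h.2.imp Eq.symm fun ⟨a, ha⟩ => ⟨a, ha.trans h.1⟩⟩
  trans h h' := ⟨h.1.trans h'.1, by
    obtain h₁ | ⟨a, ha⟩ := h.2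
    · exact h'.2.imp h₁.trans fun ⟨a, ha⟩ => ⟨a, ha.trans h.1.symm⟩
    · exact .inr ⟨a, ha⟩⟩

variable [CartesianMonoidalCategory C] [InfinitaryPretopos.{w} C]

lemma isIso_of_mono_of_epi_of_pretopos {A B : C} (m : A ⟶ B) [Mono m] [Epi m] : IsIso m := by
  obtain ⟨Q, π, hπ⟩ := (isSmallRel_glueRel.{w} m).exists_isLocalQuotient
    (isFamiliallyRepresentable_twoCopies B) (equivalence_glueRel m)
  have h' : m ≫ π (twoCopies.mk true (𝟙 B)) = m ≫ π (twoCopies.mk false (𝟙 B)) := by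
    rw [hπ.comp, hπ.comp, twoCopies.map_mk, twoCopies.map_mk]
    refine hπ.sound (isSmallRel_glueRel.{w} m).res ⟨rfl, .inr ⟨𝟙 A, ?_⟩⟩
    exact (Category.id_comp m).trans (Category.comp_id m).symm
  rw [cancel_epi, hπ.eq_iff] at h'
  obtain ⟨g, hg⟩ := Locally.factors (f := 𝟙 B) m <| h'.mono fun T' e he => by
    obtain ⟨_, he | he⟩ := he
    · cases he
    · exact he
  have := IsSplitEpi.mk' (f := m) ⟨g, hg⟩
  exact isIso_of_mono_of_isSplitEpi m

lemma strongEpi_of_epi_of_pretopos {A B : C} (f : A ⟶ B) [Epi f] : StrongEpi f := by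
  let F := Regular.strongEpiMonoFactorisation f
  have : Epi F.m := by
    have h : Epi (F.e ≫ F.m) := by rw [F.fac]; infer_instance
    exact epi_of_epi F.e F.m
  have := isIso_of_mono_of_epi_of_pretopos.{w} F.m
  rw [← F.fac]
  exact strongEpi_comp _ _

lemma Locally.of_epi {T T' : C} (e : T' ⟶ T) [Epi e] {P : ∀ ⦃T' : C⦄, (T' ⟶ T) → Prop}
    (h : P e) : Locally.{w} T P :=
  have := strongEpi_of_epi_of_pretopos.{w} e
  .of_strongEpi e h

/-- Epimorphisms are effective. -/
lemma exists_desc_of_epi {U V Z : C} (p : U ⟶ V) [Epi p] (f : U ⟶ Z)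
    (h : ∀ ⦃T : C⦄ (s t : T ⟶ U), s ≫ p = t ≫ p → s ≫ f = t ≫ f) : ∃ g : V ⟶ Z, p ≫ g = f := by
  obtain ⟨g, hg⟩ := exists_glue.{w} (V := V) (Z := Z) (fun T s z => ∃ u, u ≫ p = s ∧ u ≫ f = z)
    (by rintro T T' e _ _ ⟨u, rfl, rfl⟩; exact ⟨e ≫ u, by simp, by simp⟩)
    (by rintro T _ _ _ ⟨u, hu, rfl⟩ ⟨u', hu', rfl⟩; exact h _ _ (hu.trans hu'.symm))
    (.of_epi p ⟨f, 𝟙 U, by simp, by simp⟩)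
  exact ⟨g, hg p f ⟨𝟙 U, by simp, by simp⟩⟩

end Balanced

section GroupObjects

variable {C : Type u} [Category.{v} C] [CartesianMonoidalCategory C]

/-- A group object from operations which satisfy the group axioms on generalized elements. -/
@[to_additive]
abbrev grpObjOfPoints {Q : C} (one : 𝟙_ C ⟶ Q) (mul : Q ⊗ Q ⟶ Q) (inv : Q ⟶ Q)
    (one_mul : ∀ {T : C} (a : T ⟶ Q), lift (toUnit T ≫ one) a ≫ mul = a)
    (mul_one : ∀ {T : C} (a : T ⟶ Q), lift a (toUnit T ≫ one) ≫ mul = a)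
    (mul_assoc : ∀ {T : C} (a b c : T ⟶ Q),
      lift (lift a b ≫ mul) c ≫ mul = lift a (lift b c ≫ mul) ≫ mul)
    (inv_mul : ∀ {T : C} (a : T ⟶ Q), lift (a ≫ inv) a ≫ mul = toUnit T ≫ one)
    (mul_inv : ∀ {T : C} (a : T ⟶ Q), lift a (a ≫ inv) ≫ mul = toUnit T ≫ one) :
    GrpObj Q where
  one := one
  mul := mul
  inv := inv
  one_mul := by
    have h : one ▷ Q = lift (toUnit _ ≫ one) (λ_ Q).hom := by
      ext
      · simp [toUnit_unique (fst (𝟙_ C) Q) (toUnit _)]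
      · simp [leftUnitor_hom]
    rw [h, one_mul]
  mul_one := by
    have h : Q ◁ one = lift (ρ_ Q).hom (toUnit _ ≫ one) := by
      ext
      · simp [rightUnitor_hom]
      · simp [toUnit_unique (snd Q (𝟙_ C)) (toUnit _)]
    rw [h, mul_one]
  mul_assoc := by
    have h : mul ▷ Q = lift (lift (fst _ _ ≫ fst _ _) (fst _ _ ≫ snd _ _) ≫ mul) (snd _ _) := by
      ext
      · simp only [whiskerRight_fst, lift_fst]
        congr 1
        ext <;> simp
      · simp
    rw [h, mul_assoc, ← Category.assoc]
    congr 1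
    ext
    · simp
    · simp only [lift_snd, Category.assoc, whiskerLeft_snd]
      rw [← Category.assoc]
      congr 1
      ext <;> simp
  left_inv := by simpa using inv_mul (𝟙 Q)
  right_inv := by simpa using mul_inv (𝟙 Q)

/-- A morphism of group objects which preserves the multiplication is a homomorphism. -/
lemma isMonHom_of_map_mul {G H : C} [GrpObj G] [GrpObj H] (f : G ⟶ H)
    (h : ∀ {T : C} (a b : T ⟶ G), (a * b) ≫ f = (a ≫ f) * (b ≫ f)) : IsMonHom f where
  one_hom := by
    have h₁ := h (η[G]) η[G]
    rw [MonObj.one_eq_one, mul_one] at h₁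
    rw [MonObj.one_eq_one, MonObj.one_eq_one]
    exact left_eq_mul.mp h₁
  mul_hom := by
    rw [MonObj.mul_eq_mul, h, Hom.mul_def]
    congr 1
    ext <;> simp

end GroupObjects

section QuotientGroups

universe t

variable {C : Type u} [Category.{v} C] [InfinitaryPretopos.{w} C]
  {D : Cᵒᵖ ⥤ Type t} {ρ : ∀ ⦃T : C⦄, D.obj (.op T) → D.obj (.op T) → Prop}
  {Q : C} {π : ∀ ⦃T : C⦄, D.obj (.op T) → (T ⟶ Q)}

namespace IsLocalQuotient

lemma hom_eq (h : IsLocalQuotient.{w} D ρ Q π) {T Z : C} (q : T ⟶ Q) {f g : T ⟶ Z}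
    (hfg : ∀ ⦃T' : C⦄ (e : T' ⟶ T) (x : D.obj (.op T')), π x = e ≫ q → e ≫ f = e ≫ g) : f = g :=
  Locally.eq ((h.surj q).mono fun _ e ⟨x, hx⟩ => hfg e x hx)

lemma hom_eq₂ (h : IsLocalQuotient.{w} D ρ Q π) {T Z : C} (q r : T ⟶ Q) {f g : T ⟶ Z}
    (hfg : ∀ ⦃T' : C⦄ (e : T' ⟶ T) (x y : D.obj (.op T')), π x = e ≫ q → π y = e ≫ r →
      e ≫ f = e ≫ g) : f = g :=
  h.hom_eq q fun _ e x hx => h.hom_eq (e ≫ r) fun _ e' y hy => by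
    rw [← Category.assoc, ← Category.assoc]
    exact hfg _ (D.map e'.op x) y (by rw [← h.comp, hx, Category.assoc]) (by rw [hy, Category.assoc])

lemma hom_eq₃ (h : IsLocalQuotient.{w} D ρ Q π) {T Z : C} (q r s : T ⟶ Q) {f g : T ⟶ Z}
    (hfg : ∀ ⦃T' : C⦄ (e : T' ⟶ T) (x y z : D.obj (.op T')), π x = e ≫ q → π y = e ≫ r →
      π z = e ≫ s → e ≫ f = e ≫ g) : f = g :=
  h.hom_eq₂ q r fun _ e x y hx hy => h.hom_eq (e ≫ s) fun _ e' z hz => by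
    rw [← Category.assoc, ← Category.assoc]
    exact hfg _ (D.map e'.op x) (D.map e'.op y) z (by rw [← h.comp, hx, Category.assoc])
      (by rw [← h.comp, hy, Category.assoc]) (by rw [hz, Category.assoc])

lemma map_eq (h : IsLocalQuotient.{w} D ρ Q π) {Z : C} (φ : ∀ ⦃T : C⦄, D.obj (.op T) → (T ⟶ Z))
    (nat : ∀ ⦃T T' : C⦄ (f : T' ⟶ T) (x : D.obj (.op T)), f ≫ φ x = φ (D.map f.op x))
    (hφ : ∀ ⦃T : C⦄ (x y : D.obj (.op T)), ρ x y → φ x = φ y)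
    {T : C} {x y : D.obj (.op T)} (hxy : π x = π y) : φ x = φ y :=
  Locally.eq (((h.eq_iff _ _).1 hxy).mono fun _ e he => by rw [nat, nat, hφ _ _ he])

lemma exists_desc (h : IsLocalQuotient.{w} D ρ Q π) {Z : C}
    (φ : ∀ ⦃T : C⦄, D.obj (.op T) → (T ⟶ Z))
    (nat : ∀ ⦃T T' : C⦄ (f : T' ⟶ T) (x : D.obj (.op T)), f ≫ φ x = φ (D.map f.op x))
    (hφ : ∀ ⦃T : C⦄ (x y : D.obj (.op T)), ρ x y → φ x = φ y) :
    ∃ g : Q ⟶ Z, ∀ ⦃T : C⦄ (x : D.obj (.op T)), π x ≫ g = φ x := by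
  obtain ⟨g, hg⟩ := exists_glue.{w} (V := Q) (Z := Z) (fun T s z => ∃ x, π x = s ∧ φ x = z)
    (by rintro T T' e _ _ ⟨x, rfl, rfl⟩; exact ⟨_, (h.comp _ _).symm, (nat _ _).symm⟩)
    (by rintro T _ _ _ ⟨x, hx, rfl⟩ ⟨y, hy, rfl⟩; exact h.map_eq φ nat hφ (hx.trans hy.symm))
    ((h.surj (𝟙 Q)).mono fun T e ⟨x, hx⟩ => ⟨_, x, by simpa using hx, rfl⟩)
  exact ⟨g, fun T x => hg _ _ ⟨x, rfl, rfl⟩⟩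

lemma exists_desc₂ [CartesianMonoidalCategory C] (h : IsLocalQuotient.{w} D ρ Q π) {Z : C}
    (φ : ∀ ⦃T : C⦄, D.obj (.op T) → D.obj (.op T) → (T ⟶ Z))
    (nat : ∀ ⦃T T' : C⦄ (f : T' ⟶ T) (x y : D.obj (.op T)),
      f ≫ φ x y = φ (D.map f.op x) (D.map f.op y))
    (hl : ∀ ⦃T : C⦄ (x x' y : D.obj (.op T)), ρ x x' → φ x y = φ x' y)
    (hr : ∀ ⦃T : C⦄ (x y y' : D.obj (.op T)), ρ y y' → φ x y = φ x y') :
    ∃ g : Q ⊗ Q ⟶ Z, ∀ ⦃T : C⦄ (x y : D.obj (.op T)), lift (π x) (π y) ≫ g = φ x y := by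
  obtain ⟨g, hg⟩ := exists_glue.{w} (V := Q ⊗ Q) (Z := Z)
    (fun T s z => ∃ x y, lift (π x) (π y) = s ∧ φ x y = z)
    (by
      rintro T T' e _ _ ⟨x, y, rfl, rfl⟩
      exact ⟨_, _, by rw [comp_lift, h.comp, h.comp], (nat _ _ _).symm⟩)
    (by
      rintro T _ _ _ ⟨x, y, hx, rfl⟩ ⟨x', y', hx', rfl⟩
      have h₁ := congr($(hx.trans hx'.symm) ≫ fst _ _)
      have h₂ := congr($(hx.trans hx'.symm) ≫ snd _ _)
      simp only [lift_fst, lift_snd] at h₁ h₂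
      refine Locally.eq ((((h.eq_iff _ _).1 h₁).mono fun T' e he => ?_).trans)
      have h₃ : π (D.map e.op y) = π (D.map e.op y') := by rw [← h.comp, ← h.comp, h₂]
      refine (((h.eq_iff _ _).1 h₃).mono fun T'' e' he' => ?_)
      rw [Category.assoc, Category.assoc, nat, hl _ _ _ he, nat, hr _ _ _ he', ← nat, ← nat])
    (((h.surj (fst Q Q)).and (h.surj (snd Q Q))
      (fun T₁ T₂ f e ⟨x, hx⟩ => ⟨_, (h.comp f x).symm.trans
        ((congrArg (f ≫ ·) hx).trans (Category.assoc _ _ _).symm)⟩)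
      (fun T₁ T₂ f e ⟨x, hx⟩ => ⟨_, (h.comp f x).symm.trans
        ((congrArg (f ≫ ·) hx).trans (Category.assoc _ _ _).symm)⟩)).mono
      fun T e ⟨⟨x, hx⟩, ⟨y, hy⟩⟩ => ⟨_, x, y, by ext <;> simp [hx, hy], rfl⟩)
  exact ⟨g, fun T x y => hg _ _ ⟨x, y, rfl, rfl⟩⟩

/-- The quotient of a presheaf of monoids by a congruence is a group object if all elements are
invertible modulo the congruence. -/
@[to_additive]
lemma exists_grpObj [CartesianMonoidalCategory C] [∀ T : C, Monoid (D.obj (.op T))]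
    (h : IsLocalQuotient.{w} D ρ Q π) (he : ∀ ⦃T : C⦄, Equivalence (ρ (T := T)))
    (hres : ∀ ⦃T T' : C⦄ (f : T' ⟶ T) (x y : D.obj (.op T)), ρ x y →
      ρ (D.map f.op x) (D.map f.op y))
    (map_one : ∀ ⦃T T' : C⦄ (f : T' ⟶ T), D.map f.op (1 : D.obj (.op T)) = (1 : D.obj (.op T')))
    (map_mul : ∀ ⦃T T' : C⦄ (f : T' ⟶ T) (x y : D.obj (.op T)),
      (D.map f.op (x * y) : D.obj (.op T')) = (D.map f.op x : D.obj (.op T')) * D.map f.op y)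
    (mul : ∀ ⦃T : C⦄ (x x' y y' : D.obj (.op T)), ρ x x' → ρ y y' → ρ (x * y) (x' * y'))
    (inv : ∀ ⦃T : C⦄, D.obj (.op T) → D.obj (.op T))
    (map_inv : ∀ ⦃T T' : C⦄ (f : T' ⟶ T) (x : D.obj (.op T)),
      D.map f.op (inv x) = inv (D.map f.op x))
    (inv_mul : ∀ ⦃T : C⦄ (x : D.obj (.op T)), ρ (inv x * x) 1)
    (mul_inv : ∀ ⦃T : C⦄ (x : D.obj (.op T)), ρ (x * inv x) 1) :
    ∃ (_ : GrpObj Q), ∀ ⦃T : C⦄ (x y : D.obj (.op T)), π (x * y) = π x * π y := by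
  have hinv : ∀ ⦃T : C⦄ (x y : D.obj (.op T)), ρ x y → ρ (inv x) (inv y) := fun T x y hxy => by
    have h₁ := mul _ _ _ _ (he.refl (inv x)) (he.symm (mul_inv y))
    have h₂ := mul _ _ _ _ (mul _ _ _ _ (he.refl (inv x)) (he.symm hxy)) (he.refl (inv y))
    have h₃ := mul _ _ _ _ (inv_mul x) (he.refl (inv y))
    rw [mul_one, ← mul_assoc] at h₁
    rw [one_mul] at h₃
    exact he.trans h₁ (he.trans h₂ h₃)
  have sound : ∀ ⦃T : C⦄ (x y : D.obj (.op T)), ρ x y → π x = π y := fun T x y => h.sound hres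
  obtain ⟨m, hm⟩ := h.exists_desc₂ (fun T x y => π (x * y))
    (fun T T' f x y => by rw [h.comp, map_mul])
    (fun T x x' y hx => sound _ _ (mul _ _ _ _ hx (he.refl y)))
    (fun T x y y' hy => sound _ _ (mul _ _ _ _ (he.refl x) hy))
  obtain ⟨i, hi⟩ := h.exists_desc (fun T x => π (inv x)) (fun T T' f x => by rw [h.comp, map_inv])
    (fun T x y hxy => sound _ _ (hinv _ _ hxy))
  have ho : ∀ T : C, toUnit T ≫ π (1 : D.obj (.op (𝟙_ C))) = π (1 : D.obj (.op T)) := fun T => by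
    rw [h.comp, map_one]
  refine ⟨grpObjOfPoints (π (1 : D.obj (.op (𝟙_ C)))) m i ?_ ?_ ?_ ?_ ?_, fun T x y =>
    (hm x y).symm⟩
  · refine fun {T} a => h.hom_eq a fun T' e x hx => ?_
    rw [comp_lift_assoc, ← hx, comp_toUnit_assoc, ho, hm, one_mul]
  · refine fun {T} a => h.hom_eq a fun T' e x hx => ?_
    rw [comp_lift_assoc, ← hx, comp_toUnit_assoc, ho, hm, mul_one]
  · refine fun {T} a b c => h.hom_eq₃ a b c fun T' e x y z hx hy hz => ?_
    rw [comp_lift_assoc, comp_lift_assoc, comp_lift_assoc, comp_lift_assoc, ← hx, ← hy, ← hz,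
      hm, hm, hm, hm, mul_assoc]
  · refine fun {T} a => h.hom_eq a fun T' e x hx => ?_
    rw [comp_lift_assoc, ← Category.assoc, ← hx, comp_toUnit_assoc, ho, hi, hm]
    exact sound _ _ (inv_mul x)
  · refine fun {T} a => h.hom_eq a fun T' e x hx => ?_
    rw [comp_lift_assoc, ← Category.assoc, ← hx, comp_toUnit_assoc, ho, hi, hm]
    exact sound _ _ (mul_inv x)

end IsLocalQuotient

end QuotientGroups

/-- The least equivalence relation containing `r` and compatible with the binary operations
`op j`. -/
inductive CongruenceClosure {X J : Type*} (op : J → X → X → X) (r : X → X → Prop) : X → X → Prop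
  | of (x y : X) : r x y → CongruenceClosure op r x y
  | refl (x : X) : CongruenceClosure op r x x
  | symm {x y : X} : CongruenceClosure op r x y → CongruenceClosure op r y x
  | trans {x y z : X} : CongruenceClosure op r x y → CongruenceClosure op r y z →
      CongruenceClosure op r x z
  | op (j : J) {x x' y y' : X} : CongruenceClosure op r x x' → CongruenceClosure op r y y' →
      CongruenceClosure op r (op j x y) (op j x' y')

lemma CongruenceClosure.equivalence {X J : Type*} (op : J → X → X → X) (r : X → X → Prop) :
    Equivalence (CongruenceClosure op r) :=
  ⟨.refl, .symm, .trans⟩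

namespace IsSmallRel

universe t

variable {C : Type u} [Category.{v} C] {D : Cᵒᵖ ⥤ Type t}

lemma _root_.IsFamiliallyRepresentable.exists_equalizers [HasPullbacks C]
    (hD : IsFamiliallyRepresentable.{w} D) {V V' : C} (x : D.obj (.op V)) (y : D.obj (.op V')) :
    ∃ (A : Type w) (K : A → C) (p : ∀ a, K a ⟶ V) (q : ∀ a, K a ⟶ V'),
      (∀ a, D.map (p a).op x = D.map (q a).op y) ∧
      ∀ ⦃T : C⦄ (f : T ⟶ V) (g : T ⟶ V'), D.map f.op x = D.map g.op y →
        ∃ (a : A) (h : T ⟶ K a), h ≫ p a = f ∧ h ≫ q a = g := by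
  obtain ⟨A, U, s, hs⟩ := hD
  obtain ⟨⟨a, f⟩, rfl, -⟩ := hs x
  obtain ⟨⟨b, g⟩, rfl, -⟩ := hs y
  have key : ∀ ⦃T : C⦄ (f' : T ⟶ V) (g' : T ⟶ V'),
      D.map f'.op (D.map f.op (s a)) = D.map g'.op (D.map g.op (s b)) →
      (⟨a, f' ≫ f⟩ : Σ a, (T ⟶ U a)) = ⟨b, g' ≫ g⟩ := fun T f' g' h =>
    (hs (D.map f'.op (D.map f.op (s a)))).unique (by simp) (by rw [h]; simp)
  by_cases hab : a = b
  · subst hab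
    refine ⟨PUnit, fun _ => pullback f g, fun _ => pullback.fst f g, fun _ => pullback.snd f g,
      fun _ => ?_, fun T f' g' h => ⟨⟨⟩, pullback.lift f' g' ?_, pullback.lift_fst _ _ _,
        pullback.lift_snd _ _ _⟩⟩
    · simp only [← ConcreteCategory.comp_apply, ← Functor.map_comp, ← op_comp, pullback.condition]
    · simpa using key f' g' h
  · exact ⟨PEmpty, fun a => a.elim, fun a => a.elim, fun a => a.elim, fun a => a.elim,
      fun T f' g' h => (hab congr($(key f' g' h).1)).elim⟩

lemma eq (hD : IsFamiliallyRepresentable.{w} D) : IsSmallRel.{w} D fun _ => Eq := by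
  obtain ⟨A, U, s, hs⟩ := hD
  refine ⟨fun T T' f x y h => by rw [h], A, U, s, s, fun _ => rfl, ?_⟩
  rintro T x _ rfl
  obtain ⟨⟨a, f⟩, hf, -⟩ := hs x
  exact ⟨a, f, hf, hf⟩

variable {ρ ρ' : ∀ ⦃T : C⦄, D.obj (.op T) → D.obj (.op T) → Prop}

lemma iSup {B : Type w} {ρ : B → ∀ ⦃T : C⦄, D.obj (.op T) → D.obj (.op T) → Prop}
    (h : ∀ i, IsSmallRel.{w} D (ρ i)) : IsSmallRel.{w} D fun _ x y => ∃ i, ρ i x y := by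
  refine ⟨fun T T' f x y ⟨i, hi⟩ => ⟨i, (h i).res f x y hi⟩, ?_⟩
  choose A V x y h₁ h₂ using fun i => (h i).small
  refine ⟨Σ i, A i, fun a => V a.1 a.2, fun a => x a.1 a.2, fun a => y a.1 a.2,
    fun a => ⟨a.1, h₁ _ _⟩, ?_⟩
  rintro T x' y' ⟨i, hi⟩
  obtain ⟨a, f, hf⟩ := h₂ i _ _ hi
  exact ⟨⟨i, a⟩, f, hf⟩

lemma or (h : IsSmallRel.{w} D ρ) (h' : IsSmallRel.{w} D ρ') :
    IsSmallRel.{w} D fun _ x y => ρ x y ∨ ρ' x y := by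
  have := iSup (ρ := fun (i : ULift.{w} Bool) T x y => bif i.down then ρ x y else ρ' x y)
    (by rintro ⟨_ | _⟩; exacts [h', h])
  convert! this using 4
  simp [or_comm]

lemma swap (h : IsSmallRel.{w} D ρ) : IsSmallRel.{w} D fun _ x y => ρ y x := by
  refine ⟨fun T T' f x y h' => h.res f _ _ h', ?_⟩
  obtain ⟨A, V, x, y, h₁, h₂⟩ := h.small
  refine ⟨A, V, y, x, h₁, fun T x' y' h' => ?_⟩
  obtain ⟨a, f, h₃, h₄⟩ := h₂ _ _ h'
  exact ⟨a, f, h₄, h₃⟩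

lemma comp [HasPullbacks C] (hD : IsFamiliallyRepresentable.{w} D) (h : IsSmallRel.{w} D ρ)
    (h' : IsSmallRel.{w} D ρ') : IsSmallRel.{w} D fun _ x z => ∃ y, ρ x y ∧ ρ' y z := by
  refine ⟨fun T T' f x z ⟨y, h₁, h₂⟩ => ⟨_, h.res f _ _ h₁, h'.res f _ _ h₂⟩, ?_⟩
  obtain ⟨A, V, x, y, hxy, hA⟩ := h.small
  obtain ⟨B, W, y', z, hyz, hB⟩ := h'.small
  choose E K p q hpq hK using fun (i : A × B) => hD.exists_equalizers (y i.1) (y' i.2)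
  refine ⟨Σ i, E i, fun i => K i.1 i.2, fun i => D.map (p i.1 i.2).op (x i.1.1),
    fun i => D.map (q i.1 i.2).op (z i.1.2),
    fun i => ⟨_, h.res _ _ _ (hxy i.1.1), hpq i.1 i.2 ▸ h'.res _ _ _ (hyz i.1.2)⟩, ?_⟩
  rintro T x₁ z₁ ⟨y₁, h₁, h₂⟩
  obtain ⟨a, f, rfl, hf⟩ := hA _ _ h₁
  obtain ⟨b, g, hg, rfl⟩ := hB _ _ h₂
  obtain ⟨c, k, rfl, rfl⟩ := hK (a, b) f g (hf.trans hg.symm)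
  exact ⟨⟨(a, b), c⟩, k, by simp, by simp⟩

lemma op₂ [CartesianMonoidalCategory C] (h : IsSmallRel.{w} D ρ) (h' : IsSmallRel.{w} D ρ')
    (op : ∀ ⦃T : C⦄, D.obj (.op T) → D.obj (.op T) → D.obj (.op T))
    (map_op : ∀ ⦃T T' : C⦄ (f : T' ⟶ T) (x y : D.obj (.op T)),
      D.map f.op (op x y) = op (D.map f.op x) (D.map f.op y)) :
    IsSmallRel.{w} D fun _ a b => ∃ x x' y y', ρ x x' ∧ ρ' y y' ∧ op x y = a ∧ op x' y' = b := by
  refine ⟨?_, ?_⟩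
  · rintro T T' f _ _ ⟨x, x', y, y', h₁, h₂, rfl, rfl⟩
    exact ⟨_, _, _, _, h.res f _ _ h₁, h'.res f _ _ h₂, (map_op _ _ _).symm, (map_op _ _ _).symm⟩
  · obtain ⟨A, V, x, x', hx, hA⟩ := h.small
    obtain ⟨B, W, y, y', hy, hB⟩ := h'.small
    refine ⟨A × B, fun i => V i.1 ⊗ W i.2,
      fun i => op (D.map (fst _ _).op (x i.1)) (D.map (snd _ _).op (y i.2)),
      fun i => op (D.map (fst _ _).op (x' i.1)) (D.map (snd _ _).op (y' i.2)),
      fun i => ⟨_, _, _, _, h.res _ _ _ (hx i.1), h'.res _ _ _ (hy i.2), rfl, rfl⟩, ?_⟩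
    rintro T _ _ ⟨x₁, x₂, y₁, y₂, h₁, h₂, rfl, rfl⟩
    obtain ⟨a, f, rfl, rfl⟩ := hA _ _ h₁
    obtain ⟨b, g, rfl, rfl⟩ := hB _ _ h₂
    refine ⟨(a, b), lift f g, ?_, ?_⟩ <;>
    · simp only [map_op, ← ConcreteCategory.comp_apply, ← Functor.map_comp, ← op_comp, lift_fst,
        lift_snd]

lemma congruenceClosure [CartesianMonoidalCategory C] [HasPullbacks C]
    (hD : IsFamiliallyRepresentable.{w} D) (h : IsSmallRel.{w} D ρ) {J : Type w}
    (op : J → ∀ ⦃T : C⦄, D.obj (.op T) → D.obj (.op T) → D.obj (.op T))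
    (map_op : ∀ j ⦃T T' : C⦄ (f : T' ⟶ T) (x y : D.obj (.op T)),
      D.map f.op (op j x y) = op j (D.map f.op x) (D.map f.op y)) :
    IsSmallRel.{w} D fun T => CongruenceClosure (fun j => op j (T := T)) (ρ (T := T)) := by
  let F : (∀ ⦃T : C⦄, D.obj (.op T) → D.obj (.op T) → Prop) →
      ∀ ⦃T : C⦄, D.obj (.op T) → D.obj (.op T) → Prop := fun τ T a b =>
    τ a b ∨ τ b a ∨ (∃ c, τ a c ∧ τ c b) ∨
      ∃ j, ∃ x x' y y', τ x x' ∧ τ y y' ∧ op j x y = a ∧ op j x' y' = b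
  let τ : ℕ → ∀ ⦃T : C⦄, D.obj (.op T) → D.obj (.op T) → Prop := fun n =>
    F^[n] fun _ a b => ρ a b ∨ a = b
  have hτ : ∀ n, τ (n + 1) = F (τ n) := fun n => Function.iterate_succ_apply' _ _ _
  have hsmall : ∀ n, IsSmallRel.{w} D (τ n) := by
    intro n
    induction n with
    | zero => exact h.or (.eq hD)
    | succ n ih =>
      rw [hτ]
      exact ih.or (ih.swap.or ((ih.comp hD ih).or (.iSup fun j => ih.op₂ ih (op j) (map_op j))))
  have hmono : ∀ {m n : ℕ}, m ≤ n → ∀ ⦃T : C⦄ (x y : D.obj (.op T)), τ m x y → τ n x y := by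
    intro m n hmn T x y hxy
    induction n, hmn using Nat.le_induction with
    | base => exact hxy
    | succ n _ ih => rw [hτ]; exact .inl ih
  have := iSup (B := ULift ℕ) (ρ := fun n => τ n.down) fun n => hsmall n.down
  convert! this using 1
  ext T x y
  constructor
  · intro hxy
    induction hxy with
    | of x y hxy => exact ⟨⟨0⟩, .inl hxy⟩
    | refl x => exact ⟨⟨0⟩, .inr rfl⟩
    | symm _ ih =>
      obtain ⟨n, hn⟩ := ih
      exact ⟨⟨n.down + 1⟩, by rw [hτ]; exact .inr (.inl hn)⟩
    | trans _ _ ih ih' =>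
      obtain ⟨⟨n⟩, hn⟩ := ih
      obtain ⟨⟨m⟩, hm⟩ := ih'
      refine ⟨⟨max n m + 1⟩, ?_⟩
      rw [hτ]
      exact .inr (.inr (.inl ⟨_, hmono (le_max_left n m) _ _ hn, hmono (le_max_right n m) _ _ hm⟩))
    | op j _ _ ih ih' =>
      obtain ⟨⟨n⟩, hn⟩ := ih
      obtain ⟨⟨m⟩, hm⟩ := ih'
      refine ⟨⟨max n m + 1⟩, ?_⟩
      rw [hτ]
      exact .inr (.inr (.inr ⟨j, _, _, _, _, hmono (le_max_left n m) _ _ hn,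
        hmono (le_max_right n m) _ _ hm, rfl, rfl⟩))
  · rintro ⟨⟨n⟩, hn⟩
    change τ n x y at hn
    induction n generalizing x y with
    | zero =>
      obtain hn | rfl := hn
      · exact .of _ _ hn
      · exact .refl _
    | succ n ih =>
      rw [hτ] at hn
      obtain hn | hn | ⟨c, h₁, h₂⟩ | ⟨j, a, a', b, b', h₁, h₂, rfl, rfl⟩ := hn
      · exact ih _ _ hn
      · exact .symm (ih _ _ hn)
      · exact .trans (ih _ _ h₁) (ih _ _ h₂)
      · exact .op j (ih _ _ h₁) (ih _ _ h₂)

end IsSmallRel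

section PresentedGroups

variable {C : Type u} [Category.{v} C]

/-- Words in the generators `(i, p)`, where `i : I` and `p` is an element of `R`. -/
abbrev Word (I : Type) (R T : C) := FreeMonoid (I × (T ⟶ R))

/-- Restriction of words. -/
def Word.res {I : Type} {R T T' : C} (f : T' ⟶ T) : Word I R T →* Word I R T' :=
  FreeMonoid.map fun a => (a.1, f ≫ a.2)

@[simp] lemma Word.res_of {I : Type} {R T T' : C} (f : T' ⟶ T) (i : I) (p : T ⟶ R) :
    Word.res f (FreeMonoid.of (i, p)) = FreeMonoid.of (i, f ≫ p) := rfl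

/-- The presheaf of words. -/
def Word.presheaf (I : Type) (R : C) : Cᵒᵖ ⥤ Type v where
  obj T := Word I R T.unop
  map f := ↾fun w => Word.res f.unop w
  map_id T := by
    ext w
    refine DFunLike.congr_fun (f := Word.res (𝟙 T.unop)) (g := MonoidHom.id _) ?_ w
    ext a
    simp [Word.res]
  map_comp f g := by
    ext w
    refine DFunLike.congr_fun (f := Word.res (g.unop ≫ f.unop))
      (g := (Word.res g.unop).comp (Word.res f.unop)) ?_ w
    ext a
    simp [Word.res]

instance (I : Type) (R T : C) : Monoid ((Word.presheaf I R).obj (.op T)) :=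
  inferInstanceAs (Monoid (Word I R T))

lemma Word.presheaf_map {I : Type} {R T T' : C} (f : T' ⟶ T) (w : Word I R T) :
    (Word.presheaf I R).map f.op w = Word.res f w := rfl

lemma Word.res_res {I : Type} {R T T' T'' : C} (f : T' ⟶ T) (g : T'' ⟶ T') (w : Word I R T) :
    Word.res g (Word.res f w) = Word.res (g ≫ f) w :=
  (congr($((Word.presheaf I R).map_comp f.op g.op) w)).symm

variable [CartesianMonoidalCategory C]

/-- The object of words of a given shape. -/
def Word.shape (R : C) {I : Type} : List I → C
  | [] => 𝟙_ C
  | _ :: l => R ⊗ Word.shape R l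

/-- The generic word of a given shape. -/
def Word.generic (R : C) {I : Type} : ∀ l : List I, Word I R (Word.shape R l)
  | [] => 1
  | i :: l => FreeMonoid.of (i, fst R (Word.shape R l)) *
      Word.res (snd R (Word.shape R l)) (Word.generic R l)

lemma Word.res_generic_cons {R T : C} {I : Type} (i : I) (l : List I)
    (f : T ⟶ R ⊗ Word.shape R l) :
    Word.res f (Word.generic R (i :: l)) =
      FreeMonoid.of (i, f ≫ fst R (Word.shape R l)) *
        Word.res (f ≫ snd R (Word.shape R l)) (Word.generic R l) := by
  change Word.res f (FreeMonoid.of _ * Word.res _ _) = _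
  rw [map_mul, res_of, res_res]

lemma Word.isFamiliallyRepresentable (I : Type) (R : C) :
    IsFamiliallyRepresentable.{w} (Word.presheaf I R) := by
  refine ⟨ULift (List I), fun l => Word.shape R l.down, fun l => Word.generic R l.down,
    fun T w => ?_⟩
  change ∃! p : Σ l : ULift (List I), (T ⟶ Word.shape R l.down),
    Word.res p.2 (Word.generic R p.1.down) = w
  induction w using FreeMonoid.inductionOn' with
  | one =>
    refine ⟨⟨⟨[]⟩, toUnit T⟩, rfl, ?_⟩
    rintro ⟨⟨_ | ⟨i, l⟩⟩, f⟩ h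
    · exact congrArg (Sigma.mk _) (toUnit_unique _ _)
    · exact (List.cons_ne_nil _ _ ((Word.res_generic_cons i l f).symm.trans h)).elim
  | of_mul a w ih =>
    obtain ⟨⟨⟨l⟩, f⟩, rfl, hu⟩ := ih
    refine ⟨⟨⟨a.1 :: l⟩, lift a.2 f⟩, ?_, ?_⟩
    · refine (Word.res_generic_cons _ l _).trans ?_
      rw [lift_fst, lift_snd]
    · rintro ⟨⟨_ | ⟨i, l'⟩⟩, g⟩ h
      · exact (List.cons_ne_nil _ _ h.symm).elim
      · obtain ⟨h₁, h₂⟩ := List.cons.inj ((Word.res_generic_cons i l' g).symm.trans h)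
        have h₃ := hu ⟨⟨l'⟩, g ≫ snd _ _⟩ h₂
        simp only [Sigma.mk.injEq, ULift.up.injEq] at h₃
        obtain ⟨rfl, h₃⟩ := h₃
        obtain rfl := eq_of_heq h₃
        subst h₁
        refine congrArg (Sigma.mk _) ?_
        dsimp only
        exact hom_ext _ _ (lift_fst _ _).symm (lift_snd _ _).symm

/-- The value of a word in a group object. -/
def Word.eval {I : Type} {R G T : C} [GrpObj G] (x : I → (R ⟶ G)) : Word I R T →* (T ⟶ G) :=
  FreeMonoid.lift fun a => a.2 ≫ x a.1

@[simp] lemma Word.eval_of {I : Type} {R G T : C} [GrpObj G] (x : I → (R ⟶ G)) (i : I)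
    (p : T ⟶ R) : Word.eval x (FreeMonoid.of (i, p)) = p ≫ x i := by
  simp [Word.eval]

lemma Word.comp_eval {I : Type} {R G T T' : C} [GrpObj G] (x : I → (R ⟶ G)) (f : T' ⟶ T)
    (w : Word I R T) : f ≫ Word.eval x w = Word.eval x (Word.res f w) := by
  induction w using FreeMonoid.inductionOn' with
  | one => rw [map_one, map_one, map_one, MonObj.comp_one]
  | of_mul a w ih =>
    obtain ⟨i, p⟩ := a
    simp [MonObj.comp_mul, ih]

lemma Word.eval_comp {I : Type} {R G H T : C} [GrpObj G] [GrpObj H] (x : I → (R ⟶ G)) (f : G ⟶ H)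
    [IsMonHom f] (w : Word I R T) : Word.eval x w ≫ f = Word.eval (fun i => x i ≫ f) w := by
  induction w using FreeMonoid.inductionOn' with
  | one => rw [map_one, map_one, MonObj.one_comp]
  | of_mul a w ih =>
    obtain ⟨i, p⟩ := a
    simp [MonObj.mul_comp, ih]

/-- The morphisms `x i` satisfy the relations `l k p q = r k p q`. -/
def SatisfiesRelations {I K : Type} {R G : C} [GrpObj G]
    (l r : K → ∀ ⦃T : C⦄, (T ⟶ R) → (T ⟶ R) → Word I R T) (x : I → (R ⟶ G)) : Prop :=
  ∀ (k : K) ⦃T : C⦄ (p q : T ⟶ R), Word.eval x (l k p q) = Word.eval x (r k p q)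

/-- Groups objects given by generators and relations exist. The generators are `(i, p)` for `i : I`
and `p` in `R`, and the relations are `l k p q = r k p q` for `k : K` and `p`, `q` in `R`.  -/
theorem exists_presented_grpObj [InfinitaryPretopos.{w} C] {I K : Type} {R : C}
    (l r : K → ∀ ⦃T : C⦄, (T ⟶ R) → (T ⟶ R) → Word I R T)
    (hl : ∀ k ⦃T T' : C⦄ (f : T' ⟶ T) (p q : T ⟶ R),
      Word.res f (l k p q) = l k (f ≫ p) (f ≫ q))
    (hr : ∀ k ⦃T T' : C⦄ (f : T' ⟶ T) (p q : T ⟶ R),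
      Word.res f (r k p q) = r k (f ≫ p) (f ≫ q))
    (inv : R ⟶ R)
    (hinv : ∀ i, ∃ k, ∀ ⦃T : C⦄ (p q : T ⟶ R),
      l k p q = FreeMonoid.of (i, p) * FreeMonoid.of (i, p ≫ inv) ∧ r k p q = 1)
    (hinv' : ∀ i, ∃ k, ∀ ⦃T : C⦄ (p q : T ⟶ R),
      l k p q = FreeMonoid.of (i, p ≫ inv) * FreeMonoid.of (i, p) ∧ r k p q = 1) :
    ∃ (G : C) (_ : GrpObj G) (x : I → (R ⟶ G)), SatisfiesRelations l r x ∧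
      (∀ ⦃T : C⦄ (g : T ⟶ G), Locally.{w} T fun _ e => ∃ a, Word.eval x a = e ≫ g) ∧
      ∀ (H : C) [GrpObj H] (y : I → (R ⟶ H)), SatisfiesRelations l r y →
        ∃! f : G ⟶ H, IsMonHom f ∧ ∀ i, x i ≫ f = y i := by
  let ρ₀ : ∀ ⦃T : C⦄, (Word.presheaf I R).obj (.op T) → (Word.presheaf I R).obj (.op T) → Prop :=
    fun T a b => ∃ k p q, l k p q = a ∧ r k p q = b
  have hρ₀ : IsSmallRel.{w} _ ρ₀ := by
    refine ⟨?_, ULift K, fun _ => R ⊗ R, fun k => l k.down (fst R R) (snd R R),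
      fun k => r k.down (fst R R) (snd R R), fun k => ⟨_, _, _, rfl, rfl⟩, ?_⟩
    · rintro T T' f _ _ ⟨k, p, q, rfl, rfl⟩
      exact ⟨k, f ≫ p, f ≫ q, (hl _ _ _ _).symm, (hr _ _ _ _).symm⟩
    · rintro T _ _ ⟨k, p, q, rfl, rfl⟩
      exact ⟨⟨k⟩, lift p q, (hl _ _ _ _).trans (by simp), (hr _ _ _ _).trans (by simp)⟩
  let ρ : ∀ ⦃T : C⦄, (Word.presheaf I R).obj (.op T) → (Word.presheaf I R).obj (.op T) → Prop :=
    fun T => CongruenceClosure (fun _ : PUnit => (· * ·)) (ρ₀ (T := T))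
  have hρ : IsSmallRel.{w} _ ρ :=
    hρ₀.congruenceClosure (Word.isFamiliallyRepresentable I R) (J := PUnit)
      (fun _ _ => (· * ·)) (fun _ T T' f x y => map_mul (Word.res f) x y)
  have he : ∀ ⦃T : C⦄, Equivalence (ρ (T := T)) := fun T => CongruenceClosure.equivalence _ _
  have hmul : ∀ ⦃T : C⦄ (x x' y y' : (Word.presheaf I R).obj (.op T)), ρ x x' → ρ y y' →
      ρ (x * y) (x' * y') := fun T x x' y y' h h' => .op ⟨⟩ h h'
  obtain ⟨G, π, hπ⟩ := hρ.exists_isLocalQuotient (Word.isFamiliallyRepresentable I R) he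
  let ν : ∀ ⦃T : C⦄, Word I R T → Word I R T := fun T w =>
    FreeMonoid.ofList (w.toList.map fun a => (a.1, a.2 ≫ inv)).reverse
  have hν : ∀ ⦃T : C⦄ (a : I × (T ⟶ R)) (w : Word I R T),
      ν (FreeMonoid.of a * w) = ν w * FreeMonoid.of (a.1, a.2 ≫ inv) := fun T a w => by
    simp [ν, FreeMonoid.toList_mul]
  obtain ⟨hG, hπm⟩ := hπ.exists_grpObj he hρ.res (fun T T' f => map_one (Word.res f))
    (fun T T' f x y => map_mul (Word.res f) x y) hmul ν
    (fun T T' f w => by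
      change Word.res f (ν w) = ν (Word.res f w)
      induction w using FreeMonoid.inductionOn' with
      | one => rfl
      | of_mul a w ih =>
        obtain ⟨i, p⟩ := a
        simp [hν, ih])
    (fun T w => by
      induction w using FreeMonoid.inductionOn' with
      | one => exact he.refl _
      | of_mul a w ih =>
        obtain ⟨k, hk⟩ := hinv' a.1
        change ρ (ν (FreeMonoid.of a * w) * (FreeMonoid.of a * w)) 1
        rw [hν, mul_assoc, ← mul_assoc (FreeMonoid.of (a.1, a.2 ≫ inv))]
        refine he.trans (hmul _ _ _ _ (he.refl _) (hmul _ 1 _ _ ?_ (he.refl _))) ?_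
        · exact .of _ _ ⟨k, a.2, a.2, hk _ _⟩
        · change ρ (ν w * w) 1
          exact ih)
    (fun T w => by
      induction w using FreeMonoid.inductionOn' with
      | one => exact he.refl _
      | of_mul a w ih =>
        obtain ⟨k, hk⟩ := hinv a.1
        change ρ (FreeMonoid.of a * w * ν (FreeMonoid.of a * w)) 1
        rw [hν, mul_assoc, ← mul_assoc w]
        refine he.trans (hmul _ _ _ _ (he.refl _) (hmul _ 1 _ _ ih (he.refl _))) ?_
        exact .of _ _ ⟨k, a.2, a.2, hk _ _⟩)
  have hπ1 : ∀ T : C, π (1 : Word I R T) = 1 := fun T => by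
    have := hπm (T := T) 1 1
    rw [mul_one] at this
    exact left_eq_mul.mp this
  let x : I → (R ⟶ G) := fun i => π (FreeMonoid.of (i, 𝟙 R))
  have hx : ∀ ⦃T : C⦄ (w : Word I R T), Word.eval x w = π w := fun T w => by
    induction w using FreeMonoid.inductionOn' with
    | one => rw [map_one, hπ1]
    | of_mul a w ih =>
      obtain ⟨i, p⟩ := a
      rw [map_mul, ih, Word.eval_of]
      refine Eq.trans ?_ (hπm _ _).symm
      congr 1
      refine (hπ.comp p _).trans ?_
      rw [Word.presheaf_map, Word.res_of, Category.comp_id]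
  refine ⟨G, hG, x, fun k T p q => ?_, fun T g => (hπ.surj g).mono fun T' e ⟨a, ha⟩ =>
    ⟨a, (hx a).trans ha⟩, fun H _ y hy => ?_⟩
  · rw [hx, hx]
    exact hπ.sound hρ.res (.of _ _ ⟨k, p, q, rfl, rfl⟩)
  · obtain ⟨f, hf⟩ := hπ.exists_desc (fun T w => Word.eval y w) (fun T T' f w => Word.comp_eval y f w)
      (fun T a b hab => by
        induction hab with
        | of a b hab =>
          obtain ⟨k, p, q, rfl, rfl⟩ := hab
          exact hy k p q
        | refl => rfl
        | symm _ ih => exact ih.symm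
        | trans _ _ ih ih' => exact ih.trans ih'
        | op _ _ _ ih ih' => exact (map_mul _ _ _).trans ((congrArg₂ _ ih ih').trans (map_mul _ _ _).symm))
    refine ⟨f, ⟨isMonHom_of_map_mul f fun {T} a b => ?_, fun i => ?_⟩, fun g ⟨hg, hg'⟩ => ?_⟩
    · refine hπ.hom_eq₂ a b fun T' e s t hs ht => ?_
      rw [← Category.assoc, MonObj.comp_mul, MonObj.comp_mul, ← hs, ← ht, ← hπm, hf,
        ← Category.assoc, ← Category.assoc, ← hs, ← ht, hf, hf]
      exact map_mul _ _ _
    · refine (hf _).trans ?_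
      rw [Word.eval_of, Category.id_comp]
    · refine hπ.hom_eq (𝟙 G) fun T e w hw => ?_
      rw [Category.comp_id] at hw
      rw [← hw, hf]
      refine (congrArg (· ≫ g) (hx w).symm).trans ((Word.eval_comp x g w).trans ?_)
      simp only [hg']

end PresentedGroups

section RingQuotients

variable {C : Type u} [Category.{v} C]

lemma isFamiliallyRepresentable_yoneda (X : C) :
    IsFamiliallyRepresentable.{w} (yoneda.obj X) :=
  ⟨PUnit, fun _ => X, fun _ => 𝟙 X, fun T x => ⟨⟨⟨⟩, x⟩, Category.comp_id x, by
    rintro ⟨⟨⟩, y⟩ rfl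
    exact congrArg (Sigma.mk _) (Category.comp_id y).symm⟩⟩

lemma IsSmallRel.exists_quotient [CartesianMonoidalCategory C] [InfinitaryPretopos.{w} C] {X : C}
    {ρ : ∀ ⦃T : C⦄, (T ⟶ X) → (T ⟶ X) → Prop} (hρ : IsSmallRel.{w} (yoneda.obj X) ρ)
    (he : ∀ ⦃T : C⦄, Equivalence (ρ (T := T))) :
    ∃ (Q : C) (q : X ⟶ Q), Epi q ∧ IsLocalQuotient.{w} (yoneda.obj X) ρ Q fun _ p => p ≫ q := by
  obtain ⟨Q, π, hπ⟩ := hρ.exists_isLocalQuotient (isFamiliallyRepresentable_yoneda X) he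
  have h : ∀ ⦃T : C⦄ (p : T ⟶ X), p ≫ π (T := X) (𝟙 X) = π p := fun T p =>
    (hπ.comp p _).trans (congrArg (π (T := T)) (Category.comp_id p))
  refine ⟨Q, π (T := X) (𝟙 X), epi_of_locally_lift _ ((hπ.surj (𝟙 Q)).mono ?_), ⟨?_, ?_, ?_⟩⟩
  · rintro T e ⟨x, hx⟩
    exact ⟨x, (h x).trans (hx.trans (Category.comp_id e))⟩
  · exact fun T T' f x => (Category.assoc _ _ _).symm
  · intro T x y
    exact (congrArg₂ Eq (h x) (h y)).to_iff.trans (hπ.eq_iff _ _)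
  · exact fun T q => (hπ.surj q).mono fun _ e ⟨x, hx⟩ => ⟨x, (h x).trans hx⟩

variable [CartesianMonoidalCategory C] [BraidedCategory C]

namespace NonUnitalRingObj

variable {R : C} [NonUnitalRingObj R] {T T' : C}

lemma comp_mul (f : T' ⟶ T) (p q : T ⟶ R) : f ≫ (p * q) = (f ≫ p) * (f ≫ q) := by
  change f ≫ lift p q ≫ rmul = lift (f ≫ p) (f ≫ q) ≫ rmul
  rw [comp_lift_assoc]

lemma comp_add (f : T' ⟶ T) (p q : T ⟶ R) : f ≫ (p + q) = f ≫ p + f ≫ q :=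
  AddMonObj.comp_add f p q

lemma comp_zero (f : T' ⟶ T) : f ≫ (0 : T ⟶ R) = 0 :=
  AddMonObj.comp_zero f

lemma comp_neg (f : T' ⟶ T) (p : T ⟶ R) : f ≫ (-p) = -(f ≫ p) :=
  AddGrpObj.comp_neg f p

lemma comp_sub (f : T' ⟶ T) (p q : T ⟶ R) : f ≫ (p - q) = f ≫ p - f ≫ q :=
  AddGrpObj.comp_sub f p q

end NonUnitalRingObj

open NonUnitalRingObj in
/-- The quotient of a ring object by the congruence generated by a small relation. -/
theorem IsSmallRel.exists_ringQuotient [InfinitaryPretopos.{w} C] {R : C} [NonUnitalRingObj R]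
    {ρ₀ : ∀ ⦃T : C⦄, (T ⟶ R) → (T ⟶ R) → Prop} (hρ₀ : IsSmallRel.{w} (yoneda.obj R) ρ₀) :
    ∃ (Q : C) (_ : NonUnitalRingObj Q) (q : R ⟶ Q), IsNonUnitalRingHom q ∧ Epi q ∧
      IsLocalQuotient.{w} (yoneda.obj R) (fun T => CongruenceClosure
        (fun (b : ULift.{w} Bool) (x y : T ⟶ R) => bif b.down then x * y else x + y) (ρ₀ (T := T))) Q
        (fun _ p => p ≫ q) := by
  let op : ULift.{w} Bool → ∀ ⦃T : C⦄, (T ⟶ R) → (T ⟶ R) → (T ⟶ R) := fun b T x y =>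
    bif b.down then x * y else x + y
  let ρ : ∀ ⦃T : C⦄, (T ⟶ R) → (T ⟶ R) → Prop := fun T =>
    CongruenceClosure (fun b => op b (T := T)) (ρ₀ (T := T))
  have hρ : IsSmallRel.{w} (yoneda.obj R) ρ :=
    hρ₀.congruenceClosure (isFamiliallyRepresentable_yoneda R) op (by
      rintro ⟨_ | _⟩ T T' f x y
      · exact comp_add f x y
      · exact comp_mul f x y)
  have he : ∀ ⦃T : C⦄, Equivalence (ρ (T := T)) := fun T => CongruenceClosure.equivalence _ _
  obtain ⟨Q, q, hq, hQ⟩ := hρ.exists_quotient he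
  have hadd : ∀ ⦃T : C⦄ (x x' y y' : T ⟶ R), ρ x x' → ρ y y' → ρ (x + y) (x' + y') :=
    fun T x x' y y' h h' =>
      CongruenceClosure.op (op := fun b => op b (T := T)) (⟨false⟩ : ULift.{w} Bool) h h'
  have hmul : ∀ ⦃T : C⦄ (x x' y y' : T ⟶ R), ρ x x' → ρ y y' → ρ (x * y) (x' * y') :=
    fun T x x' y y' h h' =>
      CongruenceClosure.op (op := fun b => op b (T := T)) (⟨true⟩ : ULift.{w} Bool) h h'
  let _ : ∀ T : C, AddMonoid ((yoneda.obj R).obj (.op T)) := fun T =>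
    inferInstanceAs (AddMonoid (T ⟶ R))
  obtain ⟨hG, hqa⟩ := hQ.exists_addGrpObj he hρ.res (fun T T' f => comp_zero f)
    (fun T T' f => comp_add f) hadd (fun T (x : T ⟶ R) => -x) (fun T T' f => comp_neg f)
    (fun T (x : T ⟶ R) => by
      change ρ (-x + x) 0
      rw [neg_add_cancel]
      exact he.refl _)
    (fun T (x : T ⟶ R) => by
      change ρ (x + -x) 0
      rw [add_neg_cancel]
      exact he.refl _)
  replace hqa : ∀ ⦃T : C⦄ (x y : T ⟶ R), (x + y) ≫ q = x ≫ q + y ≫ q := hqa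
  have hcomm : IsCommAddMonObj Q := by
    rw [isCommAddMonObj_iff_isAddCommutative]
    refine fun T => ⟨⟨fun a b => hQ.hom_eq₂ a b ?_⟩⟩
    intro T' e (x : T' ⟶ R) (y : T' ⟶ R) hx hy
    rw [AddMonObj.comp_add, AddMonObj.comp_add, ← hx, ← hy, ← hqa, ← hqa, add_comm]
  obtain ⟨m, hm⟩ := hQ.exists_desc₂ (Z := Q) (fun T (x : T ⟶ R) (y : T ⟶ R) => (x * y) ≫ q)
    (fun T T' f (x : T ⟶ R) (y : T ⟶ R) => by
      rw [← Category.assoc, comp_mul]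
      rfl)
    (fun T x x' y hx => hQ.sound hρ.res (hmul _ _ _ _ hx (he.refl y)))
    (fun T x y y' hy => hQ.sound hρ.res (hmul _ _ _ _ (he.refl x) hy))
  replace hm : ∀ ⦃T : C⦄ (x y : T ⟶ R), lift (x ≫ q) (y ≫ q) ≫ m = (x * y) ≫ q := hm
  let inst : NonUnitalRingObj Q :=
    { toAddGrpObj := hG
      toIsCommAddMonObj := hcomm
      rmul := m
      rmul_assoc := fun {T} a b c => hQ.hom_eq₃ a b c (by
        intro T' e (x : T' ⟶ R) (y : T' ⟶ R) (z : T' ⟶ R) hx hy hz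
        rw [comp_lift_assoc, comp_lift_assoc, comp_lift_assoc, comp_lift_assoc, ← hx, ← hy, ← hz,
          hm, hm, hm, hm, mul_assoc])
      rmul_add := fun {T} a b c => hQ.hom_eq₃ a b c (by
        intro T' e (x : T' ⟶ R) (y : T' ⟶ R) (z : T' ⟶ R) hx hy hz
        rw [comp_lift_assoc, AddMonObj.comp_add, AddMonObj.comp_add, comp_lift_assoc,
          comp_lift_assoc, ← hx, ← hy, ← hz, ← hqa, hm, hm, hm, ← hqa, mul_add])
      add_rmul := fun {T} a b c => hQ.hom_eq₃ a b c (by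
        intro T' e (x : T' ⟶ R) (y : T' ⟶ R) (z : T' ⟶ R) hx hy hz
        rw [comp_lift_assoc, AddMonObj.comp_add, AddMonObj.comp_add, comp_lift_assoc,
          comp_lift_assoc, ← hx, ← hy, ← hz, ← hqa, hm, hm, hm, ← hqa, add_mul]) }
  exact ⟨Q, inst, q, ⟨fun p r => hqa p r, fun p r => (hm p r).symm⟩, hq, hQ⟩

/-- The generators of the ideal which defines `R_{2ε}`. -/
def twoEpsGenerator {A : Type*} [NonUnitalRing A] (k : Fin 3) (p q : A) : A :=
  ![p + p, p * q - q * p, (p * p - p) * (q * q - q)] k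

open NonUnitalRingObj in
/-- The relation which generates the congruence defining `R_{2ε}`. -/
lemma isSmallRel_twoEps (R : C) [NonUnitalRingObj R] :
    IsSmallRel.{w} (yoneda.obj R) fun T (x : T ⟶ R) (y : T ⟶ R) =>
      y = 0 ∧ ∃ (k : Fin 3) (p q : T ⟶ R), twoEpsGenerator k p q = x := by
  have h : ∀ ⦃T T' : C⦄ (f : T' ⟶ T) (k : Fin 3) (p q : T ⟶ R),
      f ≫ twoEpsGenerator k p q = twoEpsGenerator k (f ≫ p) (f ≫ q) := fun T T' f k p q => by
    fin_cases k <;> simp [twoEpsGenerator, comp_mul, comp_sub, comp_add]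
  refine ⟨?_, ULift (Fin 3), fun _ => R ⊗ R, fun k =>
    (twoEpsGenerator k.down (fst R R) (snd R R) : R ⊗ R ⟶ R),
    fun _ => (0 : R ⊗ R ⟶ R), fun k => ⟨rfl, _, _, _, rfl⟩, ?_⟩
  · rintro T T' f _ _ ⟨rfl, k, p, q, rfl⟩
    exact ⟨comp_zero f, k, f ≫ p, f ≫ q, (h f k p q).symm⟩
  · rintro T _ _ ⟨rfl, k, p, q, rfl⟩
    exact ⟨⟨k⟩, lift p q, (h _ _ _ _).trans (by simp), comp_zero _⟩

/-- The factor-ring `R_{2ε}` exists, and it is given by the congruence generated by its defining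
relations. -/
theorem exists_isTwoEpsQuotient [InfinitaryPretopos.{w} C] (R : C) [NonUnitalRingObj R] :
    ∃ (Q : C) (_ : NonUnitalRingObj Q) (q : R ⟶ Q), IsTwoEpsQuotient q ∧ Epi q ∧
      ∀ ⦃T : C⦄ (p p' : T ⟶ R), p ≫ q = p' ≫ q → Locally.{w} T fun T' e => CongruenceClosure
        (fun (b : ULift.{w} Bool) (x y : T' ⟶ R) => bif b.down then x * y else x + y)
        (fun x y => y = 0 ∧ ∃ (k : Fin 3) (p q : T' ⟶ R), twoEpsGenerator k p q = x)
        (e ≫ p) (e ≫ p') := by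
  obtain ⟨Q, hQr, q, hq, hepi, hQ⟩ := (isSmallRel_twoEps.{w} R).exists_ringQuotient
  have hz : ∀ T : C, (0 : T ⟶ R) ≫ q = 0 := fun T => by
    have := hq.map_add (T := T) 0 0
    rw [add_zero] at this
    exact left_eq_add.mp this
  have hk : ∀ ⦃T : C⦄ (k : Fin 3) (x y : T ⟶ R), twoEpsGenerator k x y ≫ q = 0 := fun T k x y => by
    rw [← hz]
    refine (hQ.eq_iff _ _).2 (.of_id (.of _ _ ?_))
    exact (isSmallRel_twoEps.{w} R).res _ _ _ ⟨rfl, k, x, y, rfl⟩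
  refine ⟨Q, hQr, q, ⟨hq, fun p r => ⟨hk 0 p r, hk 1 p r, hk 2 p r⟩, fun S _ f hf hf' => ?_⟩, hepi,
    fun T p p' h => (hQ.eq_iff p p').1 h⟩
  obtain ⟨g, hg⟩ := hQ.exists_desc (Z := S) (fun T (p : T ⟶ R) => p ≫ f)
    (fun T T' e p => (Category.assoc _ _ _).symm) (fun T x y h => by
      induction h with
      | of x y h =>
        obtain ⟨rfl, k, p, r, rfl⟩ := h
        have h0 : (0 : T ⟶ R) ≫ f = 0 := by
          have := hf.map_add (T := T) 0 0
          rw [add_zero] at this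
          exact left_eq_add.mp this
        refine Eq.trans ?_ h0.symm
        fin_cases k
        · exact (hf' p r).1
        · exact (hf' p r).2.1
        · exact (hf' p r).2.2
      | refl => rfl
      | symm _ ih => exact ih.symm
      | trans _ _ ih ih' => exact ih.trans ih'
      | op b _ _ ih ih' =>
        obtain ⟨_ | _⟩ := b
        · exact (hf.map_add _ _).trans ((congrArg₂ _ ih ih').trans (hf.map_add _ _).symm)
        · exact (hf.map_mul _ _).trans ((congrArg₂ _ ih ih').trans (hf.map_mul _ _).symm))
  replace hg : ∀ ⦃T : C⦄ (p : T ⟶ R), (p ≫ q) ≫ g = p ≫ f := hg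
  refine ⟨g, ⟨⟨fun {T} a b => hQ.hom_eq₂ a b ?_, fun {T} a b => hQ.hom_eq₂ a b ?_⟩, ?_⟩, ?_⟩
  · intro T' e (x : T' ⟶ R) (y : T' ⟶ R) hx hy
    rw [← Category.assoc, NonUnitalRingObj.comp_add, NonUnitalRingObj.comp_add, ← hx, ← hy,
      ← hq.map_add, hg, ← Category.assoc, ← Category.assoc, ← hx, ← hy, hg, hg, hf.map_add]
  · intro T' e (x : T' ⟶ R) (y : T' ⟶ R) hx hy
    rw [← Category.assoc, NonUnitalRingObj.comp_mul, NonUnitalRingObj.comp_mul, ← hx, ← hy,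
      ← hq.map_mul, hg, ← Category.assoc, ← Category.assoc, ← hx, ← hy, hg, hg, hf.map_mul]
  · simpa using hg (𝟙 R)
  · rintro g' ⟨-, hg'⟩
    rw [← cancel_epi q, hg', ← Category.id_comp q, hg, Category.id_comp]

end RingQuotients

section CommPairings

/-- The properties of the commutator pairing of a central extension `d` which do not refer to the
surjectivity of `d`. -/
structure CommPairing {X G : Type*} [Group X] [Group G] (d : X → G) (β : G → G → X) : Prop where
  map : ∀ a b, d (β a b) = ⁅a, b⁆
  comm : ∀ x y, β (d x) (d y) = ⁅x, y⁆
  swap : ∀ a b, β a b * β b a = 1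
  one_left : ∀ a, β 1 a = 1
  mul_left : ∀ a b c, β (a * b) c = β a ⁅b, c⁆ * β b c * β a c
  conj : ∀ a b c, β (a * b * a⁻¹) (a * c * a⁻¹) = β a ⁅b, c⁆ * β b c
  central : ∀ z h, d z = 1 → z * h = h * z

namespace CommPairing

variable {X G : Type*} [Group X] [Group G] {d : X → G} {β : G → G → X} (H : CommPairing d β)
include H

lemma swap' (a b : G) : β a b = (β b a)⁻¹ :=
  eq_inv_of_mul_eq_one_left (H.swap a b)

lemma one_right (a : G) : β a 1 = 1 := by
  rw [H.swap', H.one_left, inv_one]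

lemma mul_right (a b c : G) : β a (b * c) = β a b * β a c * (β b ⁅c, a⁆)⁻¹ := by
  rw [H.swap', H.mul_left, H.swap' a b, H.swap' a c]
  group

lemma pairing_mul_comm {a b : G} (h : ⁅a, b⁆ = 1) (x : X) : β a b * x = x * β a b :=
  H.central _ _ (by rw [H.map, h])

lemma mul_left_of_comm (a : G) {b c : G} (h : ⁅b, c⁆ = 1) : β (a * b) c = β b c * β a c := by
  rw [H.mul_left, h, H.one_right, one_mul]

lemma mul_right_of_comm (a : G) {b c : G} (h : ⁅c, a⁆ = 1) : β a (b * c) = β a b * β a c := by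
  rw [H.mul_right, h, H.one_right, inv_one, mul_one]

lemma commutator_left {a b c : G} (ha : ⁅a, c⁆ = 1) (hb : ⁅b, c⁆ = 1) : β ⁅a, b⁆ c = 1 := by
  have h := H.conj a b c
  rw [hb, H.one_right, one_mul, commutatorElement_eq_one_iff_mul_comm.1 ha, mul_inv_cancel_right,
    show a * b * a⁻¹ = ⁅a, b⁆ * b by rw [commutatorElement_def]; group,
    H.mul_left_of_comm _ hb] at h
  exact mul_eq_left.1 h

lemma commutator_right_of_comm_right (u : G) {a b : G} (h : ⁅u, b⁆ = 1) :
    β u ⁅a, b⁆ * β a b = β ⁅u, a⁆ ⁅a, b⁆ * β a b * β ⁅u, a⁆ b := by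
  rw [← H.mul_left, ← H.conj, commutatorElement_eq_one_iff_mul_comm.1 h, mul_inv_cancel_right,
    show u * a * u⁻¹ = ⁅u, a⁆ * a by rw [commutatorElement_def]; group]

lemma commutator_right_of_comm_left (u : G) {a b : G} (h : ⁅u, a⁆ = 1) :
    β u ⁅a, b⁆ * β a b = β a ⁅u, b⁆ * β a b * (β ⁅u, b⁆ ⁅b, a⁆)⁻¹ := by
  rw [← H.mul_right, ← H.conj, commutatorElement_eq_one_iff_mul_comm.1 h, mul_inv_cancel_right,
    show u * b * u⁻¹ = ⁅u, b⁆ * b by rw [commutatorElement_def]; group]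

end CommPairing

/-- The Steinberg relations of type `A₃` for elements of a group, together with a commutator
pairing. -/
structure SteinbergPairing {A X G : Type*} [NonUnitalRing A] [Group X] [Group G]
    (x : Fin 4 → Fin 4 → A → G) (d : X → G) (β : G → G → X) : Prop extends CommPairing d β where
  map_add : ∀ {i j : Fin 4}, i ≠ j → ∀ p q, x i j (p + q) = x i j p * x i j q
  comm_mul : ∀ {i j k : Fin 4}, i ≠ j → j ≠ k → i ≠ k → ∀ p q, ⁅x i j p, x j k q⁆ = x i k (p * q)
  comm_one : ∀ {i j k l : Fin 4}, i ≠ j → k ≠ l → j ≠ k → i ≠ l → ∀ p q, ⁅x i j p, x k l q⁆ = 1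

/-- A Steinberg pairing which vanishes on pairs of distinct roots with acute angle and on pairs of
equal roots. -/
structure ReducedSteinbergPairing {A X G : Type*} [NonUnitalRing A] [Group X] [Group G]
    (x : Fin 4 → Fin 4 → A → G) (d : X → G) (β : G → G → X) : Prop
    extends SteinbergPairing x d β where
  vanish : ∀ {i j k l : Fin 4}, i ≠ j → k ≠ l → j ≠ k → i ≠ l → (i = k ∨ j = l) →
    ∀ p q, β (x i j p) (x k l q) = 1

variable {A X G : Type*} [NonUnitalRing A] [Group X] [Group G]
  {x : Fin 4 → Fin 4 → A → G} {d : X → G} {β : G → G → X}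

namespace SteinbergPairing

variable (H : SteinbergPairing x d β)
include H

lemma map_zero {i j : Fin 4} (hij : i ≠ j) : x i j 0 = 1 := by
  have h := H.map_add hij 0 0
  rw [add_zero] at h
  exact left_eq_mul.1 h

lemma map_neg {i j : Fin 4} (hij : i ≠ j) (p : A) : x i j (-p) = (x i j p)⁻¹ :=
  eq_inv_of_mul_eq_one_left (by rw [← H.map_add hij, neg_add_cancel, H.map_zero hij])

lemma comm_mul_swap {i j k : Fin 4} (hij : i ≠ j) (hjk : j ≠ k) (hik : i ≠ k) (p q : A) :
    ⁅x j k p, x i j q⁆ = x i k (-(q * p)) := by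
  rw [← commutatorElement_inv, H.comm_mul hij hjk hik, H.map_neg hik]

lemma pairing_mul_eq_one {i j k l : Fin 4} (hij : i ≠ j) (hkl : k ≠ l) (hjk : j ≠ k) (hil : i ≠ l)
    (h : i = k ∨ j = l) (p q r : A) : β (x i j (p * q)) (x k l r) = 1 := by
  obtain ⟨m, hi, hj, hk, hl⟩ : ∃ m : Fin 4, i ≠ m ∧ m ≠ j ∧ m ≠ k ∧ m ≠ l := by
    revert i j k l; decide
  rw [← H.comm_mul hi hj hij]
  exact H.commutator_left (H.comm_one hi hkl hk hil _ _) (H.comm_one hj hkl hjk hl _ _)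

end SteinbergPairing

namespace ReducedSteinbergPairing

variable (H : ReducedSteinbergPairing x d β) {i j k l : Fin 4}
include H

lemma disjoint_add_left (hij : i ≠ j) (hkl : k ≠ l) (hjk : j ≠ k) (hil : i ≠ l) (p q r : A) :
    β (x i j (p + q)) (x k l r) = β (x i j p) (x k l r) * β (x i j q) (x k l r) := by
  have h := H.comm_one hij hkl hjk hil
  rw [H.map_add hij, H.mul_left_of_comm _ (h _ _), H.pairing_mul_comm (h _ _)]

lemma disjoint_add_right (hij : i ≠ j) (hkl : k ≠ l) (hjk : j ≠ k) (hil : i ≠ l) (p q r : A) :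
    β (x i j p) (x k l (q + r)) = β (x i j p) (x k l q) * β (x i j p) (x k l r) := by
  rw [H.map_add hkl, H.mul_right_of_comm _ (H.comm_one hkl hij hil.symm hjk.symm _ _)]

lemma adjacent_add_left (hij : i ≠ j) (hjk : j ≠ k) (hik : i ≠ k) (p q r : A) :
    β (x i j (p + q)) (x j k r) = β (x i j p) (x j k r) * β (x i j q) (x j k r) := by
  rw [add_comm, H.map_add hij, H.mul_left, H.comm_mul hij hjk hik,
    H.vanish hij hik hij.symm hik (.inl rfl), one_mul]

lemma adjacent_add_right (hij : i ≠ j) (hjk : j ≠ k) (hik : i ≠ k) (p q r : A) :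
    β (x i j p) (x j k (q + r)) = β (x i j p) (x j k q) * β (x i j p) (x j k r) := by
  rw [H.map_add hjk, H.mul_right, H.comm_mul_swap hij hjk hik,
    H.vanish hjk hik hik.symm hjk (.inr rfl), inv_one, mul_one]

lemma disjoint_mul_right_eq_inv (hij : i ≠ j) (hik : i ≠ k) (hil : i ≠ l) (hjk : j ≠ k)
    (_ : j ≠ l) (hkl : k ≠ l) (p q r : A) :
    β (x k l p) (x i j (q * r)) = (β (x i l (q * p)) (x k j r))⁻¹ := by
  have h := H.commutator_right_of_comm_right (x k l p) (a := x i k q) (b := x k j r)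
    (H.comm_one hkl hjk.symm hkl.symm hjk.symm _ _)
  rw [H.comm_mul hik hjk.symm hij, H.comm_mul_swap hik hkl hil,
    H.vanish hil hij hil.symm hij (.inl rfl), one_mul,
    H.pairing_mul_comm (H.comm_one hkl hij hil.symm hjk.symm _ _)] at h
  rw [mul_left_cancel h, eq_inv_iff_mul_eq_one,
    ← H.disjoint_add_left hil hjk.symm hkl.symm hij, neg_add_cancel, H.map_zero hil, H.one_left]

lemma disjoint_mul_right_eq (hij : i ≠ j) (_ : i ≠ k) (hil : i ≠ l) (hjk : j ≠ k)
    (hjl : j ≠ l) (hkl : k ≠ l) (p q r : A) :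
    β (x k l p) (x i j (q * r)) = β (x i l q) (x k j (p * r)) := by
  have h := H.commutator_right_of_comm_left (x k l p) (a := x i l q) (b := x l j r)
    (H.comm_one hkl hil hil.symm hkl _ _)
  rw [H.comm_mul hil hjl.symm hij, H.comm_mul hkl hjl.symm hjk.symm,
    H.comm_mul_swap hil hjl.symm hij, H.vanish hjk.symm hij hij.symm hjk.symm (.inr rfl), inv_one,
    mul_one] at h
  exact mul_right_cancel h

lemma disjoint_mul_left (hij : i ≠ j) (hik : i ≠ k) (hil : i ≠ l) (hjk : j ≠ k)
    (hjl : j ≠ l) (hkl : k ≠ l) (p q r : A) :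
    β (x i j (p * q)) (x k l r) = (β (x i j p) (x k l (q * r)))⁻¹ := by
  rw [← H.disjoint_mul_right_eq hil hik hij hkl.symm hjl.symm hjk.symm,
    H.disjoint_mul_right_eq_inv hil hik hij hkl.symm hjl.symm hjk.symm, inv_inv]

/-- The pairing of disjoint roots is `2`-torsion. -/
lemma disjoint_mul_mul_sq (hij : i ≠ j) (hik : i ≠ k) (hil : i ≠ l) (hjk : j ≠ k)
    (hjl : j ≠ l) (hkl : k ≠ l) (p q r s : A) :
    β (x i j p) (x k l (q * r * s)) * β (x i j p) (x k l (q * r * s)) = 1 := by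
  have h := H.disjoint_mul_left hij hik hil hjk hjl hkl p (q * r) s
  rw [← mul_assoc p, H.disjoint_mul_left hij hik hil hjk hjl hkl,
    H.disjoint_mul_left hij hik hil hjk hjl hkl, inv_inv, ← mul_assoc q] at h
  rw [← eq_inv_iff_mul_eq_one, ← h]

lemma adjacent_mul_left (hij : i ≠ j) (hik : i ≠ k) (hil : i ≠ l) (hjk : j ≠ k)
    (hjl : j ≠ l) (hkl : k ≠ l) (a b r : A) :
    β (x i j (a * b)) (x j k r) =
      β (x i l a) (x l k (b * r)) * β (x l k (b * r)) (x i j (a * b)) := by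
  have hlk := H.comm_one hkl.symm hij hik.symm hjl.symm
  have h := H.commutator_right_of_comm_left (x j k r) (a := x i l a) (b := x l j b)
    (H.comm_one hjk hil hik.symm hjl _ _)
  rw [H.comm_mul hil hjl.symm hij, H.comm_mul_swap hjl.symm hjk hkl.symm,
    H.comm_mul_swap hil hjl.symm hij] at h
  have h0 : β (x l k (-(b * r))) (x i j (-(a * b))) = β (x l k (b * r)) (x i j (a * b)) := by
    have h1 : ∀ p, β (x l k (-(b * r))) (x i j p) = (β (x l k (b * r)) (x i j p))⁻¹ := fun p => by
      rw [eq_inv_iff_mul_eq_one, ← H.disjoint_add_left hkl.symm hij hik.symm hjl.symm,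
        neg_add_cancel, H.map_zero hkl.symm, H.one_left]
    rw [h1, inv_eq_iff_mul_eq_one, ← H.disjoint_add_right hkl.symm hij hik.symm hjl.symm,
      neg_add_cancel, H.map_zero hij, H.one_right]
  have h2 : β (x i l a) (x l k (-(b * r))) = (β (x i l a) (x l k (b * r)))⁻¹ := by
    rw [eq_inv_iff_mul_eq_one, ← H.adjacent_add_right hil hkl.symm hik,
      neg_add_cancel, H.map_zero hkl.symm, H.one_right]
  have hQ : Commute (β (x i l a) (x l j b)) (β (x l k (b * r)) (x i j (a * b)))⁻¹ :=
    (show Commute _ _ from (H.pairing_mul_comm (hlk _ _) _).symm).inv_right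
  rw [h0, h2, mul_assoc, hQ.eq, ← mul_assoc, mul_left_inj, H.swap' (x j k r), ← mul_inv_rev,
    inv_inj] at h
  rw [h, H.pairing_mul_comm (hlk _ _)]

end ReducedSteinbergPairing

end CommPairings

section WeakUnits

variable {C : Type u} [Category.{v} C] [CartesianMonoidalCategory C]

lemma exists_epi_lift [InfinitaryPretopos.{w} C] {T X Y : C} (p : X ⟶ Y) [Epi p] (f : T ⟶ Y) :
    ∃ (T' : C) (e : T' ⟶ T) (g : T' ⟶ X), Epi e ∧ g ≫ p = e ≫ f := by
  have := strongEpi_of_epi_of_pretopos.{w} p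
  have : StrongEpi (pullback.snd p f) := inferInstance
  exact ⟨pullback p f, pullback.snd p f, pullback.fst p f, inferInstance, pullback.condition⟩

variable [BraidedCategory C]

open NonUnitalRingObj

namespace IsWeakUnit

variable {R : C} [NonUnitalRingObj R] {E : Subobject R} (hE : IsWeakUnit R E) {T : C}
include hE

lemma factors_mul {a b : T ⟶ R} (ha : E.Factors a) (hb : E.Factors b) : E.Factors (a * b) := by
  obtain ⟨m, hm, -⟩ := hE.mul_epi
  rw [← Subobject.factorThru_arrow E a ha, ← Subobject.factorThru_arrow E b hb]
  rw [Subobject.factors_iff]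
  refine ⟨lift (E.factorThru a ha) (E.factorThru b hb) ≫ m, ?_⟩
  change (_ ≫ m) ≫ E.arrow = lift (_ ≫ E.arrow) (_ ≫ E.arrow) ≫ rmul
  rw [Category.assoc, hm, lift_map_assoc]

section

variable [InfinitaryPretopos.{w} C]

lemma exists_mul (p : T ⟶ R) : ∃ (T' : C) (e : T' ⟶ T) (m t : T' ⟶ R), Epi e ∧ E.Factors t ∧
    e ≫ p = m * t := by
  have := hE.smul_epi
  obtain ⟨T', e, g, he, hg⟩ := exists_epi_lift.{w} ((R ◁ E.arrow) ≫ rmul) p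
  refine ⟨T', e, g ≫ fst _ _, g ≫ snd _ _ ≫ E.arrow, he, ?_, ?_⟩
  · rw [← Category.assoc]
    exact Subobject.factors_comp_arrow _
  · rw [← hg]
    change g ≫ (R ◁ E.arrow) ≫ rmul = lift (g ≫ fst _ _) (g ≫ snd _ _ ≫ E.arrow) ≫ rmul
    rw [← Category.assoc]
    congr 1
    ext <;> simp

lemma exists_mul₂ (p q : T ⟶ R) : ∃ (T' : C) (e : T' ⟶ T) (m n t : T' ⟶ R), Epi e ∧ E.Factors t ∧
    e ≫ p = m * t ∧ e ≫ q = n * t := by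
  obtain ⟨T₁, e₁, m, s, h₁, hs, hp⟩ := exists_mul.{w} hE p
  obtain ⟨T₂, e₂, n, t, h₂, ht, hq⟩ := exists_mul.{w} hE (e₁ ≫ q)
  obtain ⟨T₃, e₃, r, a, b, h₃, hr, -, -, ha, hb⟩ := hE.common_divisor (e₂ ≫ s) t
    (Subobject.factors_of_factors_right _ hs) ht
  refine ⟨T₃, e₃ ≫ e₂ ≫ e₁, (e₃ ≫ e₂ ≫ m) * a, (e₃ ≫ n) * b, r, epi_comp _ _, hr, ?_, ?_⟩
  · rw [Category.assoc, Category.assoc, hp, comp_mul, comp_mul, ha, mul_assoc]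
  · rw [Category.assoc, Category.assoc, hq, comp_mul, hb, mul_assoc]

lemma exists_mul_sq {p : T ⟶ R} (hp : E.Factors p) : ∃ (T' : C) (e : T' ⟶ T) (s t : T' ⟶ R),
    Epi e ∧ E.Factors t ∧ e ≫ p = s * (t * t) := by
  obtain ⟨m, hm, hm'⟩ := hE.mul_epi
  obtain ⟨T₁, e₁, g, h₁, hg⟩ := exists_epi_lift.{w} m (E.factorThru p hp)
  obtain ⟨T₂, e₂, t, a, b, h₂, ht, -, -, ha, hb⟩ := hE.common_divisor (g ≫ fst _ _ ≫ E.arrow)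
    (g ≫ snd _ _ ≫ E.arrow) (by rw [← Category.assoc]; exact Subobject.factors_comp_arrow _)
    (by rw [← Category.assoc]; exact Subobject.factors_comp_arrow _)
  refine ⟨T₂, e₂ ≫ e₁, a * b, t, epi_comp _ _, ht, ?_⟩
  have h : e₁ ≫ p = (g ≫ fst _ _ ≫ E.arrow) * (g ≫ snd _ _ ≫ E.arrow) := by
    rw [← Subobject.factorThru_arrow E p hp, ← Category.assoc, ← hg, Category.assoc, hm,
      ← Category.assoc]
    change _ = lift (g ≫ _) (g ≫ _) ≫ rmul
    congr 1
    ext <;> simp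
  rw [Category.assoc, h, comp_mul, ha, hb, mul_assoc, ← mul_assoc t, hE.central t b ht]
  simp only [mul_assoc]

lemma exists_mul_mul_pow (p : T ⟶ R) : ∃ (T' : C) (e : T' ⟶ T) (a b t : T' ⟶ R),
    Epi e ∧ E.Factors t ∧ e ≫ p = a * (b * (t * t * (t * t) * (t * t))) := by
  obtain ⟨T₁, e₁, m, s, h₁, hs, hp⟩ := exists_mul.{w} hE p
  obtain ⟨T₂, e₂, s₁, t₁, h₂, ht₁, hp₁⟩ := exists_mul_sq.{w} hE hs
  obtain ⟨T₃, e₃, s₂, t₂, h₃, ht₂, hp₂⟩ := exists_mul_sq.{w} hE ht₁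
  obtain ⟨T₄, e₄, s₃, t₃, h₄, ht₃, hp₃⟩ := exists_mul_sq.{w} hE ht₂
  refine ⟨T₄, e₄ ≫ e₃ ≫ e₂ ≫ e₁, e₄ ≫ e₃ ≫ e₂ ≫ m,
    (e₄ ≫ e₃ ≫ s₁) * ((e₄ ≫ s₂) * (s₃ * s₃) * ((e₄ ≫ s₂) * (s₃ * s₃)) * (t₃ * t₃)), t₃,
    epi_comp _ _, ht₃, ?_⟩
  have h : ∀ s t : T₄ ⟶ R, E.Factors t → s * (t * t) * (s * (t * t)) = s * s * (t * t * (t * t)) :=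
    fun s t ht => by
      rw [mul_assoc, ← mul_assoc (t * t) s, hE.central (t * t) s (hE.factors_mul ht ht)]
      simp only [mul_assoc]
  simp only [Category.assoc, hp, comp_mul, hp₁, hp₂, hp₃]
  rw [h _ _ ht₃, ← mul_assoc (e₄ ≫ s₂), h _ _ (hE.factors_mul ht₃ ht₃)]
  simp only [mul_assoc]

lemma hom_ext {X : C} {f g : R ⟶ X}
    (h : ∀ {T : C} (a b t : T ⟶ R), E.Factors t →
      (a * (b * (t * t * (t * t) * (t * t)))) ≫ f = (a * (b * (t * t * (t * t) * (t * t)))) ≫ g) :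
    f = g := by
  obtain ⟨T, e, a, b, t, he, ht, hp⟩ := exists_mul_mul_pow.{w} hE (𝟙 R)
  rw [← cancel_epi e, ← Category.comp_id e, hp, h a b t ht]

lemma hom_ext_mul {X : C} {f g : R ⟶ X} (h : ∀ {T : C} (a b : T ⟶ R), (a * b) ≫ f = (a * b) ≫ g) :
    f = g :=
  hom_ext.{w} hE fun _ _ _ _ => h _ _

/-- A balanced biadditive map is induced by a homomorphism. -/
theorem exists_hom_of_balanced {X : C} [GrpObj X] (f : R ⊗ R ⟶ X)
    (hl : ∀ {T : C} (p q r : T ⟶ R), lift (p + q) r ≫ f = (lift p r ≫ f) * (lift q r ≫ f))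
    (hb : ∀ {T : C} (p q r : T ⟶ R), lift (p * q) r ≫ f = lift p (q * r) ≫ f) :
    ∃ h : R ⟶ X, IsAddToMulHom h ∧ ∀ {T : C} (p q : T ⟶ R), lift p q ≫ f = (p * q) ≫ h := by
  have := hE.smul_epi
  have hs : ∀ {T : C} (s : T ⟶ R ⊗ (E : C)), s ≫ (R ◁ E.arrow) =
      lift (s ≫ fst _ _) (s ≫ snd _ _ ≫ E.arrow) := fun s => by ext <;> simp
  have key : ∀ {T : C} (m s n t : T ⟶ R), E.Factors s → E.Factors t → m * s = n * t →
      lift m s ≫ f = lift n t ≫ f := by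
    intro T m s n t hs ht h
    obtain ⟨T₁, e₁, r, a, b, h₁, hr, ha', hb', ha, hb₁⟩ := hE.common_divisor s t hs ht
    have h0 : ((e₁ ≫ m) * a - (e₁ ≫ n) * b) * r = 0 := by
      rw [sub_mul, mul_assoc, mul_assoc, ← ha, ← hb₁, ← comp_mul, ← comp_mul, h, sub_self]
    obtain ⟨T₂, e₂, r₁, r₂, h₂, -, -, hr', hr₁⟩ := hE.torsion _ r hr h0
    rw [comp_sub, sub_mul, sub_eq_zero] at hr₁
    rw [← cancel_epi e₁, ← cancel_epi e₂, comp_lift_assoc, comp_lift_assoc, comp_lift_assoc,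
      comp_lift_assoc, ha, hb₁, comp_mul, comp_mul, ← hb, ← hb, hr', ← hb, ← hb, ← comp_mul,
      ← comp_mul, hr₁]
  obtain ⟨h, hh⟩ := exists_desc_of_epi.{w} ((R ◁ E.arrow) ≫ rmul) ((R ◁ E.arrow) ≫ f)
    (fun T s t hst => by
      rw [← Category.assoc, ← Category.assoc, hs, hs] at hst ⊢
      refine key _ _ _ _ ?_ ?_ hst <;>
      · rw [← Category.assoc]
        exact Subobject.factors_comp_arrow _)
  have hh' : ∀ {T : C} (m t : T ⟶ R), E.Factors t → (m * t) ≫ h = lift m t ≫ f := by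
    intro T m t ht
    have h1 := congrArg (lift m (E.factorThru t ht) ≫ ·) hh
    simp only [← Category.assoc, hs] at h1
    simp only [lift_fst, Category.assoc, lift_snd_assoc, Subobject.factorThru_arrow] at h1
    rw [← h1, ← Category.assoc]
    rfl
  refine ⟨h, fun {T} p q => ?_, fun {T} p q => ?_⟩
  · obtain ⟨T', e, m, n, t, he, ht, hp, hq⟩ := exists_mul₂.{w} hE p q
    rw [← cancel_epi e, ← Category.assoc, comp_add, MonObj.comp_mul, ← Category.assoc,
      ← Category.assoc, hp, hq, ← add_mul, hh' _ _ ht, hh' _ _ ht, hh' _ _ ht, hl]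
  · obtain ⟨T', e, m, t, he, ht, hq⟩ := exists_mul.{w} hE q
    rw [← cancel_epi e, comp_lift_assoc, ← Category.assoc, comp_mul, hq, ← hb, ← mul_assoc,
      hh' _ _ ht]

end

end IsWeakUnit

end WeakUnits

section Pairings

variable {C : Type u} [Category.{v} C] [CartesianMonoidalCategory C]

lemma GrpObj.comp_commutator {G T T' : C} [GrpObj G] (f : T' ⟶ T) (a b : T ⟶ G) :
    f ≫ ⁅a, b⁆ = ⁅f ≫ a, f ≫ b⁆ := by
  simp only [commutatorElement_def, MonObj.comp_mul, GrpObj.comp_inv]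

lemma GrpObj.commutator_comp {G H T : C} [GrpObj G] [GrpObj H] (f : G ⟶ H) [IsMonHom f]
    (a b : T ⟶ G) : ⁅a, b⁆ ≫ f = ⁅a ≫ f, b ≫ f⁆ := by
  simp only [commutatorElement_def, MonObj.mul_comp, GrpObj.inv_comp]

lemma epi_tensor_of_epi [InfinitaryPretopos.{w} C] {X Y : C} (d : X ⟶ Y) [Epi d] :
    Epi (d ⊗ₘ d) := by
  refine ⟨fun {Z} f g hfg => ?_⟩
  obtain ⟨T, e, a, he, ha⟩ := exists_epi_lift.{w} d (fst Y Y)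
  obtain ⟨T', e', b, he', hb⟩ := exists_epi_lift.{w} d (e ≫ snd Y Y)
  have h : lift (e' ≫ a) b ≫ (d ⊗ₘ d) = e' ≫ e := by
    ext <;> simp [ha, hb]
  rw [← cancel_epi e, ← cancel_epi e', ← Category.assoc, ← Category.assoc, ← h, Category.assoc,
    hfg, Category.assoc]

namespace IsCentralExtension

variable {X G : C} [GrpObj X] [GrpObj G] {d : X ⟶ G}

lemma commutator_eq_of_comp_eq (hd : IsCentralExtension d) {T : C} {x x' y y' : T ⟶ X}
    (hx : x ≫ d = x' ≫ d) (hy : y ≫ d = y' ≫ d) : ⁅x, y⁆ = ⁅x', y'⁆ := by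
  have := hd.isHom
  have h : ∀ a b : T ⟶ X, a ≫ d = b ≫ d → ∃ z, (∀ h, z * h = h * z) ∧ a = z * b := by
    intro a b hab
    refine ⟨a * b⁻¹, fun h => hd.central _ h ?_, by group⟩
    rw [MonObj.mul_comp, GrpObj.inv_comp, hab, mul_inv_cancel]
  obtain ⟨z, hz, rfl⟩ := h _ _ hx
  obtain ⟨t, ht, rfl⟩ := h _ _ hy
  have h₁ : z * x' * (t * y') = z * t * (x' * y') := by
    rw [mul_assoc, ← mul_assoc x', ← ht x', mul_assoc t, mul_assoc]
  have h₂ : t * y' * (z * x') = z * t * (y' * x') := by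
    rw [hz t, mul_assoc, ← mul_assoc y', ← hz y', mul_assoc z, mul_assoc]
  have h₃ : ∀ h, z * t * h = h * (z * t) := fun h => by
    rw [mul_assoc, ht, ← mul_assoc, hz, mul_assoc]
  rw [commutatorElement_def, mul_assoc, ← mul_inv_rev, h₁, h₂, h₃ (x' * y'), h₃ (y' * x')]
  group

variable [InfinitaryPretopos.{w} C]

lemma exists_pairing (hd : IsCentralExtension d) : ∃ B : G ⊗ G ⟶ X, IsCommutatorPairing d B := by
  have := hd.isHom
  have := hd.epi
  have := epi_tensor_of_epi.{w} d
  have h : ∀ {T : C} (s : T ⟶ X ⊗ X), s ≫ ⁅fst X X, snd X X⁆ = ⁅s ≫ fst X X, s ≫ snd X X⁆ :=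
    fun s => GrpObj.comp_commutator _ _ _
  obtain ⟨B, hB⟩ := exists_desc_of_epi.{w} (d ⊗ₘ d) ⁅fst X X, snd X X⁆ (fun T s t hst => by
    rw [h, h]
    have h₁ := congr($hst ≫ fst _ _)
    have h₂ := congr($hst ≫ snd _ _)
    simp only [Category.assoc, tensorHom_fst, tensorHom_snd] at h₁ h₂
    exact hd.commutator_eq_of_comp_eq (by simpa using h₁) (by simpa using h₂))
  have hB' : ∀ {T : C} (x y : T ⟶ X), lift (x ≫ d) (y ≫ d) ≫ B = ⁅x, y⁆ := fun x y => by
    rw [← lift_map, Category.assoc, hB, h, lift_fst, lift_snd]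
  refine ⟨B, fun {T} a b => ?_, hB'⟩
  obtain ⟨T₁, e₁, x, h₁, hx⟩ := exists_epi_lift.{w} d a
  obtain ⟨T₂, e₂, y, h₂, hy⟩ := exists_epi_lift.{w} d (e₁ ≫ b)
  rw [← cancel_epi e₁, ← cancel_epi e₂, comp_lift_assoc, comp_lift_assoc, ← hx, ← hy,
    ← Category.assoc, ← Category.assoc, hB', GrpObj.commutator_comp, GrpObj.comp_commutator,
    GrpObj.comp_commutator, ← hx, hy, Category.assoc]

lemma exists_lift₃ (hd : IsCentralExtension d) {T : C} (a b c : T ⟶ G) :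
    ∃ (T' : C) (e : T' ⟶ T) (x y z : T' ⟶ X), Epi e ∧ e ≫ a = x ≫ d ∧ e ≫ b = y ≫ d ∧
      e ≫ c = z ≫ d := by
  have := hd.epi
  obtain ⟨T₁, e₁, x, h₁, hx⟩ := exists_epi_lift.{w} d a
  obtain ⟨T₂, e₂, y, h₂, hy⟩ := exists_epi_lift.{w} d (e₁ ≫ b)
  obtain ⟨T₃, e₃, z, h₃, hz⟩ := exists_epi_lift.{w} d (e₂ ≫ e₁ ≫ c)
  exact ⟨T₃, e₃ ≫ e₂ ≫ e₁, e₃ ≫ e₂ ≫ x, e₃ ≫ y, z, epi_comp _ _, by simp [hx], by simp [hy],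
    by simp [hz]⟩

lemma commPairing (hd : IsCentralExtension d) {B : G ⊗ G ⟶ X} (hB : IsCommutatorPairing d B)
    (T : C) : CommPairing (fun z : T ⟶ X => z ≫ d) (fun a b : T ⟶ G => lift a b ≫ B) := by
  have := hd.isHom
  have hc : ∀ {T : C} (x y : T ⟶ X), ⁅x ≫ d, y ≫ d⁆ = ⁅x, y⁆ ≫ d := fun x y =>
    (GrpObj.commutator_comp d x y).symm
  refine ⟨fun a b => (Category.assoc _ _ _).trans (hB.comp a b), fun x y => hB.lift_comp x y,
    fun a b => ?_, fun a => ?_, fun a b c => ?_, fun a b c => ?_, fun z h hz => hd.central z h hz⟩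
  · obtain ⟨T', e, x, y, z, he, hx, hy, -⟩ := hd.exists_lift₃ a b b
    rw [← cancel_epi e]
    simp only [MonObj.comp_mul, MonObj.comp_one, comp_lift_assoc, hx, hy, hB.lift_comp]
    group
  · obtain ⟨T', e, x, y, z, he, hx, hy, -⟩ := hd.exists_lift₃ a a a
    have h1 : (1 : T' ⟶ G) = (1 : T' ⟶ X) ≫ d := (MonObj.one_comp d).symm
    rw [← cancel_epi e, comp_lift_assoc, MonObj.comp_one, MonObj.comp_one, hx, h1, hB.lift_comp,
      commutatorElement_one_left]
  · obtain ⟨T', e, x, y, z, he, hx, hy, hz⟩ := hd.exists_lift₃ a b c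
    rw [← cancel_epi e]
    simp only [MonObj.comp_mul, comp_lift_assoc, GrpObj.comp_commutator, hx, hy, hz, hc,
      ← MonObj.mul_comp, hB.lift_comp]
    simp only [commutatorElement_def]
    group
  · obtain ⟨T', e, x, y, z, he, hx, hy, hz⟩ := hd.exists_lift₃ a b c
    rw [← cancel_epi e]
    simp only [MonObj.comp_mul, GrpObj.comp_inv, comp_lift_assoc, GrpObj.comp_commutator, hx, hy,
      hz, hc, ← MonObj.mul_comp, ← GrpObj.inv_comp, hB.lift_comp]
    simp only [commutatorElement_def]
    group

end IsCentralExtension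

variable [BraidedCategory C]

/-- A commutator pairing on an object with generators satisfying the Steinberg relations. -/
def IsSteinbergPairing {R X G : C} [NonUnitalRingObj R] [GrpObj X] [GrpObj G]
    (x : Fin 4 → Fin 4 → (R ⟶ G)) (d : X ⟶ G) (B : G ⊗ G ⟶ X) : Prop :=
  ∀ T : C, ReducedSteinbergPairing (fun i j (p : T ⟶ R) => p ≫ x i j) (fun z : T ⟶ X => z ≫ d)
    (fun a b : T ⟶ G => lift a b ≫ B)

lemma IsWeakUnit.isSteinbergPairing [InfinitaryPretopos.{w} C] {R X G : C} [NonUnitalRingObj R]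
    [GrpObj X] [GrpObj G] {E : Subobject R} (hE : IsWeakUnit R E)
    {x : Fin 4 → Fin 4 → (R ⟶ G)} (hx : SteinbergRelations fun i j (_ : i ≠ j) => x i j)
    {d : X ⟶ G} (hd : IsCentralExtension d) {B : G ⊗ G ⟶ X} (hB : IsCommutatorPairing d B) :
    IsSteinbergPairing x d B := by
  have H : ∀ T : C, SteinbergPairing (fun i j (p : T ⟶ R) => p ≫ x i j) (fun z : T ⟶ X => z ≫ d)
      (fun a b : T ⟶ G => lift a b ≫ B) := fun T =>
    { hd.commPairing.{w} hB T with
      map_add := fun hij p q => (hx.map_add _ _ hij p q).symm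
      comm_mul := fun hij hjk hik => hx.comm_mul _ _ _ hij hjk hik
      comm_one := fun hij hkl hjk hil => hx.comm_one _ _ _ _ hij hkl hjk hil }
  refine fun T => { H T with vanish := fun {i j k l} hij hkl hjk hil h p q => ?_ }
  obtain ⟨T', e, m, t, he, -, hp⟩ := hE.exists_mul.{w} p
  rw [← cancel_epi e, comp_lift_assoc, ← Category.assoc, ← Category.assoc, hp, MonObj.comp_one]
  exact (H T').pairing_mul_eq_one hij hkl hjk hil h m t (e ≫ q)

end Pairings

section DisjointRoots

/-- The indices `i`, `j`, `k`, `l` are distinct. -/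
structure Distinct (i j k l : Fin 4) : Prop where
  ij : i ≠ j
  ik : i ≠ k
  il : i ≠ l
  jk : j ≠ k
  jl : j ≠ l
  kl : k ≠ l

lemma eq_of_distinct {α : Type*} (c : Fin 4 → Fin 4 → Fin 4 → Fin 4 → α)
    (h₁ : ∀ {i j k l}, Distinct i j k l → c i j k l = c k j i l)
    (h₂ : ∀ {i j k l}, Distinct i j k l → c i j k l = c k l i j)
    (h₃ : ∀ {i j k l}, Distinct i j k l → c i j k l = c l j k i)
    {i j k l : Fin 4} (h : Distinct i j k l) : c i j k l = c 0 1 2 3 := by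
  have s₂₃ : ∀ {i j k l}, Distinct i j k l → c i j k l = c i k j l := fun ⟨a, b, c, d, e, f⟩ => by
    rw [h₂ ⟨a, b, c, d, e, f⟩, h₃ ⟨f, b.symm, d.symm, c.symm, e.symm, a⟩,
      h₂ ⟨e, a.symm, d, c.symm, f.symm, b⟩]
  have s₁₂ : ∀ {i j k l}, Distinct i j k l → c i j k l = c j i k l := fun ⟨a, b, c, d, e, f⟩ => by
    rw [h₁ ⟨a, b, c, d, e, f⟩, s₂₃ ⟨d.symm, b.symm, f, a.symm, e, c⟩,
      h₁ ⟨b.symm, d.symm, f, a, c, e⟩]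
  have s₃₄ : ∀ {i j k l}, Distinct i j k l → c i j k l = c i j l k := fun ⟨a, b, c, d, e, f⟩ => by
    rw [h₃ ⟨a, b, c, d, e, f⟩, h₁ ⟨e.symm, f.symm, c.symm, d, a.symm, b.symm⟩,
      h₃ ⟨d.symm, f, b.symm, e, a.symm, c.symm⟩]
  have t₃ : ∀ {k l}, Distinct 0 1 k l → c 0 1 k l = c 0 1 2 3 := by
    intro k l h
    have : k = 2 ∧ l = 3 ∨ k = 3 ∧ l = 2 := by
      obtain ⟨-, a, b, c, d, e⟩ := h
      revert k l; decide
    obtain ⟨rfl, rfl⟩ | ⟨rfl, rfl⟩ := this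
    · rfl
    · exact s₃₄ h
  have t₂ : ∀ {j k l}, Distinct 0 j k l → c 0 j k l = c 0 1 2 3 := by
    intro j k l h
    have : j = 1 ∨ k = 1 ∨ l = 1 := by
      obtain ⟨a, b, c, d, e, f⟩ := h
      revert j k l; decide
    have t : ∀ {j l}, Distinct 0 j 1 l → c 0 j 1 l = c 0 1 2 3 := fun h =>
      (s₂₃ h).trans (t₃ ⟨h.ik, h.ij, h.il, h.jk.symm, h.kl, h.jl⟩)
    obtain rfl | rfl | rfl := this
    · exact t₃ h
    · exact t h
    · exact (s₃₄ h).trans (t ⟨h.ij, h.il, h.ik, h.jl, h.jk, h.kl.symm⟩)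
  have : i = 0 ∨ j = 0 ∨ k = 0 ∨ l = 0 := by
    obtain ⟨a, b, c, d, e, f⟩ := h
    revert i j k l; decide
  obtain rfl | rfl | rfl | rfl := this
  · exact t₂ h
  · exact (s₁₂ h).trans (t₂ ⟨h.ij.symm, h.jk, h.jl, h.ik, h.il, h.kl⟩)
  · exact (h₁ h).trans (t₂ ⟨h.jk.symm, h.ik.symm, h.kl, h.ij.symm, h.jl, h.il⟩)
  · exact (h₃ h).trans (t₂ ⟨h.jl.symm, h.kl.symm, h.il.symm, h.jk, h.ij.symm, h.ik.symm⟩)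

variable {C : Type u} [Category.{v} C] [CartesianMonoidalCategory C] [BraidedCategory C]
  {R X G : C} [NonUnitalRingObj R] [GrpObj X] [GrpObj G]

open NonUnitalRingObj

/-- The homomorphism `c` gives the values of the pairing on disjoint roots. -/
structure IsDisjointRootPairing (x : Fin 4 → Fin 4 → (R ⟶ G)) (B : G ⊗ G ⟶ X) (c : R ⟶ X) :
    Prop where
  map_add : IsAddToMulHom c
  mul_self : ∀ {T : C} (p : T ⟶ R), (p ≫ c) * (p ≫ c) = 1
  pairing : ∀ {i j k l : Fin 4}, Distinct i j k l → ∀ {T : C} (p q : T ⟶ R),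
    lift (p ≫ x i j) (q ≫ x k l) ≫ B = (p * q) ≫ c
  mul_comm : ∀ {T : C} (p q : T ⟶ R), (p * q) ≫ c = (q * p) ≫ c
  mul_left_comm : ∀ {T : C} (p q r : T ⟶ R), (p * (q * r)) ≫ c = (q * (p * r)) ≫ c

variable [InfinitaryPretopos.{w} C]
  {E : Subobject R} (hE : IsWeakUnit R E) {x : Fin 4 → Fin 4 → (R ⟶ G)} {d : X ⟶ G}
  {B : G ⊗ G ⟶ X} (H : IsSteinbergPairing x d B)

namespace IsSteinbergPairing
include hE H

lemma disjoint_mul_self {i j k l : Fin 4} (h : Distinct i j k l) {T : C} (p q : T ⟶ R) :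
    (lift (p ≫ x i j) (q ≫ x k l) ≫ B) * (lift (p ≫ x i j) (q ≫ x k l) ≫ B) = 1 := by
  obtain ⟨T', e, a, b, t, he, -, hq⟩ := hE.exists_mul_mul_pow.{w} q
  rw [← cancel_epi e, MonObj.comp_mul, comp_lift_assoc, ← Category.assoc, ← Category.assoc, hq,
    MonObj.comp_one, ← mul_assoc]
  exact (H T').disjoint_mul_mul_sq h.ij h.ik h.il h.jk h.jl h.kl _ _ _ _

lemma exists_disjoint {i j k l : Fin 4} (h : Distinct i j k l) :
    ∃ c : R ⟶ X, IsAddToMulHom c ∧ ∀ {T : C} (p q : T ⟶ R),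
      lift (p ≫ x i j) (q ≫ x k l) ≫ B = (p * q) ≫ c := by
  obtain ⟨c, hc, hc'⟩ := hE.exists_hom_of_balanced.{w} ((x i j ⊗ₘ x k l) ≫ B)
    (fun {T} p q r => by
      simp only [lift_map_assoc]
      exact (H T).disjoint_add_left h.ij h.kl h.jk h.il p q r)
    (fun {T} p q r => by
      simp only [lift_map_assoc]
      refine ((H T).disjoint_mul_left h.ij h.ik h.il h.jk h.jl h.kl p q r).trans ?_
      exact inv_eq_of_mul_eq_one_left (H.disjoint_mul_self hE h p (q * r)))
  simp only [lift_map_assoc] at hc'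
  exact ⟨c, hc, hc'⟩

theorem exists_isDisjointRootPairing : ∃ c : R ⟶ X, IsDisjointRootPairing x B c := by
  have h0 : ∀ i j k l : Fin 4, ∃ c : R ⟶ X, Distinct i j k l → (IsAddToMulHom c ∧
      ∀ {T : C} (p q : T ⟶ R), lift (p ≫ x i j) (q ≫ x k l) ≫ B = (p * q) ≫ c) := by
    intro i j k l
    by_cases h : Distinct i j k l
    · obtain ⟨c, hc⟩ := H.exists_disjoint hE h
      exact ⟨c, fun _ => hc⟩
    · exact ⟨1, fun h' => (h h').elim⟩
  choose c hc using h0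
  have hadd : ∀ {i j k l}, Distinct i j k l → IsAddToMulHom (c i j k l) := fun h => (hc _ _ _ _ h).1
  have hmul : ∀ {i j k l}, Distinct i j k l → ∀ {T : C} (p q : T ⟶ R),
    (p * q) ≫ c i j k l = lift (p ≫ x i j) (q ≫ x k l) ≫ B := fun {i j k l} h {T} p q =>
      ((hc _ _ _ _ h).2 p q).symm
  have hsq : ∀ {i j k l}, Distinct i j k l → ∀ {T : C} (p : T ⟶ R),
      (p ≫ c i j k l) * (p ≫ c i j k l) = 1 := fun {i j k l} h {T} p => by
    obtain ⟨T', e, m, t, he, -, hp⟩ := hE.exists_mul.{w} p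
    rw [← cancel_epi e, MonObj.comp_mul, ← Category.assoc, hp, MonObj.comp_one, hmul h]
    exact H.disjoint_mul_self hE h m t
  have hlc : ∀ {i j k l}, Distinct i j k l → ∀ {T : C} (p q r : T ⟶ R),
      (p * (q * r)) ≫ c k l i j = (q * (p * r)) ≫ c i l k j := fun {i j k l} h {T} p q r => by
    rw [hmul ⟨h.kl, h.ik.symm, h.jk.symm, h.il.symm, h.jl.symm, h.ij⟩,
      hmul ⟨h.il, h.ik, h.ij, h.kl.symm, h.jl.symm, h.jk.symm⟩]
    exact (H T).disjoint_mul_right_eq h.ij h.ik h.il h.jk h.jl h.kl p q r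
  have hcm : ∀ {i j k l}, Distinct i j k l → ∀ {T : C} (p q : T ⟶ R),
      (p * q) ≫ c i j k l = (q * p) ≫ c k l i j := fun {i j k l} h {T} p q => by
    have h' : Distinct k l i j := ⟨h.kl, h.ik.symm, h.jk.symm, h.il.symm, h.jl.symm, h.ij⟩
    have h1 := (H T).swap (p ≫ x i j) (q ≫ x k l)
    rw [← hmul h, ← hmul h'] at h1
    rw [← mul_left_inj ((q * p) ≫ c k l i j), h1, hsq h']
  have hcen : ∀ {i j k l}, Distinct i j k l → ∀ {T : C} (p : T ⟶ R) (z : T ⟶ X),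
      (p ≫ c i j k l) * z = z * (p ≫ c i j k l) := fun {i j k l} h {T} p z => by
    obtain ⟨T', e, m, t, he, -, hp⟩ := hE.exists_mul.{w} p
    rw [← cancel_epi e, MonObj.comp_mul, MonObj.comp_mul, ← Category.assoc, hp, hmul h]
    exact (H T').pairing_mul_comm ((H T').comm_one h.ij h.kl h.jk h.il m t) (e ≫ z)
  have e₁ : ∀ {i j k l}, Distinct i j k l → c i j k l = c k j i l := fun {i j k l} h =>
    hE.hom_ext.{w} fun {T} a b t ht => by
      have h' := hlc ⟨h.kl, h.ik.symm, h.jk.symm, h.il.symm, h.jl.symm, h.ij⟩ (a * b) t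
        (t * (t * t) * (t * t))
      rw [← mul_assoc t (a * b), hE.central t (a * b) ht] at h'
      simpa only [mul_assoc] using h'
  have e₂ : ∀ {i j k l}, Distinct i j k l → c i j k l = c k l i j := fun {i j k l} h =>
    hE.hom_ext.{w} fun {T} a b t ht => by
      rw [← mul_assoc, hcm h, hE.central (t * t * (t * t) * (t * t))]
      exact hE.factors_mul (hE.factors_mul (hE.factors_mul ht ht) (hE.factors_mul ht ht))
        (hE.factors_mul ht ht)
  have e₃ : ∀ {i j k l}, Distinct i j k l → c i j k l = c l j k i := fun {l k i j} h =>
    hE.hom_ext.{w} fun {T} r a t ht => by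
      have h' : Distinct j k i l := ⟨h.jl.symm, h.kl.symm, h.il.symm, h.jk, h.ij.symm, h.ik.symm⟩
      have hf : ∀ a b r : T ⟶ R, lift ((a * b) ≫ x i j) (r ≫ x j k) ≫ B =
          (lift (a ≫ x i l) ((b * r) ≫ x l k) ≫ B) * ((b * r) * (a * b)) ≫ c l k i j := by
        intro a b r
        rw [hmul h]
        exact (H T).adjacent_mul_left h.kl h.jk.symm h.ik.symm h.jl.symm h.il.symm h.ij.symm a b r
      have hf' : ∀ a b r : T ⟶ R, lift ((a * b) ≫ x i l) (r ≫ x l k) ≫ B =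
          (lift (a ≫ x i j) ((b * r) ≫ x j k) ≫ B) * ((b * r) * (a * b)) ≫ c j k i l := by
        intro a b r
        rw [hmul h']
        exact (H T).adjacent_mul_left h.ik.symm h.jk.symm h.kl h.ij h.il h.jl a b r
      have hff : ∀ a b b' r : T ⟶ R, lift ((a * b * b') ≫ x i j) (r ≫ x j k) ≫ B =
          (lift (a ≫ x i j) ((b * (b' * r)) ≫ x j k) ≫ B) *
            (((b * (b' * r)) * (a * b)) ≫ c j k i l * ((b' * r) * (a * b * b')) ≫ c l k i j) := by
        intro a b b' r
        rw [hf, hf', mul_assoc]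
      have h₁ := hff a (t * t) (t * t) r
      have h₂ := hff (a * (t * t)) t t r
      rw [← mul_assoc a t t, hff a t t] at h₂
      have hr : t * r = r * t := hE.central t r ht
      have ha : t * a = a * t := hE.central t a ht
      have hr' : ∀ w, w * t * r = w * r * t := fun w => by rw [mul_assoc, hr, ← mul_assoc]
      have ha' : ∀ w, w * t * a = w * a * t := fun w => by rw [mul_assoc, ha, ← mul_assoc]
      simp only [← mul_assoc r, ← mul_assoc a, ← mul_assoc t, ← mul_assoc (_ * _ : T ⟶ R), hr, hr', ha']
        at h₁ h₂ ⊢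
      have hs : ∀ p : T ⟶ R, (p ≫ c j k i l * p ≫ c l k i j) * (p ≫ c j k i l * p ≫ c l k i j) = 1 :=
        fun p => by
          rw [mul_assoc, ← mul_assoc (p ≫ c l k i j), hcen h p (p ≫ c j k i l),
            mul_assoc (p ≫ c j k i l), hsq h, mul_one, hsq h']
      rw [h₁, mul_assoc (lift _ _ ≫ B), hs, mul_one] at h₂
      exact (eq_inv_of_mul_eq_one_right (mul_eq_left.1 h₂)).trans
        (inv_eq_of_mul_eq_one_right (hsq h' _))
  exact ⟨c 0 1 2 3, hadd ⟨by decide, by decide, by decide, by decide, by decide, by decide⟩,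
    hsq ⟨by decide, by decide, by decide, by decide, by decide, by decide⟩, fun h => by
      rw [← eq_of_distinct c e₁ e₂ e₃ h]
      exact (hc _ _ _ _ h).2, fun p q => by
      rw [hcm ⟨by decide, by decide, by decide, by decide, by decide, by decide⟩, ←
        e₂ ⟨by decide, by decide, by decide, by decide, by decide, by decide⟩], fun p q r => by
      have h : Distinct 2 3 0 1 := ⟨by decide, by decide, by decide, by decide, by decide, by decide⟩
      rw [hlc h, ← e₁ ⟨by decide, by decide, by decide, by decide, by decide, by decide⟩]⟩

end IsSteinbergPairing

end DisjointRoots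

section AdjacentRoots

/-- A trace-like additive function is defined on a commutative quotient of a ring. -/
lemma exists_commRing_hom {A : Type v} {M : Type*} [NonUnitalRing A] [Group M] (τ : A → M)
    (hadd : ∀ p q, τ (p + q) = τ p * τ q) (hcomm : ∀ p q, τ (p * q) = τ (q * p))
    (hlc : ∀ p q r, τ (p * (q * r)) = τ (q * (p * r))) :
    ∃ (U : Type v) (_ : CommRing U) (φ : A →ₙ+* U), ∀ p q,
      φ p = φ q ↔ τ p = τ q ∧ ∀ r, τ (r * p) = τ (r * q) := by
  let c : RingCon A :=
    { r := fun p q => τ p = τ q ∧ ∀ r, τ (r * p) = τ (r * q)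
      iseqv := ⟨fun p => ⟨rfl, fun _ => rfl⟩, fun h => ⟨h.1.symm, fun r => (h.2 r).symm⟩,
        fun h h' => ⟨h.1.trans h'.1, fun r => (h.2 r).trans (h'.2 r)⟩⟩
      add' := fun {p q s t} h h' => ⟨by rw [hadd, hadd, h.1, h'.1], fun r => by
        rw [mul_add, mul_add, hadd, hadd, h.2, h'.2]⟩
      mul' := fun {p q s t} h h' => ⟨by rw [h'.2, hcomm, h.2, hcomm], fun r => by
        rw [← mul_assoc, h'.2, mul_assoc, hlc, hcomm, h.2, hcomm, hlc]⟩ }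
  let _ : NonUnitalCommRing c.Quotient :=
    { (inferInstance : NonUnitalRing c.Quotient) with
      mul_comm := by
        rintro ⟨p⟩ ⟨q⟩
        refine (RingCon.eq c).2 ⟨hcomm p q, fun r => ?_⟩
        rw [← mul_assoc, hcomm, hlc] }
  refine ⟨Unitization ℤ c.Quotient, inferInstance,
    { toFun := fun p => ((p : c.Quotient) : Unitization ℤ c.Quotient)
      map_mul' := fun p q => by rw [RingCon.coe_mul, Unitization.inr_mul]
      map_zero' := by rw [RingCon.coe_zero, Unitization.inr_zero]
      map_add' := fun p q => by rw [RingCon.coe_add, Unitization.inr_add] }, fun p q => ?_⟩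
  exact Unitization.inr_injective.eq_iff.trans (RingCon.eq c)

variable {C : Type u} [Category.{v} C] [CartesianMonoidalCategory C] [BraidedCategory C]
  {R X G : C} [NonUnitalRingObj R] [GrpObj X] [GrpObj G] {x : Fin 4 → Fin 4 → (R ⟶ G)} {d : X ⟶ G}
  {B : G ⊗ G ⟶ X} {c : R ⟶ X}

open NonUnitalRingObj

namespace IsAddToMulHom

lemma map_zero (hc : IsAddToMulHom c) {T : C} : (0 : T ⟶ R) ≫ c = 1 := by
  have h := hc (0 : T ⟶ R) 0
  rw [add_zero] at h
  exact left_eq_mul.1 h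

lemma map_neg (hc : IsAddToMulHom c) {T : C} (p : T ⟶ R) : (-p) ≫ c = (p ≫ c)⁻¹ :=
  eq_inv_of_mul_eq_one_left (by rw [← hc, neg_add_cancel, hc.map_zero])

end IsAddToMulHom

omit [GrpObj G] in
lemma IsDisjointRootPairing.exists_commRing_hom (hc : IsDisjointRootPairing x B c) (T : C) :
    ∃ (U : Type v) (_ : CommRing U) (φ : (T ⟶ R) →ₙ+* U), (∀ p, 2 * φ p = 0) ∧
      (∀ p q, φ p = φ q → p ≫ c = q ≫ c) ∧
      ∀ p, p ≫ c = 1 → (∀ r : T ⟶ R, (r * p) ≫ c = 1) → φ p = 0 := by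
  obtain ⟨U, hU, φ, hφ⟩ := _root_.exists_commRing_hom (fun p : T ⟶ R => p ≫ c) hc.map_add
    hc.mul_comm hc.mul_left_comm
  have h0 : ∀ p, p ≫ c = 1 → (∀ r : T ⟶ R, (r * p) ≫ c = 1) → φ p = 0 := fun p h h' => by
    rw [← _root_.map_zero φ, hφ]
    refine ⟨h.trans (IsAddToMulHom.map_zero hc.map_add).symm, fun r => (h' r).trans ?_⟩
    rw [mul_zero]
    exact (IsAddToMulHom.map_zero hc.map_add).symm
  refine ⟨U, hU, φ, fun p => ?_, fun p q h => ((hφ p q).1 h).1, h0⟩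
  rw [two_mul, ← _root_.map_add]
  refine h0 _ ?_ fun r => ?_
  · rw [hc.map_add, hc.mul_self]
  · rw [mul_add, hc.map_add, hc.mul_self]

lemma IsDisjointRootPairing.adjacent_mul_left (hc : IsDisjointRootPairing x B c)
    (H : IsSteinbergPairing x d B) {i j k l : Fin 4} (h : Distinct i j k l) {T : C} (a b r : T ⟶ R) :
    lift ((a * b) ≫ x i j) (r ≫ x j k) ≫ B =
      (lift (a ≫ x i l) ((b * r) ≫ x l k) ≫ B) * ((b * r) * (a * b)) ≫ c := by
  rw [← hc.pairing ⟨h.kl.symm, h.il.symm, h.jl.symm, h.ik.symm, h.jk.symm, h.ij⟩]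
  exact (H T).adjacent_mul_left h.ij h.ik h.il h.jk h.jl h.kl a b r

lemma IsDisjointRootPairing.adjacent_mul_right (hc : IsDisjointRootPairing x B c)
    (H : IsSteinbergPairing x d B) {i j k l : Fin 4} (h : Distinct i j k l) {T : C} (a b e r : T ⟶ R) :
    lift (a ≫ x i j) ((b * e * r) ≫ x j k) ≫ B =
      (lift (a ≫ x i l) ((b * e * r) ≫ x l k) ≫ B) *
        ((b * e * r) * (a * (b * e)) + ((b * e * r) * (a * b) + (e * r) * (a * (b * e)))) ≫ c := by
  have h' : Distinct i l k j := ⟨h.il, h.ik, h.ij, h.kl.symm, h.jl.symm, h.jk.symm⟩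
  have h₁ := hc.adjacent_mul_left H h a (b * e) r
  have h₂ := hc.adjacent_mul_left H h (a * b) e r
  rw [hc.adjacent_mul_left H h', ← mul_assoc b e r, mul_assoc a b e, h₁, mul_assoc (_ ≫ B),
    ← hc.map_add] at h₂
  have h₃ : ∀ {u v : T ⟶ X} {p q : T ⟶ R}, u * p ≫ c = v * q ≫ c → v = u * (p + q) ≫ c :=
    fun {u v p q} h => by rw [hc.map_add, ← mul_assoc, h, mul_assoc, hc.mul_self, mul_one]
  exact h₃ h₂

variable [InfinitaryPretopos.{w} C] {E : Subobject R} (hE : IsWeakUnit R E)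
  (H : IsSteinbergPairing x d B) (hc : IsDisjointRootPairing x B c)

namespace IsDisjointRootPairing
include hE H hc

lemma central {T : C} (p : T ⟶ R) (z : T ⟶ X) : (p ≫ c) * z = z * (p ≫ c) := by
  have h : Distinct 0 1 2 3 := ⟨by decide, by decide, by decide, by decide, by decide, by decide⟩
  obtain ⟨T', e, m, t, he, -, hp⟩ := hE.exists_mul.{w} p
  rw [← cancel_epi e, MonObj.comp_mul, MonObj.comp_mul, ← Category.assoc, hp, ← hc.pairing h]
  exact (H T').pairing_mul_comm ((H T').comm_one h.ij h.kl h.jk h.il m t) (e ≫ z)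

end IsDisjointRootPairing

end AdjacentRoots

section Factorization

variable {C : Type u} [Category.{v} C] [CartesianMonoidalCategory C] [BraidedCategory C]
  {R X G : C} [NonUnitalRingObj R] [GrpObj X] [GrpObj G] {x : Fin 4 → Fin 4 → (R ⟶ G)} {d : X ⟶ G}
  {B : G ⊗ G ⟶ X} {c : R ⟶ X}

open NonUnitalRingObj

namespace IsDisjointRootPairing

variable (hc : IsDisjointRootPairing x B c)
include hc

omit [GrpObj G] in
lemma mul_eq_one_of_eq {T : C} {z : T ⟶ X} {p q : T ⟶ R} (h : z * p ≫ c = z * q ≫ c) :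
    (p + q) ≫ c = 1 := by
  rw [hc.map_add, mul_left_cancel h, hc.mul_self]

lemma kills_mul_mul (H : IsSteinbergPairing x d B) {T : C} (a r b e g : T ⟶ R) :
    (a * r * ((e * e - e) * (b * b * g - b * (g * g)))) ≫ c = 1 := by
  have h : Distinct 0 1 2 3 := ⟨by decide, by decide, by decide, by decide, by decide, by decide⟩
  have h₁ := hc.adjacent_mul_right H h a (b * e) g r
  have h₂ := hc.adjacent_mul_right H h a b (e * g) r
  rw [← mul_assoc b e g, h₁] at h₂
  obtain ⟨U, _, φ, hφ, hφ', -⟩ := hc.exists_commRing_hom T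
  rw [← hc.mul_eq_one_of_eq h₂]
  apply hφ'
  simp only [map_mul, _root_.map_add, map_sub]
  have h3 := hφ (a * r * (b * e * g))
  simp only [map_mul] at h3
  linear_combination (- φ b * φ e * φ g - φ g * φ e - φ b) * h3

lemma kills_mul_mul_sq (H : IsSteinbergPairing x d B) {T : C} (a r b s e g : T ⟶ R) :
    (a * r * (b * (s * s)) * ((e * e - e) * (g * g - g))) ≫ c = 1 := by
  have h₁ := hc.kills_mul_mul H a r b e (s * g)
  have h₂ := hc.kills_mul_mul H a (r * g) b e s
  obtain ⟨U, _, φ, hφ, hφ', -⟩ := hc.exists_commRing_hom T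
  refine Eq.trans ?_ ((hc.map_add _ _).trans ((congrArg₂ (· * ·) h₁ h₂).trans (mul_one 1)))
  apply hφ'
  simp only [map_mul, _root_.map_add, map_sub]
  have h3 := hφ (a * r * b)
  simp only [map_mul] at h3
  linear_combination (φ s * φ g * (φ e ^ 2 - φ e) * (φ s * φ g - φ b)) * h3

end IsDisjointRootPairing

variable [InfinitaryPretopos.{w} C] {E : Subobject R} (hE : IsWeakUnit R E)
  (H : IsSteinbergPairing x d B) (hc : IsDisjointRootPairing x B c)

namespace IsDisjointRootPairing
include hE H hc

lemma kills_mul {T : C} (r e g : T ⟶ R) : (r * ((e * e - e) * (g * g - g))) ≫ c = 1 := by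
  obtain ⟨T', e', a, b, t, he, ht, hp⟩ := hE.exists_mul_mul_pow.{w} r
  rw [← cancel_epi e', ← Category.assoc, MonObj.comp_one, comp_mul, hp,
    ← hc.kills_mul_mul_sq H a b (t * t * (t * t)) t (e' ≫ e) (e' ≫ g)]
  simp only [comp_mul, comp_sub, mul_assoc]

lemma kills {T : C} (e g : T ⟶ R) : ((e * e - e) * (g * g - g)) ≫ c = 1 := by
  obtain ⟨T', e', u, v, he, -, hp⟩ := hE.exists_mul.{w} e
  rw [← cancel_epi e', ← Category.assoc, MonObj.comp_one]
  have h₁ := hc.kills_mul.{w} hE H (u * u) v (e' ≫ g)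
  have h₂ := hc.kills_mul.{w} hE H v u (e' ≫ g)
  obtain ⟨U, _, φ, hφ, hφ', -⟩ := hc.exists_commRing_hom T'
  refine Eq.trans ?_ ((hc.map_add _ _).trans ((congrArg₂ (· * ·) h₁ h₂).trans (mul_one 1)))
  simp only [comp_mul, comp_sub, hp]
  apply hφ'
  simp only [map_mul, _root_.map_add, map_sub]
  ring1

lemma exists_commRing_hom_kills (T : C) :
    ∃ (U : Type v) (_ : CommRing U) (φ : (T ⟶ R) →ₙ+* U), (∀ p, 2 * φ p = 0) ∧
      (∀ p q, φ p = φ q → p ≫ c = q ≫ c) ∧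
      ∀ p q, (φ p * φ p - φ p) * (φ q * φ q - φ q) = 0 := by
  obtain ⟨U, hU, φ, hφ, hφ', h⟩ := hc.exists_commRing_hom T
  refine ⟨U, hU, φ, hφ, hφ', fun p q => ?_⟩
  have := h _ (hc.kills.{w} hE H p q) fun r => hc.kills_mul.{w} hE H r p q
  simpa only [map_mul, map_sub] using this

lemma adjacent_eq_mul {i j k l : Fin 4} (h : Distinct i j k l) {T : C} (a r : T ⟶ R) :
    lift (a ≫ x i j) (r ≫ x j k) ≫ B = (lift (a ≫ x i l) (r ≫ x l k) ≫ B) * (a * r) ≫ c := by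
  obtain ⟨T', e', p, q, t, he, ht, hp⟩ := hE.exists_mul_mul_pow.{w} r
  rw [← cancel_epi e', MonObj.comp_mul, comp_lift_assoc, comp_lift_assoc, ← Category.assoc e',
    ← Category.assoc e', ← Category.assoc e', ← Category.assoc e', ← Category.assoc e', comp_mul,
    hp, ← mul_assoc, hc.adjacent_mul_right H h]
  congr 1
  obtain ⟨U, _, φ, hφ, hφ', h⟩ := hc.exists_commRing_hom_kills.{w} hE H T'
  apply hφ'
  have h3 := hφ (e' ≫ a)
  have h4 := h p q
  simp only [map_mul, _root_.map_add] at h3 h4 ⊢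
  linear_combination (φ (e' ≫ a) * (φ t) ^ 6) * h4 + (φ p * φ q * φ t ^ 6 * (φ p + φ q - 1)) * h3

/-- The values of the pairing on adjacent roots with middle index `j` give a homomorphism. -/
lemma exists_adjacent {i j k l : Fin 4} (h : Distinct i j k l) :
    ∃ y : R ⟶ X, IsAddToMulHom y ∧ ∀ {T : C} (p q : T ⟶ R),
      (lift (p ≫ x i j) (q ≫ x j k) ≫ B) * (p * (q * q - q)) ≫ c = (p * q) ≫ y := by
  let f : R ⊗ R ⟶ X := (lift (fst R R ≫ x i j) (snd R R ≫ x j k) ≫ B) *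
    (fst R R * (snd R R * snd R R - snd R R)) ≫ c
  have hf : ∀ {T : C} (p q : T ⟶ R), lift p q ≫ f =
      (lift (p ≫ x i j) (q ≫ x j k) ≫ B) * (p * (q * q - q)) ≫ c := fun p q => by
    rw [MonObj.comp_mul, comp_lift_assoc, lift_fst_assoc, lift_snd_assoc,
      ← Category.assoc (lift p q), comp_mul, comp_sub, comp_mul, lift_fst, lift_snd]
  obtain ⟨y, hy, hy'⟩ := hE.exists_hom_of_balanced.{w} f
    (fun {T} p q r => by
      rw [hf, hf, hf]
      refine (congrArg (· * _) ((H T).adjacent_add_left h.ij h.jk h.ik p q r)).trans ?_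
      rw [add_mul, hc.map_add, mul_assoc, mul_assoc, ← mul_assoc _ ((p * (r * r - r)) ≫ c),
        ← hc.central.{w} hE H (p * (r * r - r)), mul_assoc])
    (fun {T} p q r => by
      rw [hf, hf, hc.adjacent_mul_left H h,
        hc.adjacent_eq_mul hE H ⟨h.il, h.ik, h.ij, h.kl.symm, h.jl.symm, h.jk.symm⟩, mul_assoc,
        mul_assoc, ← hc.map_add, ← hc.map_add]
      congr 1
      obtain ⟨U, _, φ, hφ, hφ', h⟩ := hc.exists_commRing_hom_kills.{w} hE H T
      apply hφ'
      have h3 := hφ p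
      have h4 := h q r
      simp only [map_mul, _root_.map_add, map_sub] at h3 h4 ⊢
      linear_combination (-φ p) * h4 + (φ q * φ r) * h3)
  exact ⟨y, hy, fun p q => by rw [← hf, hy']⟩

end IsDisjointRootPairing

end Factorization

section ExtendedRelations

variable {C : Type u} [Category.{v} C] [CartesianMonoidalCategory C] [BraidedCategory C]
  {R X G : C} [NonUnitalRingObj R] [GrpObj X] [GrpObj G]

open NonUnitalRingObj

/-- The relations between the lifts `y i j k` of the generators `x i k` to a central extension.
Here `j` is an auxiliary index. -/
structure ExtendedSteinbergRelations (y : Fin 4 → Fin 4 → Fin 4 → (R ⟶ X)) (c : R ⟶ X) :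
    Prop where
  map_add : ∀ i j k, IsAddToMulHom (y i j k)
  map_add_center : IsAddToMulHom c
  trivial : ∀ {i j k : Fin 4}, ¬(i ≠ j ∧ j ≠ k ∧ i ≠ k) → ∀ {T : C} (p : T ⟶ R), p ≫ y i j k = 1
  central : ∀ (i j k : Fin 4) {T : C} (p q : T ⟶ R),
    (p ≫ c) * (q ≫ y i j k) = (q ≫ y i j k) * (p ≫ c)
  central_self : ∀ {T : C} (p q : T ⟶ R), (p ≫ c) * (q ≫ c) = (q ≫ c) * (p ≫ c)
  change : ∀ {i j k l : Fin 4}, Distinct i j k l → ∀ {T : C} (p : T ⟶ R),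
    p ≫ y i j k = (p ≫ y i l k) * (p ≫ c)
  comm_mul : ∀ {i j k : Fin 4} (m n : Fin 4), i ≠ j → j ≠ k → i ≠ k → i ≠ m → m ≠ j → j ≠ n →
    n ≠ k → ∀ {T : C} (p q : T ⟶ R),
      ⁅p ≫ y i m j, q ≫ y j n k⁆ = ((p * q) ≫ y i j k) * (p * (q * q - q)) ≫ c
  comm_disjoint : ∀ {i j k l : Fin 4} (m n : Fin 4), Distinct i j k l → i ≠ m → m ≠ j → k ≠ n →
    n ≠ l → ∀ {T : C} (p q : T ⟶ R), ⁅p ≫ y i m j, q ≫ y k n l⁆ = (p * q) ≫ c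
  comm_one : ∀ {i j k l : Fin 4} (m n : Fin 4), i ≠ j → k ≠ l → j ≠ k → i ≠ l → (i = k ∨ j = l) →
    i ≠ m → m ≠ j → k ≠ n → n ≠ l → ∀ {T : C} (p q : T ⟶ R), ⁅p ≫ y i m j, q ≫ y k n l⁆ = 1

variable {x : Fin 4 → Fin 4 → (R ⟶ G)} {d : X ⟶ G} {B : G ⊗ G ⟶ X} {c : R ⟶ X}
  [InfinitaryPretopos.{w} C] {E : Subobject R} (hE : IsWeakUnit R E)
  (H : IsSteinbergPairing x d B) (hc : IsDisjointRootPairing x B c)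

namespace IsDisjointRootPairing
include hE H hc

lemma comp_eq_one {T : C} (p : T ⟶ R) : (p ≫ c) ≫ d = 1 := by
  have h : Distinct 0 1 2 3 := ⟨by decide, by decide, by decide, by decide, by decide, by decide⟩
  obtain ⟨T', e, m, t, he, -, hp⟩ := hE.exists_mul.{w} p
  rw [← cancel_epi e, ← Category.assoc, ← Category.assoc, hp, ← hc.pairing h, MonObj.comp_one]
  exact ((H T').map _ _).trans ((H T').comm_one h.ij h.kl h.jk h.il m t)

theorem exists_extendedSteinbergRelations [IsMonHom d] : ∃ y : Fin 4 → Fin 4 → Fin 4 → (R ⟶ X),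
    ExtendedSteinbergRelations y c ∧
      ∀ {i j k : Fin 4}, i ≠ j → j ≠ k → i ≠ k → y i j k ≫ d = x i k := by
  have h0 : ∀ i j k : Fin 4, ∃ y : R ⟶ X, IsAddToMulHom y ∧
      (¬(i ≠ j ∧ j ≠ k ∧ i ≠ k) → y = 1) ∧ ((i ≠ j ∧ j ≠ k ∧ i ≠ k) → ∀ {T : C} (p q : T ⟶ R),
        (p * q) ≫ y = (lift (p ≫ x i j) (q ≫ x j k) ≫ B) * (p * (q * q - q)) ≫ c) := by
    intro i j k
    by_cases h : i ≠ j ∧ j ≠ k ∧ i ≠ k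
    · obtain ⟨l, hl⟩ : ∃ l, Distinct i j k l := by
        obtain ⟨l, hi, hj, hk⟩ : ∃ l : Fin 4, i ≠ l ∧ j ≠ l ∧ k ≠ l := by
          revert i j k; decide
        exact ⟨l, h.1, h.2.2, hi, h.2.1, hj, hk⟩
      obtain ⟨y, hy, hy'⟩ := hc.exists_adjacent.{w} hE H hl
      exact ⟨y, hy, fun h' => (h' h).elim, fun _ {T} p q => (hy' p q).symm⟩
    · refine ⟨1, fun p q => ?_, fun _ => rfl, fun h' => (h h').elim⟩
      rw [MonObj.comp_one, MonObj.comp_one, MonObj.comp_one, mul_one]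
  choose y hy hy₁ hy₂ using h0
  have hyd : ∀ {i j k : Fin 4}, i ≠ j → j ≠ k → i ≠ k → y i j k ≫ d = x i k := by
    intro i j k hij hjk hik
    refine hE.hom_ext_mul.{w} fun {T} p q => ?_
    rw [← Category.assoc, hy₂ i j k ⟨hij, hjk, hik⟩, MonObj.mul_comp, hc.comp_eq_one.{w} hE H,
      mul_one]
    exact ((H T).map _ _).trans ((H T).comm_mul hij hjk hik p q)
  have hcomm : ∀ {i j k l : Fin 4} (m n : Fin 4), i ≠ j → k ≠ l → i ≠ m → m ≠ j → k ≠ n → n ≠ l →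
      ∀ {T : C} (p q : T ⟶ R),
        ⁅p ≫ y i m j, q ≫ y k n l⁆ = lift (p ≫ x i j) (q ≫ x k l) ≫ B := by
    intro i j k l m n hij hkl him hmj hkn hnl T p q
    have h := (H T).comm (p ≫ y i m j) (q ≫ y k n l)
    rw [← h, Category.assoc, Category.assoc, hyd him hmj hij, hyd hkn hnl hkl]
  refine ⟨y, ⟨hy, hc.map_add, fun {i j k} h {T} p => ?_, fun i j k {T} p q => hc.central.{w} hE H _ _,
    fun {T} p q => hc.central.{w} hE H _ _, fun {i j k l} h {T} p => ?_, ?_, ?_, ?_⟩, hyd⟩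
  · rw [hy₁ _ _ _ h, MonObj.comp_one]
  · rw [← MonObj.comp_mul]
    congr 1
    refine hE.hom_ext_mul.{w} fun {T} p q => ?_
    rw [MonObj.comp_mul, hy₂ i j k ⟨h.ij, h.jk, h.ik⟩, hy₂ i l k ⟨h.il, h.kl.symm, h.ik⟩,
      hc.adjacent_eq_mul.{w} hE H h, mul_assoc, mul_assoc, hc.central.{w} hE H (p * q)]
  · intro i j k m n hij hjk hik him hmj hjn hnk T p q
    rw [hcomm m n hij hjk him hmj hjn hnk, hy₂ i j k ⟨hij, hjk, hik⟩, mul_assoc, hc.mul_self,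
      mul_one]
  · intro i j k l m n h him hmj hkn hnl T p q
    rw [hcomm m n h.ij h.kl him hmj hkn hnl, hc.pairing h]
  · intro i j k l m n hij hkl hjk hil h him hmj hkn hnl T p q
    rw [hcomm m n hij hkl him hmj hkn hnl]
    exact (H T).vanish hij hkl hjk hil h p q

end IsDisjointRootPairing

/-- Generators of the image of `R` are commutators. -/
lemma ExtendedSteinbergRelations.hom_eq
    {y y' : Fin 4 → Fin 4 → Fin 4 → (R ⟶ X)} {c c' : R ⟶ X}
    (hE : IsWeakUnit R E) (hy : ExtendedSteinbergRelations y c)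
    (hy' : ExtendedSteinbergRelations y' c')
    (h : ∀ {i j k l : Fin 4} (m n : Fin 4), i ≠ j → k ≠ l → i ≠ m → m ≠ j → k ≠ n → n ≠ l →
      ∀ {T : C} (p q : T ⟶ R), ⁅p ≫ y i m j, q ≫ y k n l⁆ = ⁅p ≫ y' i m j, q ≫ y' k n l⁆) :
    y = y' ∧ c = c' := by
  have hc : c = c' := hE.hom_ext_mul.{w} fun {T} p q => by
    have h' : Distinct 0 1 2 3 :=
      ⟨by decide, by decide, by decide, by decide, by decide, by decide⟩
    rw [← hy.comm_disjoint 2 1 h' (by decide) (by decide) (by decide) (by decide),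
      ← hy'.comm_disjoint 2 1 h' (by decide) (by decide) (by decide) (by decide)]
    exact h _ _ (by decide) (by decide) (by decide) (by decide) (by decide) (by decide) _ _
  subst hc
  refine ⟨?_, rfl⟩
  ext i j k
  by_cases hijk : i ≠ j ∧ j ≠ k ∧ i ≠ k
  · obtain ⟨hij, hjk, hik⟩ := hijk
    refine hE.hom_ext_mul.{w} fun {T} p q => ?_
    have h₁ := hy.comm_mul k i hij hjk hik hik hjk.symm hij.symm hik p q
    have h₂ := hy'.comm_mul k i hij hjk hik hik hjk.symm hij.symm hik p q
    rw [h k i hij hjk hik hjk.symm hij.symm hik, h₂] at h₁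
    exact (mul_right_cancel h₁).symm
  · rw [← Category.id_comp (y i j k), ← Category.id_comp (y' i j k), hy.trivial hijk,
      hy'.trivial hijk]

end ExtendedRelations

section Presentations

variable {C : Type u} [Category.{v} C] [CartesianMonoidalCategory C] {R : C}

/-- Elements of `G` are locally products of generators. -/
def IsGeneratedBy {I : Type} {G : C} [GrpObj G] (x : I → (R ⟶ G)) : Prop :=
  ∀ ⦃T : C⦄ (g : T ⟶ G), Locally.{w} T fun _ e => ∃ a, Word.eval x a = e ≫ g

lemma IsGeneratedBy.hom_ext [InfinitaryPretopos.{w} C] {I : Type} {G H : C} [GrpObj G] [GrpObj H]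
    {x : I → (R ⟶ G)} (hx : IsGeneratedBy.{w} x) {f g : G ⟶ H} [IsMonHom f] [IsMonHom g]
    (h : ∀ i, x i ≫ f = x i ≫ g) : f = g := by
  refine Locally.eq.{w} ((hx (𝟙 G)).mono ?_)
  rintro T e ⟨a, ha⟩
  rw [Category.comp_id] at ha
  rw [← ha, Word.eval_comp, Word.eval_comp]
  simp only [h]

lemma IsGeneratedBy.epi [InfinitaryPretopos.{w} C] {I : Type} {G H : C} [GrpObj G] [GrpObj H]
    {x : I → (R ⟶ G)} (hx : IsGeneratedBy.{w} x) (f : H ⟶ G) [IsMonHom f] (y : I → (R ⟶ H))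
    (h : ∀ i, y i ≫ f = x i) : Epi f := by
  refine epi_of_locally_lift.{w} f ((hx (𝟙 G)).mono ?_)
  rintro T e ⟨a, ha⟩
  rw [Category.comp_id] at ha
  exact ⟨Word.eval y a, by rw [Word.eval_comp, ← ha]; simp only [h]⟩

variable [BraidedCategory C] [NonUnitalRingObj R]

open NonUnitalRingObj

/-- Group objects given by additive generators and relations exist. -/
theorem exists_presented_grpObj_of_additive [InfinitaryPretopos.{w} C] {I K : Type}
    (l r : K → ∀ ⦃T : C⦄, (T ⟶ R) → (T ⟶ R) → Word I R T)
    (hl : ∀ k ⦃T T' : C⦄ (f : T' ⟶ T) (p q : T ⟶ R),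
      Word.res f (l k p q) = l k (f ≫ p) (f ≫ q))
    (hr : ∀ k ⦃T T' : C⦄ (f : T' ⟶ T) (p q : T ⟶ R),
      Word.res f (r k p q) = r k (f ≫ p) (f ≫ q)) :
    ∃ (G : C) (_ : GrpObj G) (x : I → (R ⟶ G)), (∀ i, IsAddToMulHom (x i)) ∧
      SatisfiesRelations l r x ∧ IsGeneratedBy.{w} x ∧
      ∀ (H : C) [GrpObj H] (y : I → (R ⟶ H)), (∀ i, IsAddToMulHom (y i)) →
        SatisfiesRelations l r y → ∃! f : G ⟶ H, IsMonHom f ∧ ∀ i, x i ≫ f = y i := by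
  let l' : K ⊕ I ⊕ I ⊕ I → ∀ ⦃T : C⦄, (T ⟶ R) → (T ⟶ R) → Word I R T := fun k T p q =>
    match k with
    | .inl k => l k p q
    | .inr (.inl i) => FreeMonoid.of (i, p) * FreeMonoid.of (i, q)
    | .inr (.inr (.inl i)) => FreeMonoid.of (i, p) * FreeMonoid.of (i, p ≫ (-𝟙 R))
    | .inr (.inr (.inr i)) => FreeMonoid.of (i, p ≫ (-𝟙 R)) * FreeMonoid.of (i, p)
  let r' : K ⊕ I ⊕ I ⊕ I → ∀ ⦃T : C⦄, (T ⟶ R) → (T ⟶ R) → Word I R T := fun k T p q =>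
    match k with
    | .inl k => r k p q
    | .inr (.inl i) => FreeMonoid.of (i, p + q)
    | .inr (.inr _) => 1
  have h : ∀ {H : C} [GrpObj H] (y : I → (R ⟶ H)), SatisfiesRelations l' r' y ↔
      (∀ i, IsAddToMulHom (y i)) ∧ SatisfiesRelations l r y := by
    intro H _ y
    refine ⟨fun h => ⟨fun i T p q => ?_, fun k T p q => h (.inl k) p q⟩, fun ⟨h, h'⟩ k T p q => ?_⟩
    · have := h (.inr (.inl i)) p q
      simp only [l', r', map_mul, Word.eval_of] at this
      exact this.symm
    · obtain k | i | i | i := k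
      · exact h' k p q
      · simp only [l', r', map_mul, Word.eval_of]
        exact (h i p q).symm
      · simp only [l', r', map_mul, Word.eval_of, comp_neg, Category.comp_id, map_one]
        rw [← h, add_neg_cancel, IsAddToMulHom.map_zero (h i)]
      · simp only [l', r', map_mul, Word.eval_of, comp_neg, Category.comp_id, map_one]
        rw [← h, neg_add_cancel, IsAddToMulHom.map_zero (h i)]
  obtain ⟨G, hG, x, hx, hg, hu⟩ := exists_presented_grpObj.{w} l' r'
    (by
      rintro (k | i | i | i) T T' f p q
      · exact hl k f p q
      all_goals simp [l'])
    (by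
      rintro (k | i | i | i) T T' f p q
      · exact hr k f p q
      · simp [r', comp_add]
      all_goals simp [r'])
    (-𝟙 R) (fun i => ⟨.inr (.inr (.inl i)), fun T p q => ⟨rfl, rfl⟩⟩)
    (fun i => ⟨.inr (.inr (.inr i)), fun T p q => ⟨rfl, rfl⟩⟩)
  rw [h] at hx
  exact ⟨G, hG, x, hx.1, hx.2, hg, fun H _ y hy hy' => hu H y ((h y).2 ⟨hy, hy'⟩)⟩

/-- The relations between the generators of the Steinberg group. -/
inductive SteinbergRel (n : ℕ)
  | comm_mul (i j k : Fin n) (hij : i ≠ j) (hjk : j ≠ k) (hik : i ≠ k)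
  | comm_one (i j k l : Fin n) (hij : i ≠ j) (hkl : k ≠ l) (hjk : j ≠ k) (hil : i ≠ l)

namespace SteinbergRel

/-- The generators of the Steinberg group. -/
abbrev Gen (n : ℕ) := {a : Fin n × Fin n // a.1 ≠ a.2}

/-- The left hand sides of the relations. -/
def lhs {n : ℕ} {T : C} (p q : T ⟶ R) : SteinbergRel n → Word (Gen n) R T
  | comm_mul i j k hij hjk _ => .of (⟨(i, j), hij⟩, p) * .of (⟨(j, k), hjk⟩, q)
  | comm_one i j k l hij hkl _ _ => .of (⟨(i, j), hij⟩, p) * .of (⟨(k, l), hkl⟩, q)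

/-- The right hand sides of the relations. -/
def rhs {n : ℕ} {T : C} (p q : T ⟶ R) : SteinbergRel n → Word (Gen n) R T
  | comm_mul i j k hij hjk hik =>
    .of (⟨(i, k), hik⟩, p * q) * .of (⟨(j, k), hjk⟩, q) * .of (⟨(i, j), hij⟩, p)
  | comm_one i j k l hij hkl _ _ => .of (⟨(k, l), hkl⟩, q) * .of (⟨(i, j), hij⟩, p)

end SteinbergRel

lemma commutatorElement_eq_iff {G : Type*} [Group G] {a b c : G} : ⁅a, b⁆ = c ↔ a * b = c * b * a := by
  rw [commutatorElement_def, mul_inv_eq_iff_eq_mul, mul_inv_eq_iff_eq_mul]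

lemma steinbergRelations_iff {n : ℕ} {G : C} [GrpObj G] (x : SteinbergRel.Gen n → (R ⟶ G)) :
    SteinbergRelations (fun i j hij => x ⟨(i, j), hij⟩) ↔ (∀ i, IsAddToMulHom (x i)) ∧
      SatisfiesRelations (fun k _ p q => SteinbergRel.lhs p q k)
        (fun k _ p q => SteinbergRel.rhs p q k) x := by
  constructor
  · intro h
    refine ⟨fun ⟨⟨i, j⟩, hij⟩ {T} p q => (h.map_add i j hij p q).symm, fun k T p q => ?_⟩
    obtain ⟨i, j, k, hij, hjk, hik⟩ | ⟨i, j, k, l, hij, hkl, hjk, hil⟩ := k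
    · simpa [SteinbergRel.lhs, SteinbergRel.rhs, commutatorElement_eq_iff] using
        h.comm_mul i j k hij hjk hik p q
    · simpa [SteinbergRel.lhs, SteinbergRel.rhs, commutatorElement_eq_iff] using
        h.comm_one i j k l hij hkl hjk hil p q
  · rintro ⟨h, h'⟩
    refine ⟨fun i j hij {T} p q => (h ⟨(i, j), hij⟩ p q).symm, ?_, ?_⟩
    · intro i j k hij hjk hik T p q
      simpa [SteinbergRel.lhs, SteinbergRel.rhs, commutatorElement_eq_iff] using
        h' (.comm_mul i j k hij hjk hik) p q
    · intro i j k l hij hkl hjk hil T p q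
      simpa [SteinbergRel.lhs, SteinbergRel.rhs, commutatorElement_eq_iff] using
        h' (.comm_one i j k l hij hkl hjk hil) p q

variable [InfinitaryPretopos.{w} C]

variable (R) in
/-- The Steinberg group exists and is generated by the root elements. -/
theorem exists_isSteinbergGroup (n : ℕ) : ∃ (G : C) (_ : GrpObj G)
    (x : ∀ i j : Fin n, i ≠ j → (R ⟶ G)), IsSteinbergGroup x ∧
      IsGeneratedBy.{w} fun a : SteinbergRel.Gen n => x a.1.1 a.1.2 a.2 := by
  obtain ⟨G, hG, x, hx, hx', hg, hu⟩ := exists_presented_grpObj_of_additive.{w} (R := R)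
    (fun (k : SteinbergRel n) _ p q => k.lhs p q) (fun k _ p q => k.rhs p q)
    (by rintro (_ | _) T T' f p q <;> simp [SteinbergRel.lhs])
    (by rintro (_ | _) T T' f p q <;> simp [SteinbergRel.rhs, comp_mul])
  refine ⟨G, hG, fun i j hij => x ⟨(i, j), hij⟩, ⟨(steinbergRelations_iff x).2 ⟨hx, hx'⟩,
    fun H _ y hy => ?_⟩, hg⟩
  obtain ⟨hy₁, hy₂⟩ := (steinbergRelations_iff fun a => y a.1.1 a.1.2 a.2).1 hy
  obtain ⟨f, ⟨hf, hf'⟩, hf''⟩ := hu H _ hy₁ hy₂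
  exact ⟨f, ⟨hf, fun i j hij => hf' ⟨(i, j), hij⟩⟩, fun g hg => hf'' g ⟨hg.1, fun a => hg.2 _ _ _⟩⟩

lemma IsSteinbergGroup.isGeneratedBy {n : ℕ} {G : C} [GrpObj G]
    {x : ∀ i j : Fin n, i ≠ j → (R ⟶ G)} (hx : IsSteinbergGroup x) :
    IsGeneratedBy.{w} fun a : SteinbergRel.Gen n => x a.1.1 a.1.2 a.2 := by
  obtain ⟨G', _, x', hx', hg⟩ := exists_isSteinbergGroup.{w} R n
  obtain ⟨f, ⟨hf, hf'⟩, -⟩ := hx.universal G' x' hx'.relations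
  obtain ⟨g, ⟨_, hg'⟩, -⟩ := hx'.universal G x hx.relations
  have h : f ≫ g = 𝟙 G := by
    obtain ⟨_, -, hu⟩ := hx.universal G x hx.relations
    rw [hu (f ≫ g) ⟨inferInstance, fun i j hij => by rw [← Category.assoc, hf', hg']⟩,
      hu (𝟙 G) ⟨inferInstance, fun i j hij => Category.comp_id _⟩]
  refine fun T s => (hg (s ≫ f)).mono fun T' e ⟨a, ha⟩ => ⟨a, ?_⟩
  have := congr($ha ≫ g)
  rw [Category.assoc, Category.assoc, h, Category.comp_id, Word.eval_comp] at this
  simpa only [hg'] using this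

end Presentations

section ExtendedPresentation

variable {C : Type u} [Category.{v} C] [CartesianMonoidalCategory C] [BraidedCategory C]
  {R : C} [NonUnitalRingObj R]

open NonUnitalRingObj

/-- The relations between the generators of the universal central extension of the Steinberg
group. -/
inductive ExtendedSteinbergRel
  | trivial (i j k : Fin 4) (h : ¬(i ≠ j ∧ j ≠ k ∧ i ≠ k))
  | central (i j k : Fin 4)
  | central_self
  | change (i j k l : Fin 4) (h : Distinct i j k l)
  | comm_mul (i j k m n : Fin 4) (hij : i ≠ j) (hjk : j ≠ k) (hik : i ≠ k) (him : i ≠ m)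
    (hmj : m ≠ j) (hjn : j ≠ n) (hnk : n ≠ k)
  | comm_disjoint (i j k l m n : Fin 4) (h : Distinct i j k l) (him : i ≠ m) (hmj : m ≠ j)
    (hkn : k ≠ n) (hnl : n ≠ l)
  | comm_one (i j k l m n : Fin 4) (hij : i ≠ j) (hkl : k ≠ l) (hjk : j ≠ k) (hil : i ≠ l)
    (h : i = k ∨ j = l) (him : i ≠ m) (hmj : m ≠ j) (hkn : k ≠ n) (hnl : n ≠ l)

namespace ExtendedSteinbergRel

/-- The generators of the universal central extension. -/
abbrev Gen := Option (Fin 4 × Fin 4 × Fin 4)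

/-- The left hand sides of the relations. -/
def lhs {T : C} (p q : T ⟶ R) : ExtendedSteinbergRel → Word Gen R T
  | trivial i j k _ => .of (some (i, j, k), p)
  | central i j k => .of (none, p) * .of (some (i, j, k), q)
  | central_self => .of (none, p) * .of (none, q)
  | change i j k _ _ => .of (some (i, j, k), p)
  | comm_mul i j k m n _ _ _ _ _ _ _ => .of (some (i, m, j), p) * .of (some (j, n, k), q)
  | comm_disjoint i j k l m n _ _ _ _ _ => .of (some (i, m, j), p) * .of (some (k, n, l), q)
  | comm_one i j k l m n _ _ _ _ _ _ _ _ _ => .of (some (i, m, j), p) * .of (some (k, n, l), q)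

/-- The right hand sides of the relations. -/
def rhs {T : C} (p q : T ⟶ R) : ExtendedSteinbergRel → Word Gen R T
  | trivial _ _ _ _ => 1
  | central i j k => .of (some (i, j, k), q) * .of (none, p)
  | central_self => .of (none, q) * .of (none, p)
  | change i _ k l _ => .of (some (i, l, k), p) * .of (none, p)
  | comm_mul i j k m n _ _ _ _ _ _ _ =>
    .of (some (i, j, k), p * q) * .of (none, p * (q * q - q)) * .of (some (j, n, k), q) *
      .of (some (i, m, j), p)
  | comm_disjoint i j k l m n _ _ _ _ _ =>
    .of (none, p * q) * .of (some (k, n, l), q) * .of (some (i, m, j), p)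
  | comm_one i j k l m n _ _ _ _ _ _ _ _ _ => .of (some (k, n, l), q) * .of (some (i, m, j), p)

end ExtendedSteinbergRel

lemma extendedSteinbergRelations_iff {X : C} [GrpObj X] (y : ExtendedSteinbergRel.Gen → (R ⟶ X)) :
    ExtendedSteinbergRelations (fun i j k => y (some (i, j, k))) (y none) ↔
      (∀ i, IsAddToMulHom (y i)) ∧ SatisfiesRelations (fun k _ p q => ExtendedSteinbergRel.lhs p q k)
        (fun k _ p q => ExtendedSteinbergRel.rhs p q k) y := by
  constructor
  · intro h
    refine ⟨?_, fun k T p q => ?_⟩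
    · rintro (_ | ⟨i, j, k⟩)
      · exact h.map_add_center
      · exact h.map_add i j k
    cases k with
    | trivial i j k hijk =>
      simpa [ExtendedSteinbergRel.lhs, ExtendedSteinbergRel.rhs] using h.trivial hijk p
    | central i j k =>
      simpa [ExtendedSteinbergRel.lhs, ExtendedSteinbergRel.rhs] using h.central i j k p q
    | central_self =>
      simpa [ExtendedSteinbergRel.lhs, ExtendedSteinbergRel.rhs] using h.central_self p q
    | change i j k l hi =>
      simpa [ExtendedSteinbergRel.lhs, ExtendedSteinbergRel.rhs] using h.change hi p
    | comm_mul i j k m n hij hjk hik him hmj hjn hnk =>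
      simpa [ExtendedSteinbergRel.lhs, ExtendedSteinbergRel.rhs, commutatorElement_eq_iff] using
        h.comm_mul m n hij hjk hik him hmj hjn hnk p q
    | comm_disjoint i j k l m n hi him hmj hkn hnl =>
      simpa [ExtendedSteinbergRel.lhs, ExtendedSteinbergRel.rhs, commutatorElement_eq_iff] using
        h.comm_disjoint m n hi him hmj hkn hnl p q
    | comm_one i j k l m n hij hkl hjk hil hi him hmj hkn hnl =>
      simpa [ExtendedSteinbergRel.lhs, ExtendedSteinbergRel.rhs, commutatorElement_eq_iff] using
        h.comm_one m n hij hkl hjk hil hi him hmj hkn hnl p q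
  · rintro ⟨h, h'⟩
    simp only [SatisfiesRelations] at h'
    refine ⟨fun i j k => h _, h _, fun {i j k} hi {T} p => ?_, fun i j k {T} p q => ?_,
      fun {T} p q => ?_, fun {i j k l} hi {T} p => ?_, ?_, ?_, ?_⟩
    · simpa [ExtendedSteinbergRel.lhs, ExtendedSteinbergRel.rhs] using h' (.trivial i j k hi) p p
    · simpa [ExtendedSteinbergRel.lhs, ExtendedSteinbergRel.rhs] using h' (.central i j k) p q
    · simpa [ExtendedSteinbergRel.lhs, ExtendedSteinbergRel.rhs] using h' .central_self p q
    · simpa [ExtendedSteinbergRel.lhs, ExtendedSteinbergRel.rhs] using h' (.change i j k l hi) p p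
    · intro i j k m n hij hjk hik him hmj hjn hnk T p q
      simpa [ExtendedSteinbergRel.lhs, ExtendedSteinbergRel.rhs, commutatorElement_eq_iff] using
        h' (.comm_mul i j k m n hij hjk hik him hmj hjn hnk) p q
    · intro i j k l m n hi him hmj hkn hnl T p q
      simpa [ExtendedSteinbergRel.lhs, ExtendedSteinbergRel.rhs, commutatorElement_eq_iff] using
        h' (.comm_disjoint i j k l m n hi him hmj hkn hnl) p q
    · intro i j k l m n hij hkl hjk hil hi him hmj hkn hnl T p q
      simpa [ExtendedSteinbergRel.lhs, ExtendedSteinbergRel.rhs, commutatorElement_eq_iff] using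
        h' (.comm_one i j k l m n hij hkl hjk hil hi him hmj hkn hnl) p q

variable (R) in
/-- The group object given by the relations of lifted root elements exists. -/
theorem exists_extendedSteinbergGroup [InfinitaryPretopos.{w} C] :
    ∃ (X : C) (_ : GrpObj X) (y : ExtendedSteinbergRel.Gen → (R ⟶ X)),
      ExtendedSteinbergRelations (fun i j k => y (some (i, j, k))) (y none) ∧
      IsGeneratedBy.{w} y ∧ ∀ (H : C) [GrpObj H] (z : ExtendedSteinbergRel.Gen → (R ⟶ H)),
        ExtendedSteinbergRelations (fun i j k => z (some (i, j, k))) (z none) →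
          ∃! f : X ⟶ H, IsMonHom f ∧ ∀ i, y i ≫ f = z i := by
  obtain ⟨X, hX, y, hy, hy', hg, hu⟩ := exists_presented_grpObj_of_additive.{w} (R := R)
    (fun (k : ExtendedSteinbergRel) _ p q => k.lhs p q) (fun k _ p q => k.rhs p q)
    (by rintro k T T' f p q; cases k <;> simp [ExtendedSteinbergRel.lhs])
    (by rintro k T T' f p q; cases k <;> simp [ExtendedSteinbergRel.rhs, comp_mul, comp_sub])
  refine ⟨X, hX, y, (extendedSteinbergRelations_iff y).2 ⟨hy, hy'⟩, hg, fun H _ z hz => ?_⟩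
  obtain ⟨hz₁, hz₂⟩ := (extendedSteinbergRelations_iff z).1 hz
  exact hu H z hz₁ hz₂

end ExtendedPresentation

section CentralQuotients

variable {C : Type u} [Category.{v} C] [CartesianMonoidalCategory C] [BraidedCategory C]
  [InfinitaryPretopos.{w} C] {R X : C} [NonUnitalRingObj R] [GrpObj X]

open NonUnitalRingObj

/-- The quotient of a group object by the image of a central homomorphism. -/
theorem IsAddToMulHom.exists_quotient {c : R ⟶ X} (hc : IsAddToMulHom c)
    (hc' : ∀ {T : C} (p : T ⟶ R) (z : T ⟶ X), (p ≫ c) * z = z * (p ≫ c)) :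
    ∃ (Q : C) (_ : GrpObj Q) (q : X ⟶ Q), IsMonHom q ∧ Epi q ∧
      (∀ {T : C} (p : T ⟶ R), p ≫ c ≫ q = 1) ∧
      ∀ {T : C} (z : T ⟶ X), z ≫ q = 1 → Locally.{w} T fun T' e => ∃ p : T' ⟶ R, p ≫ c = e ≫ z := by
  let ρ : ∀ ⦃T : C⦄, (T ⟶ X) → (T ⟶ X) → Prop := fun T y z => ∃ p : T ⟶ R, z = y * (p ≫ c)
  have hρ : IsSmallRel.{w} (yoneda.obj X) ρ := by
    refine ⟨?_, PUnit, fun _ => X ⊗ R, fun _ => fst X R,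
      fun _ => fst X R * (snd X R ≫ c), fun _ => ⟨_, rfl⟩, ?_⟩
    · rintro T T' f y _ ⟨p, rfl⟩
      exact ⟨f ≫ p, (MonObj.comp_mul _ _ _).trans (by rw [Category.assoc]; rfl)⟩
    · rintro T (y : T ⟶ X) _ ⟨p, rfl⟩
      refine ⟨⟨⟩, lift y p, lift_fst _ _, (MonObj.comp_mul _ _ _).trans ?_⟩
      change lift y p ≫ fst X R * lift y p ≫ snd X R ≫ c = y * (p ≫ c)
      rw [lift_fst, lift_snd_assoc]
  have he : ∀ ⦃T : C⦄, Equivalence (ρ (T := T)) := fun T =>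
    { refl := fun y => ⟨0, by rw [hc.map_zero, mul_one]⟩
      symm := by
        rintro y _ ⟨p, rfl⟩
        exact ⟨-p, by rw [hc.map_neg, mul_inv_cancel_right]⟩
      trans := by
        rintro y _ _ ⟨p, rfl⟩ ⟨p', rfl⟩
        exact ⟨p + p', by rw [hc, mul_assoc]⟩ }
  obtain ⟨Q, q, hq, hQ⟩ := hρ.exists_quotient he
  let _ : ∀ T : C, Monoid ((yoneda.obj X).obj (.op T)) := fun T =>
    inferInstanceAs (Monoid (T ⟶ X))
  let inv : ∀ ⦃T : C⦄, (T ⟶ X) → (T ⟶ X) := fun T y => y⁻¹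
  obtain ⟨hG, hqm⟩ := hQ.exists_grpObj he hρ.res (fun T T' f => MonObj.comp_one f)
    (fun T T' f => MonObj.comp_mul f)
    (by
      rintro T (y : T ⟶ X) _ (z : T ⟶ X) _ ⟨p, rfl⟩ ⟨p', rfl⟩
      refine ⟨p + p', ?_⟩
      change y * (p ≫ c) * (z * (p' ≫ c)) = y * z * _
      rw [hc, mul_assoc, ← mul_assoc (p ≫ c), hc', mul_assoc z, mul_assoc])
    inv (fun T T' f => GrpObj.comp_inv f)
    (fun T (y : T ⟶ X) => by
      change ρ (y⁻¹ * y) 1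
      rw [inv_mul_cancel]
      exact he.refl _)
    (fun T (y : T ⟶ X) => by
      change ρ (y * y⁻¹) 1
      rw [mul_inv_cancel]
      exact he.refl _)
  replace hqm : ∀ ⦃T : C⦄ (y z : T ⟶ X), (y * z) ≫ q = (y ≫ q) * (z ≫ q) := hqm
  have hqh : IsMonHom q := isMonHom_of_map_mul q fun {T} a b => hqm a b
  refine ⟨Q, hG, q, hqh, hq, fun {T} p => ?_, fun {T} z hz => ?_⟩
  · rw [← Category.assoc, ← MonObj.one_comp q]
    exact hQ.sound hρ.res (he.symm ⟨p, (one_mul _).symm⟩)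
  · rw [← MonObj.one_comp q] at hz
    refine ((hQ.eq_iff (1 : T ⟶ X) z).1 hz.symm).mono ?_
    rintro T' e ⟨p, hp⟩
    refine ⟨p, ?_⟩
    refine Eq.trans ?_ hp.symm
    change _ = (e ≫ 1) * _
    rw [MonObj.comp_one, one_mul]

omit [BraidedCategory C] in
/-- A homomorphism killing the kernel of a quotient map descends. -/
lemma exists_desc_isMonHom {X Q Y : C} [GrpObj X] [GrpObj Q] [GrpObj Y] (q : X ⟶ Q) [IsMonHom q]
    [Epi q] (f : X ⟶ Y) [IsMonHom f] (h : ∀ {T : C} (z : T ⟶ X), z ≫ q = 1 → z ≫ f = 1) :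
    ∃ g : Q ⟶ Y, IsMonHom g ∧ q ≫ g = f := by
  obtain ⟨g, hg⟩ := exists_desc_of_epi.{w} q f (fun T s t hst => by
    have := h (s * t⁻¹) (by rw [MonObj.mul_comp, GrpObj.inv_comp, hst, mul_inv_cancel])
    rwa [MonObj.mul_comp, GrpObj.inv_comp, mul_inv_eq_one] at this)
  refine ⟨g, isMonHom_of_map_mul g fun {T} a b => ?_, hg⟩
  obtain ⟨T₁, e₁, s, h₁, hs⟩ := exists_epi_lift.{w} q a
  obtain ⟨T₂, e₂, t, h₂, ht⟩ := exists_epi_lift.{w} q (e₁ ≫ b)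
  have ha : (e₂ ≫ e₁) ≫ a = (e₂ ≫ s) ≫ q := by rw [Category.assoc, ← hs, Category.assoc]
  have hb : (e₂ ≫ e₁) ≫ b = t ≫ q := by rw [Category.assoc, ht]
  rw [← cancel_epi (e₂ ≫ e₁), ← Category.assoc, MonObj.comp_mul, MonObj.comp_mul,
    ← Category.assoc _ a, ← Category.assoc _ b, ha, hb, ← MonObj.mul_comp, Category.assoc _ q,
    Category.assoc _ q, Category.assoc _ q, hg, MonObj.mul_comp]

omit [BraidedCategory C] [NonUnitalRingObj R] in
lemma IsGeneratedBy.central {I : Type} {G T : C} [GrpObj G] {x : I → (R ⟶ G)}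
    (hx : IsGeneratedBy.{w} x) (z : T ⟶ G)
    (h : ∀ ⦃T' : C⦄ (e : T' ⟶ T) (i : I) (p : T' ⟶ R),
      (e ≫ z) * (p ≫ x i) = (p ≫ x i) * (e ≫ z)) (g : T ⟶ G) : z * g = g * z := by
  refine Locally.eq.{w} ((hx g).mono ?_)
  rintro T' e ⟨a, ha⟩
  rw [MonObj.comp_mul, MonObj.comp_mul, ← ha]
  clear ha
  induction a using FreeMonoid.inductionOn' with
  | one => rw [map_one, one_mul, mul_one]
  | of_mul a w ih =>
    obtain ⟨i, p⟩ := a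
    rw [map_mul, Word.eval_of, ← mul_assoc, h, mul_assoc, ih, mul_assoc]

variable {G : C} [GrpObj G] {x : Fin 4 → Fin 4 → (R ⟶ G)}

omit [InfinitaryPretopos.{w} C] in
/-- Modulo the image of `c`, the lifts of the root elements satisfy the Steinberg relations. -/
lemma ExtendedSteinbergRelations.steinbergRelations {y : Fin 4 → Fin 4 → Fin 4 → (R ⟶ X)}
    {c : R ⟶ X} (hy : ExtendedSteinbergRelations y c) {Q : C} [GrpObj Q] (q : X ⟶ Q) [IsMonHom q]
    (hq : ∀ {T : C} (p : T ⟶ R), p ≫ c ≫ q = 1) :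
    ∃ z : Fin 4 → Fin 4 → (R ⟶ Q), SteinbergRelations (fun i j (_ : i ≠ j) => z i j) ∧
      ∀ {i j k : Fin 4}, i ≠ j → j ≠ k → i ≠ k → y i j k ≫ q = z i k := by
  obtain ⟨m, hm⟩ : ∃ m : Fin 4 → Fin 4 → Fin 4, ∀ i k, i ≠ m i k ∧ m i k ≠ k := by
    have : ∀ i k : Fin 4, ∃ j, i ≠ j ∧ j ≠ k := by decide
    choose m hm using this
    exact ⟨m, hm⟩
  have hyz : ∀ {i j k : Fin 4}, i ≠ j → j ≠ k → i ≠ k → y i j k ≫ q = y i (m i k) k ≫ q := by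
    intro i j k hij hjk hik
    by_cases h : j = m i k
    · rw [← h]
    · have h' : Distinct i j k (m i k) := ⟨hij, hik, (hm i k).1, hjk, h, (hm i k).2.symm⟩
      have h₁ := congr($(hy.change h' (𝟙 R)) ≫ q)
      rwa [MonObj.mul_comp, Category.assoc, Category.assoc, Category.assoc, hq, mul_one,
        Category.id_comp, Category.id_comp] at h₁
  have hc : ∀ {i j k l : Fin 4} {T : C} (p p' : T ⟶ R), ⁅p ≫ y i (m i j) j ≫ q,
      p' ≫ y k (m k l) l ≫ q⁆ = ⁅p ≫ y i (m i j) j, p' ≫ y k (m k l) l⁆ ≫ q := fun p p' => by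
    rw [GrpObj.commutator_comp, Category.assoc, Category.assoc]
  refine ⟨fun i k => y i (m i k) k ≫ q, ⟨fun i j hij {T} p p' => ?_,
    fun i j k hij hjk hik {T} p p' => ?_, fun i j k l hij hkl hjk hil {T} p p' => ?_⟩, hyz⟩
  · rw [← Category.assoc, ← Category.assoc, ← Category.assoc, ← MonObj.mul_comp, ← hy.map_add]
  · rw [hc, hy.comm_mul _ _ hij hjk hik (hm i j).1 (hm i j).2 (hm j k).1 (hm j k).2,
      MonObj.mul_comp, Category.assoc, Category.assoc, hq, mul_one, hyz hij hjk hik]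
  · rw [hc]
    by_cases h : i = k ∨ j = l
    · rw [hy.comm_one _ _ hij hkl hjk hil h (hm i j).1 (hm i j).2 (hm k l).1 (hm k l).2,
        MonObj.one_comp]
    · rw [not_or] at h
      rw [hy.comm_disjoint _ _ ⟨hij, h.1, hil, hjk, h.2, hkl⟩ (hm i j).1 (hm i j).2 (hm k l).1
        (hm k l).2, Category.assoc, hq]

variable {E : Subobject R}

/-- The structure of a central extension of the Steinberg group. -/
theorem IsCentralExtension.exists_extendedSteinbergRelations (hE : IsWeakUnit R E)
    (hx : SteinbergRelations fun i j (_ : i ≠ j) => x i j) {d : X ⟶ G}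
    (hd : IsCentralExtension d) : ∃ (B : G ⊗ G ⟶ X) (c : R ⟶ X)
      (y : Fin 4 → Fin 4 → Fin 4 → (R ⟶ X)), IsCommutatorPairing d B ∧
      IsSteinbergPairing x d B ∧ IsDisjointRootPairing x B c ∧ ExtendedSteinbergRelations y c ∧
      (∀ {T : C} (p : T ⟶ R), p ≫ c ≫ d = 1) ∧
      ∀ {i j k : Fin 4}, i ≠ j → j ≠ k → i ≠ k → y i j k ≫ d = x i k := by
  have := hd.isHom
  obtain ⟨B, hB⟩ := hd.exists_pairing.{w}
  have H := hE.isSteinbergPairing.{w} hx hd hB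
  obtain ⟨c, hc⟩ := H.exists_isDisjointRootPairing.{w} hE
  obtain ⟨y, hy, hyd⟩ := hc.exists_extendedSteinbergRelations.{w} hE H
  exact ⟨B, c, y, hB, H, hc, hy, fun p => (Category.assoc _ _ _).symm.trans
    (hc.comp_eq_one.{w} hE H p), hyd⟩

end CentralQuotients

section UniversalExtension

lemma isCentralExtension_id {C : Type u} [Category.{v} C] [CartesianMonoidalCategory C] (G : C)
    [GrpObj G] : IsCentralExtension (𝟙 G) :=
  ⟨inferInstance, inferInstance, fun z h hz => by
    rw [Category.comp_id] at hz
    rw [hz, one_mul, mul_one]⟩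

variable {C : Type u} [Category.{v} C] [CartesianMonoidalCategory C] [BraidedCategory C]
  {R G : C} [NonUnitalRingObj R] [GrpObj G] {x : Fin 4 → Fin 4 → (R ⟶ G)}

open NonUnitalRingObj

lemma ExtendedSteinbergRelations.map {X Y : C} [GrpObj X] [GrpObj Y]
    {y : Fin 4 → Fin 4 → Fin 4 → (R ⟶ X)} {c : R ⟶ X} (hy : ExtendedSteinbergRelations y c)
    (f : X ⟶ Y) [IsMonHom f] :
    ExtendedSteinbergRelations (fun i j k => y i j k ≫ f) (c ≫ f) := by
  let z : ExtendedSteinbergRel.Gen → (R ⟶ X) := fun a => a.elim c fun t => y t.1 t.2.1 t.2.2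
  obtain ⟨h, h'⟩ := (extendedSteinbergRelations_iff z).1 hy
  refine (extendedSteinbergRelations_iff fun a => z a ≫ f).2 ⟨fun a {T} p q => ?_,
    fun k T p q => ?_⟩
  · rw [← Category.assoc, h a, MonObj.mul_comp, Category.assoc, Category.assoc]
  · rw [← Word.eval_comp, ← Word.eval_comp, h' k p q]

lemma ExtendedSteinbergRelations.trivial' {X : C} [GrpObj X]
    {y : Fin 4 → Fin 4 → Fin 4 → (R ⟶ X)} {c : R ⟶ X} (hy : ExtendedSteinbergRelations y c)
    {i j k : Fin 4} (h : ¬(i ≠ j ∧ j ≠ k ∧ i ≠ k)) : y i j k = 1 := by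
  rw [← Category.id_comp (y i j k), hy.trivial h]

/-- Two families of lifted generators which agree on root elements agree. -/
lemma ExtendedSteinbergRelations.comp_eq {X Y : C} [GrpObj X] [GrpObj Y]
    {y : Fin 4 → Fin 4 → Fin 4 → (R ⟶ X)} {c : R ⟶ X} (hy : ExtendedSteinbergRelations y c)
    {z : Fin 4 → Fin 4 → Fin 4 → (R ⟶ Y)} {c' : R ⟶ Y} (hz : ExtendedSteinbergRelations z c')
    (f : X ⟶ G) (g : Y ⟶ G) [IsMonHom f] [IsMonHom g]
    (hf : ∀ {i j k : Fin 4}, i ≠ j → j ≠ k → i ≠ k → y i j k ≫ f = x i k)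
    (hg : ∀ {i j k : Fin 4}, i ≠ j → j ≠ k → i ≠ k → z i j k ≫ g = x i k) (i j k : Fin 4) :
    y i j k ≫ f = z i j k ≫ g := by
  by_cases h : i ≠ j ∧ j ≠ k ∧ i ≠ k
  · rw [hf h.1 h.2.1 h.2.2, hg h.1 h.2.1 h.2.2]
  · rw [hy.trivial' h, hz.trivial' h, MonObj.one_comp, MonObj.one_comp]

variable [InfinitaryPretopos.{w} C] {E : Subobject R} (hE : IsWeakUnit R E)
  (hx : IsSteinbergGroup fun i j (_ : i ≠ j) => x i j)

include hE hx

/-- The Steinberg group has a universal central extension. -/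
theorem IsSteinbergGroup.exists_isUniversalCentralExtension :
    ∃ (X : C) (_ : GrpObj X) (κ : X ⟶ G), IsUniversalCentralExtension κ := by
  obtain ⟨X, _, y, hy, hg, hu⟩ := exists_extendedSteinbergGroup.{w} R
  obtain ⟨-, c₀, y₀, -, -, -, hy₀, hc₀, hyx₀⟩ :=
    (isCentralExtension_id G).exists_extendedSteinbergRelations.{w} hE hx.relations
  simp only [Category.comp_id] at hc₀ hyx₀
  obtain ⟨κ, ⟨_, hκ⟩, -⟩ := hu G (fun a => a.elim c₀ fun t => y₀ t.1 t.2.1 t.2.2) hy₀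
  have hcκ : ∀ {T : C} (p : T ⟶ R), (p ≫ y none) ≫ κ = 1 := fun p => by
    rw [Category.assoc, hκ]
    exact hc₀ p
  have hyκ : ∀ {i j k : Fin 4}, i ≠ j → j ≠ k → i ≠ k → y (some (i, j, k)) ≫ κ = x i k :=
    fun hij hjk hik => (hκ _).trans (hyx₀ hij hjk hik)
  have hc : ∀ {T : C} (p : T ⟶ R) (z : T ⟶ X), (p ≫ y none) * z = z * (p ≫ y none) := by
    intro T p z
    refine hg.central _ ?_ z
    rintro T' e (_ | ⟨i, j, k⟩) q
    · rw [← Category.assoc]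
      exact hy.central_self _ _
    · rw [← Category.assoc]
      exact hy.central i j k _ _
  obtain ⟨Q, _, q, _, _, hq, hq'⟩ := IsAddToMulHom.exists_quotient.{w} hy.map_add_center hc
  obtain ⟨z, hz, hyz⟩ := hy.steinbergRelations q hq
  obtain ⟨s, ⟨_, hs⟩, -⟩ := hx.universal Q _ hz
  have hqs : q = κ ≫ s := by
    refine hg.hom_ext ?_
    rintro (_ | ⟨i, j, k⟩)
    · rw [← Category.id_comp (y none), ← Category.assoc, hcκ, MonObj.one_comp, Category.assoc, hq]
    · by_cases h : i ≠ j ∧ j ≠ k ∧ i ≠ k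
      · rw [← Category.assoc, hyκ h.1 h.2.1 h.2.2, hs i k h.2.2, ← hyz h.1 h.2.1 h.2.2]
      · rw [hy.trivial' h, MonObj.one_comp, MonObj.one_comp]
  have hepi : Epi κ := by
    refine hx.isGeneratedBy.epi κ (fun a : SteinbergRel.Gen 4 => y (some (a.1.1,
      (if a.1.1 = 0 ∨ a.1.2 = 0 then if a.1.1 = 1 ∨ a.1.2 = 1 then 2 else 1 else 0), a.1.2))) ?_
    rintro ⟨⟨i, j⟩, hij⟩
    refine hyκ ?_ ?_ hij <;> revert i j <;> decide
  have hcentral : IsCentralExtension κ := ⟨inferInstance, hepi, fun {T} a b ha => by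
    refine Locally.eq.{w} ((hq' a ?_).mono ?_)
    · rw [hqs, ← Category.assoc, ha, MonObj.one_comp]
    · rintro T' e ⟨p, hp⟩
      rw [MonObj.comp_mul, MonObj.comp_mul, ← hp, hc]⟩
  refine ⟨X, inferInstance, κ, hcentral, fun Y _ d hd => ?_⟩
  have := hd.isHom
  obtain ⟨-, c', y', -, -, -, hy', hc', hyx'⟩ :=
    hd.exists_extendedSteinbergRelations.{w} hE hx.relations
  obtain ⟨f, ⟨_, hf⟩, -⟩ := hu Y (fun a => a.elim c' fun t => y' t.1 t.2.1 t.2.2) hy'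
  have hfd : f ≫ d = κ := by
    refine hg.hom_ext ?_
    rintro (_ | ⟨i, j, k⟩)
    · rw [← Category.assoc, hf, ← Category.id_comp (y none), hcκ, ← hc' (𝟙 R), Category.id_comp]
      rfl
    · rw [← Category.assoc, hf]
      exact hy'.comp_eq hy d κ hyx' hyκ i j k
  refine ⟨f, ⟨inferInstance, hfd⟩, fun g ⟨_, hgd⟩ => ?_⟩
  have h := (hy.map g).hom_eq hE (hy.map f) (fun {i j k l} m n _ _ _ _ _ _ {T} p q =>
    hd.commutator_eq_of_comp_eq (by simp only [Category.assoc, hgd, hfd])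
      (by simp only [Category.assoc, hgd, hfd]))
  refine hg.hom_ext ?_
  rintro (_ | ⟨i, j, k⟩)
  · exact h.2
  · exact congrFun (congrFun (congrFun h.1 i) j) k

omit hE in
/-- The kernel of the universal central extension consists of values of `c`. -/
theorem IsUniversalCentralExtension.locally_mem_image {X : C} [GrpObj X] {κ : X ⟶ G}
    (hκ : IsUniversalCentralExtension κ) {y : Fin 4 → Fin 4 → Fin 4 → (R ⟶ X)} {c : R ⟶ X}
    (hy : ExtendedSteinbergRelations y c) (hcκ : ∀ {T : C} (p : T ⟶ R), p ≫ c ≫ κ = 1)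
    (hyκ : ∀ {i j k : Fin 4}, i ≠ j → j ≠ k → i ≠ k → y i j k ≫ κ = x i k)
    {T : C} (t : T ⟶ X) (ht : t ≫ κ = 1) :
    Locally.{w} T fun T' e => ∃ p : T' ⟶ R, p ≫ c = e ≫ t := by
  have hcentral := hκ.isCentralExtension
  have := hcentral.isHom
  have := hcentral.epi
  obtain ⟨Q, _, q, _, _, hq, hq'⟩ := IsAddToMulHom.exists_quotient.{w} hy.map_add_center
    (fun {T} p z => hcentral.central _ z ((Category.assoc _ _ _).trans (hcκ p)))
  obtain ⟨z, hz, hyz⟩ := hy.steinbergRelations q hq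
  obtain ⟨s, ⟨_, hs⟩, -⟩ := hx.universal Q _ hz
  obtain ⟨d, _, hd⟩ := exists_desc_isMonHom.{w} q κ (fun {T} z hz => by
    refine Locally.eq.{w} ((hq' z hz).mono ?_)
    rintro T' e ⟨p, hp⟩
    rw [← Category.assoc, ← hp, Category.assoc, hcκ, MonObj.comp_one])
  have hsd : s ≫ d = 𝟙 G := by
    refine hx.isGeneratedBy.hom_ext ?_
    rintro ⟨⟨i, k⟩, hik⟩
    obtain ⟨j, hij, hjk⟩ : ∃ j : Fin 4, i ≠ j ∧ j ≠ k := by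
      revert i k; decide
    dsimp only at hik ⊢
    rw [← Category.assoc, hs i k hik, ← hyz hij hjk hik, Category.assoc, hd, hyκ hij hjk hik,
      Category.comp_id]
  have hdc : IsCentralExtension d := by
    refine ⟨inferInstance, ?_, fun {T} a b ha => ?_⟩
    · have : Epi (q ≫ d) := hd ▸ inferInstance
      exact epi_of_epi q d
    · obtain ⟨T₁, e₁, a', h₁, ha'⟩ := exists_epi_lift.{w} q a
      obtain ⟨T₂, e₂, b', h₂, hb'⟩ := exists_epi_lift.{w} q (e₁ ≫ b)
      have h := hcentral.central (e₂ ≫ a') b' (by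
        rw [← hd, Category.assoc, ← Category.assoc a', ha', Category.assoc, ha, MonObj.comp_one,
          MonObj.comp_one])
      rw [← cancel_epi e₁, ← cancel_epi e₂, MonObj.comp_mul, MonObj.comp_mul, MonObj.comp_mul,
        MonObj.comp_mul, ← ha', ← hb', ← Category.assoc, ← MonObj.mul_comp, h, MonObj.mul_comp]
  obtain ⟨_, -, hu⟩ := hκ.universal Q d hdc
  refine hq' t ?_
  rw [hu q ⟨inferInstance, hd⟩, ← hu (κ ≫ s) ⟨inferInstance, by
    rw [Category.assoc, hsd, Category.comp_id]⟩, ← Category.assoc, ht, MonObj.one_comp]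

end UniversalExtension

section SchurMultiplier

variable {C : Type u} [Category.{v} C] [CartesianMonoidalCategory C]

lemma IsCommutatorPairing.imageSubobject_eq_kernelOf [InfinitaryPretopos.{w} C] {R X G : C}
    [GrpObj X] [GrpObj G] {κ : X ⟶ G} {c : R ⟶ X} (hc : c ≫ κ = 1)
    (h : ∀ {T : C} (z : T ⟶ X), z ≫ κ = 1 →
      Locally.{w} T fun T' e => ∃ p : T' ⟶ R, p ≫ c = e ≫ z) :
    imageSubobject c = kernelOf κ := by
  have hκ := Subobject.isPullback κ (Subobject.mk η[G])
  refine le_antisymm ?_ ?_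
  · refine imageSubobject_le c (hκ.lift (toUnit R ≫ (Subobject.underlyingIso η[G]).inv) c ?_)
      (hκ.lift_snd _ _ _)
    rw [Category.assoc, Subobject.underlyingIso_arrow, hc]
    rfl
  · have hz : (kernelOf κ).arrow ≫ κ = 1 := by
      have := hκ.w
      rw [← Subobject.underlyingIso_hom_comp_eq_mk η[G], ← Category.assoc,
        toUnit_unique (_ ≫ _) (toUnit _)] at this
      exact this.symm
    obtain ⟨g, hg⟩ := Locally.factors.{w} (f := (kernelOf κ).arrow) (imageSubobject c).arrow
      ((h _ hz).mono fun T' e ⟨p, hp⟩ => ⟨p ≫ factorThruImageSubobject c, by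
        rw [Category.assoc, imageSubobject_arrow_comp, hp]⟩)
    exact Subobject.le_of_comm g hg

variable [BraidedCategory C]

open NonUnitalRingObj

/-- The homomorphism `c` factors through `R_{2ε}`. -/
lemma IsDisjointRootPairing.exists_factor [InfinitaryPretopos.{w} C] {R X G : C}
    [NonUnitalRingObj R] [GrpObj X] [GrpObj G] {E : Subobject R} (hE : IsWeakUnit R E)
    {x : Fin 4 → Fin 4 → (R ⟶ G)} {d : X ⟶ G} {B : G ⊗ G ⟶ X} {c : R ⟶ X}
    (H : IsSteinbergPairing x d B) (hc : IsDisjointRootPairing x B c) {Q : C} [NonUnitalRingObj Q]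
    {π : R ⟶ Q} (hπ : IsTwoEpsQuotient π) : ∃ c₀ : Q ⟶ X, IsAddToMulHom c₀ ∧ π ≫ c₀ = c := by
  obtain ⟨Q', _, q, hq, _, hq'⟩ := exists_isTwoEpsQuotient.{w} R
  obtain ⟨c₀, hc₀⟩ := exists_desc_of_epi.{w} q c (fun T p p' h => by
    refine Locally.eq.{w} ((hq' p p' h).mono fun T' e h => ?_)
    obtain ⟨U, _, φ, hφ, hφ', hφ₀⟩ := hc.exists_commRing_hom_kills.{w} hE H T'
    rw [← Category.assoc, ← Category.assoc]
    refine hφ' _ _ ?_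
    generalize e ≫ p = a, e ≫ p' = b at h ⊢
    induction h with
    | of a b h =>
      obtain ⟨rfl, k, r, s, rfl⟩ := h
      fin_cases k
      · simpa [twoEpsGenerator, two_mul] using hφ r
      · simp [twoEpsGenerator, _root_.mul_comm]
      · simpa [twoEpsGenerator] using hφ₀ r s
    | refl => rfl
    | symm _ ih => exact ih.symm
    | trans _ _ ih ih' => exact ih.trans ih'
    | op b _ _ ih ih' =>
      obtain ⟨_ | _⟩ := b
      · exact (_root_.map_add φ _ _).trans ((congrArg₂ _ ih ih').trans (_root_.map_add φ _ _).symm)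
      · exact (map_mul φ _ _).trans ((congrArg₂ _ ih ih').trans (map_mul φ _ _).symm))
  have hc₀' : IsAddToMulHom c₀ := fun {T} a b => by
    obtain ⟨T₁, e₁, s, h₁, hs⟩ := exists_epi_lift.{w} q a
    obtain ⟨T₂, e₂, t, h₂, ht⟩ := exists_epi_lift.{w} q (e₁ ≫ b)
    have ha : (e₂ ≫ e₁) ≫ a = (e₂ ≫ s) ≫ q := by rw [Category.assoc, ← hs, Category.assoc]
    have hb : (e₂ ≫ e₁) ≫ b = t ≫ q := by rw [Category.assoc, ht]
    rw [← cancel_epi (e₂ ≫ e₁), ← Category.assoc, comp_add, MonObj.comp_mul, ← Category.assoc _ a,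
      ← Category.assoc _ b, ha, hb, ← hq.isHom.map_add, Category.assoc _ q, Category.assoc _ q,
      Category.assoc _ q, hc₀, hc.map_add]
  obtain ⟨g, ⟨hg, hg'⟩, -⟩ := hπ.universal Q' q hq.isHom hq.kills
  refine ⟨g ≫ c₀, fun {T} a b => ?_, by rw [← Category.assoc, hg', hc₀]⟩
  rw [← Category.assoc, hg.map_add, hc₀', Category.assoc, Category.assoc]

end SchurMultiplier
theorem mainTheorem5 {C : Type u} [Category.{v} C] [CartesianMonoidalCategory C]
    [BraidedCategory C] [InfinitaryPretopos.{w} C] (R : C) [NonUnitalRingObj R]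
    (hR : IsWeaklyUnital R) :
    -- the group object `St(A₃, R)` exists
    (∃ (St : C) (_ : GrpObj St) (x : ∀ i j : Fin 4, i ≠ j → (R ⟶ St)), IsSteinbergGroup x) ∧
    -- the factor-ring `R_{2ε}` exists
    (∃ (Q : C) (_ : NonUnitalRingObj Q) (π : R ⟶ Q), IsTwoEpsQuotient π) ∧
    ∀ (St : C) [GrpObj St] (x : ∀ i j : Fin 4, i ≠ j → (R ⟶ St)), IsSteinbergGroup x →
      -- `St(A₃, R)` has a universal central extension
      (∃ (H : C) (_ : GrpObj H) (κ : H ⟶ St), IsUniversalCentralExtension κ) ∧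
      ∀ (H : C) [GrpObj H] (κ : H ⟶ St), IsUniversalCentralExtension κ →
        ∃ B : St ⊗ St ⟶ H, IsCommutatorPairing κ B ∧
          ∃ c : R ⟶ H,
            -- every `c_{ij|kl}` is well defined and equal to `c`
            (∀ (i j k l : Fin 4) (hij : i ≠ j) (hkl : k ≠ l),
              i ≠ k → i ≠ l → j ≠ k → j ≠ l →
                IsRootPairing x B i j k l hij hkl c ∧
                ∀ c' : R ⟶ H, IsRootPairing x B i j k l hij hkl c' → c' = c) ∧
            -- `c` factors through `R_{2ε}`
            (∀ (Q : C) [NonUnitalRingObj Q] (π : R ⟶ Q), IsTwoEpsQuotient π →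
              ∃ c₀ : Q ⟶ H, IsAddToMulHom c₀ ∧ π ≫ c₀ = c) ∧
            -- the Schur multiplier is the image of `c`
            imageSubobject c = kernelOf κ := by
  obtain ⟨E, hE⟩ := hR
  refine ⟨?_, ?_, fun St _ x hx => ?_⟩
  · obtain ⟨St, hSt, x, hx, -⟩ := exists_isSteinbergGroup.{w} R 4
    exact ⟨St, hSt, x, hx⟩
  · obtain ⟨Q, hQ, π, hπ, -⟩ := exists_isTwoEpsQuotient.{w} R
    exact ⟨Q, hQ, π, hπ⟩
  obtain ⟨x, rfl⟩ : ∃ x' : Fin 4 → Fin 4 → (R ⟶ St), x = fun i j _ => x' i j :=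
    ⟨fun i j => if hij : i ≠ j then x i j hij else 1, by
      funext i j hij
      exact (dif_pos hij).symm⟩
  refine ⟨hx.exists_isUniversalCentralExtension.{w} hE, fun H _ κ hκ => ?_⟩
  obtain ⟨B, c, y, hB, hs, hc, hy, hcκ, hyκ⟩ :=
    hκ.isCentralExtension.exists_extendedSteinbergRelations.{w} hE hx.relations
  refine ⟨B, hB, c, fun i j k l hij hkl hik hil hjk hjl => ?_,
    fun Q _ π hπ => hc.exists_factor.{w} hE hs hπ, ?_⟩
  · have h : Distinct i j k l := ⟨hij, hik, hil, hjk, hjl, hkl⟩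
    refine ⟨⟨hc.map_add, fun p q => hc.pairing h p q⟩, fun c' hc' => ?_⟩
    refine hE.hom_ext_mul.{w} fun {T} p q => ?_
    rw [← hc'.pairing, hc.pairing h]
  · refine IsCommutatorPairing.imageSubobject_eq_kernelOf.{w} ?_ fun {T} z hz =>
      hκ.locally_mem_image.{w} hx hy hcκ hyκ z hz
    rw [← Category.id_comp c, Category.assoc, hcκ]
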